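/- Consider the class of generalized Burgers equations \[ u_t+u^nu_x+h(t)u=g(t)u_{xx},\qquad ng\neq0, \] whose arbitrary elements are the nonzero real constant $n$ and the smooth functions $h,g$ of $t$, with $g$ vanishing nowhere; $u>0$ is assumed whenever $n$ is not fixed to be $1$. An admissible transformation of a (sub)class is a triple consisting of an initial and a target equation from it and a (local, smooth, nondegenerate) point transformation $\tilde t=T(t,x,u)$, $\tilde x=X(t,x,u)$, $\tilde u=U(t,x,u)$ that maps the first equation to the second. A generalized equivalence transformation of a (sub)class is a (local) point transformation of the space of $(t,x,u)$ and of the arbitrary elements $(n,h,g)$ that maps every equation of the (sub)class to an equation of the same (sub)class, in the sense that its components for $(t,x,u)$, with the arbitrary elements substituted, map the equation with the old arbitrary elements to the equation with the new ones; it is a usual equivalence transformation if its components for $(t,x,u)$ do not depend on the arbitrary elements. The (sub)class is normalized in the usual (resp. generalized) sense if each of its admissible transformations is locally induced by a usual (resp. generalized) equivalence transformation. It is normalized in the extended (resp. generalized extended) sense if it becomes normalized in the usual (resp. generalized) sense after finitely many virtual arbitrary elements $Y=Y(t)$ are added to $(n,h,g)$, which depend on them nonlocally through a smooth system $Y'=F(t,n,h,g,Y)$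 (e.g. antiderivatives). Then the following holds. 1. The entire class, with $n$ varying, is not normalized in any of these four senses. 2. It is partitioned into its subclasses with fixed values of $n\neq0$, and subclasses with different values of $n$ are not connected by point transformations. 3. For each fixed $n\ne 0,1$, the subclass with this value of $n$ is normalized in the usual sense. 4. The subclass with $n=1$, considered either for $u>0$ or for all real $u$, is normalized in the generalized extended sense, but it is not normalized in the usual sense, nor in the generalized sense, nor in the extended sense. 5. Every union of subclasses with fixed values of $n\neq 0,1$ is normalized in the generalized sense. -/

import Mathlib

open scoped ContDiff Topology

namespace GBE

/-- A value of the tuple of arbitrary elements `(n, h, g)` of the class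
`u_t + u ^ n * u_x + h(t) * u = g(t) * u_xx`, `n * g ≠ 0`:
a nonzero constant `n` and two smooth functions `h`, `g` on an open set `dom` of the `t`-axis,
with `g` vanishing nowhere on `dom`. -/
structure Coeffs where
  n : ℝ
  h : ℝ → ℝ
  g : ℝ → ℝ
  dom : Set ℝ
  isOpen_dom : IsOpen dom
  n_ne : n ≠ 0
  smooth_h : ContDiffOn ℝ ∞ h dom
  smooth_g : ContDiffOn ℝ ∞ g dom
  g_ne : ∀ t ∈ dom, g t ≠ 0

/-- The value `(n, h(t), g(t))` of the arbitrary elements at `t`. -/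
def Coeffs.val (θ : Coeffs) (t : ℝ) : ℝ × ℝ × ℝ := (θ.n, θ.h t, θ.g t)

/-- The set of admitted values `(n, h, g)` of the arbitrary elements: `n * g ≠ 0`. -/
def valueSpace : Set (ℝ × ℝ × ℝ) := {v | v.1 ≠ 0 ∧ v.2.2 ≠ 0}

/-- The entire class, the exponent `n` being one of the arbitrary elements. -/
def fullClass : Set Coeffs := Set.univ

/-- The subclass with a fixed value of the exponent. -/
def fixedClass (n : ℝ) : Set Coeffs := {θ | θ.n = n}

/-- The space of the variables `(t, x, u)`. -/
abbrev Pt := ℝ × ℝ × ℝ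

/-- `u_t + u ^ n * u_x + h(t) * u - g(t) * u_xx` for `u = f`, at the point `(t, x)`. -/
noncomputable def pdeResidual (θ : Coeffs) (f : ℝ → ℝ → ℝ) (t x : ℝ) : ℝ :=
  deriv (fun s => f s x) t + f t x ^ θ.n * deriv (f t) x + θ.h t * f t x
    - θ.g t * deriv (deriv (f t)) x

/-- The second prolongation of `φ` maps, over the point `p = (t, x, u)`, the manifold that is
defined by the equation `θ` in the jet space to the manifold defined by the equation `θ'`.
The jets over `p` are represented by smooth functions `f` of `(t, x)` whose graph passes
through `p`. The prolongation of `φ` at the jet of `f` is the jet, at the image point, of the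
function `f'` whose graph is the image of the graph of `f` near `p`. (It is defined if such a
smooth function `f'` exists, that is, for all jets outside of a proper algebraic subset.) -/
def MapsEquation (θ θ' : Coeffs) (φ : Pt → Pt) (p : Pt) : Prop :=
  ∀ f f' : ℝ → ℝ → ℝ,
    f p.1 p.2.1 = p.2.2 →
    ContDiffAt ℝ ∞ (Function.uncurry f) (p.1, p.2.1) →
    ContDiffAt ℝ ∞ (Function.uncurry f') ((φ p).1, (φ p).2.1) →
    (∀ᶠ q : ℝ × ℝ in 𝓝 (p.1, p.2.1),
      f' (φ (q.1, q.2, f q.1 q.2)).1 (φ (q.1, q.2, f q.1 q.2)).2.1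
        = (φ (q.1, q.2, f q.1 q.2)).2.2) →
    (pdeResidual θ f p.1 p.2.1 = 0 ↔ pdeResidual θ' f' (φ p).1 (φ p).2.1 = 0)

/-- `(θ, θ', φ)` is an admissible transformation: `φ` is a (local) point transformation
`t' = T(t, x, u)`, `x' = X(t, x, u)`, `u' = U(t, x, u)`, given on the open set `Ω`,
smooth and with nonvanishing Jacobian, which maps the equation `θ` to the equation `θ'`.
The values of the dependent variable are restricted to `R`, both before and after. -/
structure IsAdmissible (R : Set ℝ) (θ θ' : Coeffs) (φ : Pt → Pt) (Ω : Set Pt) : Prop where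
  isOpen : IsOpen Ω
  source : ∀ p ∈ Ω, p.1 ∈ θ.dom ∧ p.2.2 ∈ R
  target : ∀ p ∈ Ω, (φ p).1 ∈ θ'.dom ∧ (φ p).2.2 ∈ R
  smooth : ContDiffOn ℝ ∞ φ Ω
  nondegenerate : ∀ p ∈ Ω, Function.Bijective (fderiv ℝ φ p)
  maps : ∀ p ∈ Ω, MapsEquation θ θ' φ p

/-- Two subclasses are connected by a point transformation. -/
def Connected (R : Set ℝ) (S S' : Set Coeffs) : Prop :=
  ∃ θ ∈ S, ∃ θ' ∈ S', ∃ (φ : Pt → Pt) (Ω : Set Pt), Ω.Nonempty ∧ IsAdmissible R θ θ' φ Ω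

/-- A reparameterization of the class: `k` virtual arbitrary elements `Y = (Y¹, …, Yᵏ)`,
functions of `t`, are added, which depend nonlocally on `(n, h, g)` through a system
`Y' = F(t, (n, h, g), Y)` with smooth right-hand side. (Successive antiderivatives are
the case of a triangular system.) -/
structure Reparam where
  k : ℕ
  F : ℝ × (ℝ × ℝ × ℝ) × (Fin k → ℝ) → (Fin k → ℝ)
  smooth : ContDiffOn ℝ ∞ F {z | z.2.1 ∈ valueSpace}

/-- `Y` is a value of the virtual arbitrary elements over `θ`. -/
def Reparam.IsLift (A : Reparam) (θ : Coeffs) (Y : ℝ → Fin A.k → ℝ) : Prop :=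
  ∀ t ∈ θ.dom, HasDerivAt Y (A.F (t, θ.val t, Y t)) t

/-- No virtual arbitrary elements. -/
def Reparam.trivial : Reparam where
  k := 0
  F := fun _ => 0
  smooth := contDiffOn_const

/-- The space of the variables and of the values of all the arbitrary elements,
`(t, x, u)`, `(n, h, g)`, `Y`. -/
abbrev Reparam.Space (A : Reparam) := Pt × (ℝ × ℝ × ℝ) × (Fin A.k → ℝ)

/-- `Ψ`, given for `(t, x, u)` in the open set `Ω`, all values of `(n, h, g)` and `Y` in the open
set `B`, is a (local) generalized equivalence transformation of the class `S` reparameterized by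
`A`: it is a nondegenerate point transformation of the space of `(t, x, u, n, h, g, Y)`, and it
maps every equation from the class to an equation from the same class. When the arbitrary
elements `(θ, Y)` are substituted, its components for `t, x, u` give an admissible transformation
of `θ` to some `θ'`, and its other components give the values of `θ'` and of a lift `Y'`. -/
structure IsEquivalence (R : Set ℝ) (S : Set Coeffs) (A : Reparam) (Ω : Set Pt)
    (B : Set (Fin A.k → ℝ)) (Ψ : A.Space → A.Space) : Prop where
  isOpen : IsOpen Ω
  isOpen_lift : IsOpen B
  smooth : ContDiffOn ℝ ∞ Ψ (Ω ×ˢ valueSpace ×ˢ B)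
  nondegenerate : ∀ z ∈ Ω ×ˢ valueSpace ×ˢ B, Function.Bijective (fderiv ℝ Ψ z)
  maps : ∀ θ ∈ S, ∀ Y : ℝ → Fin A.k → ℝ, A.IsLift θ Y →
    ∀ p ∈ Ω, p.1 ∈ θ.dom → p.2.2 ∈ R → Y p.1 ∈ B →
      ∃ θ' ∈ S, ∃ Y' : ℝ → Fin A.k → ℝ, A.IsLift θ' Y' ∧
        ∃ Ω' ⊆ Ω, p ∈ Ω' ∧
          IsAdmissible R θ θ' (fun q => (Ψ (q, θ.val q.1, Y q.1)).1) Ω' ∧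
          ∀ q ∈ Ω', (Ψ (q, θ.val q.1, Y q.1)).2 =
            (θ'.val (Ψ (q, θ.val q.1, Y q.1)).1.1, Y' (Ψ (q, θ.val q.1, Y q.1)).1.1)

/-- The components of `Ψ` for the variables `t, x, u` do not depend on the arbitrary elements. -/
def IsUsual (A : Reparam) (Ω : Set Pt) (B : Set (Fin A.k → ℝ)) (Ψ : A.Space → A.Space) : Prop :=
  ∀ q ∈ Ω, ∀ v ∈ valueSpace, ∀ v' ∈ valueSpace, ∀ y ∈ B, ∀ y' ∈ B,
    (Ψ (q, v, y)).1 = (Ψ (q, v', y')).1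

/-- The admissible transformation `φ` from `(θ, Y)` to `(θ', Y')` is induced, near the point `p`,
by the transformation `Ψ`. -/
def Induces (A : Reparam) (Ψ : A.Space → A.Space) (θ θ' : Coeffs) (Y Y' : ℝ → Fin A.k → ℝ)
    (φ : Pt → Pt) (p : Pt) : Prop :=
  ∀ᶠ q in 𝓝 p, Ψ (q, θ.val q.1, Y q.1) = (φ q, θ'.val (φ q).1, Y' (φ q).1)

/-- The class `S` reparameterized by `A` is normalized in the generalized sense:
every admissible transformation is (locally) induced by a generalized equivalence
transformation. -/
def NormalizedGenVia (R : Set ℝ) (S : Set Coeffs) (A : Reparam) : Prop :=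
  ∀ θ ∈ S, ∀ θ' ∈ S, ∀ Y Y' : ℝ → Fin A.k → ℝ, A.IsLift θ Y → A.IsLift θ' Y' →
    ∀ (φ : Pt → Pt) (Ω : Set Pt), IsAdmissible R θ θ' φ Ω → ∀ p ∈ Ω,
      ∃ (Ω' : Set Pt) (B : Set (Fin A.k → ℝ)) (Ψ : A.Space → A.Space),
        IsEquivalence R S A Ω' B Ψ ∧ p ∈ Ω' ∧ Y p.1 ∈ B ∧ Induces A Ψ θ θ' Y Y' φ p

/-- The class `S` reparameterized by `A` is normalized in the usual sense:
the same, with components for the variables that do not depend on the arbitrary elements. -/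
def NormalizedUsualVia (R : Set ℝ) (S : Set Coeffs) (A : Reparam) : Prop :=
  ∀ θ ∈ S, ∀ θ' ∈ S, ∀ Y Y' : ℝ → Fin A.k → ℝ, A.IsLift θ Y → A.IsLift θ' Y' →
    ∀ (φ : Pt → Pt) (Ω : Set Pt), IsAdmissible R θ θ' φ Ω → ∀ p ∈ Ω,
      ∃ (Ω' : Set Pt) (B : Set (Fin A.k → ℝ)) (Ψ : A.Space → A.Space),
        IsEquivalence R S A Ω' B Ψ ∧ IsUsual A Ω' B Ψ ∧ p ∈ Ω' ∧ Y p.1 ∈ B ∧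
          Induces A Ψ θ θ' Y Y' φ p

/-- Normalized in the usual sense. -/
def NormalizedUsual (R : Set ℝ) (S : Set Coeffs) : Prop :=
  NormalizedUsualVia R S Reparam.trivial

/-- Normalized in the generalized sense. -/
def NormalizedGen (R : Set ℝ) (S : Set Coeffs) : Prop :=
  NormalizedGenVia R S Reparam.trivial

/-- Normalized in the extended sense: the components for the arbitrary elements may depend
nonlocally on the arbitrary elements. -/
def NormalizedExt (R : Set ℝ) (S : Set Coeffs) : Prop :=
  ∃ A : Reparam, NormalizedUsualVia R S A

/-- Normalized in the generalized extended sense: all components may depend nonlocally on the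
arbitrary elements. -/
def NormalizedGenExt (R : Set ℝ) (S : Set Coeffs) : Prop :=
  ∃ A : Reparam, NormalizedGenVia R S A

end GBE

namespace GBE

/-! All admissible transformations of the class can be found explicitly, and every claim is read off
from their form. Write `T, X, U` for the components of a transformation, and a tilde for the target.
At each point the prolonged transformation sends the 2-jets that satisfy the source equation to jets
that satisfy the target equation, and jet coordinates are varied one at a time. The source equation
leaves `u_tt` free, so `T` depends on `t` only (`IsAdmissible.fst_deriv`). Varying `u_xx` gives `g
(X_x + u_x X_u)² = g̃ T_t` for all `u_x`, so `X_u = 0` (`IsAdmissible.snd_deriv`). A second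
difference in `u_x` gives `U_uu = 0` (`IsAdmissible.snd_snd_deriv`). Hence `X = X₁(t) x + X₀(t)` and
`U = A u + B`. Splitting the transformed equation in `u_x`, `u` and `x`, with `power_identity` for
the powers of `u`, yields `IsAdmissible.normal_form`: the exponent is preserved and `A` depends on
`t` only. If `n ≠ 1`, then `B = 0`, `X₁` and `X₀` are constant and `T' Aⁿ = X₁`. If `n = 1`, then
`T' A = X₁` and `T' B = X₁' x + X₀'`, and the coefficients of `B` satisfy linear equations of first
order.

For `n ≠ 1` a transformation is thus given by `T` and two constants `κ, l`, with `A = (κ/T')^(1/n)`.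
The arbitrary elements enter its components for the variables only through `n`. This is a usual
equivalence transformation if `n` is fixed and a generalized one on unions.

For `n = 1` the coefficients of `B` solve the same homogeneous linear equation as `A X₁ exp(-∫h)`
and are constant multiples of it. Integration shows that `X₁` and `X₀` are linear fractional in `Y₂
= ∫ exp(-Y₁)`, where `Y₁ = ∫ h`, with a common denominator. Adding `Y₁, Y₂` to the arbitrary
elements turns these formulas into a generalized equivalence transformation
(`normalizedGenExt_burgers`).

The negative claims use the boost `(t, x + t, u + 1)` of the equation with `n = 1`, `h = 0`, `g =
1`. Its components for `t` and `x` are admissible only where `h = 0`. This rules out components for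
the variables that ignore the arbitrary elements. It also rules out generalized transformations
without virtual elements, because there the first-order relations force `T` and `X` not to depend on
`h`. For varying `n`, the relation `U = u U_u`, valid for all `n ≠ 1`, extends to `n = 1` by
continuity and contradicts the boost. -/

/-! ### Derivatives along curves -/

theorem hasDerivAt_fst_comp {E F : Type*} [NormedAddCommGroup E] [NormedSpace ℝ E]
    [NormedAddCommGroup F] [NormedSpace ℝ F] {c : ℝ → E × F} {c' : E × F} {s : ℝ}
    (h : HasDerivAt c c' s) : HasDerivAt (fun r => (c r).1) c'.1 s :=
  (ContinuousLinearMap.fst ℝ E F).hasFDerivAt.comp_hasDerivAt s h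

theorem hasDerivAt_snd_comp {E F : Type*} [NormedAddCommGroup E] [NormedSpace ℝ E]
    [NormedAddCommGroup F] [NormedSpace ℝ F] {c : ℝ → E × F} {c' : E × F} {s : ℝ}
    (h : HasDerivAt c c' s) : HasDerivAt (fun r => (c r).2) c'.2 s :=
  (ContinuousLinearMap.snd ℝ E F).hasFDerivAt.comp_hasDerivAt s h

/-- The second-order chain rule along a curve. -/
theorem hasDerivAt_comp_curve {E F : Type*} [NormedAddCommGroup E] [NormedSpace ℝ E]
    [NormedAddCommGroup F] [NormedSpace ℝ F] {φ : E → F} {c c' : ℝ → E} {c'' : E} {s : ℝ}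
    (hφ : ContDiffAt ℝ ∞ φ (c s)) (hc : ∀ᶠ r in 𝓝 s, HasDerivAt c (c' r) r)
    (hc' : HasDerivAt c' c'' s) :
    (∀ᶠ r in 𝓝 s, HasDerivAt (fun r => φ (c r)) (fderiv ℝ φ (c r) (c' r)) r) ∧
      HasDerivAt (fun r => fderiv ℝ φ (c r) (c' r))
        (fderiv ℝ (fderiv ℝ φ) (c s) (c' s) (c' s) + fderiv ℝ φ (c s) c'') s := by
  have hcs : HasDerivAt c (c' s) s := hc.self_of_nhds
  constructor
  · have h1 : ∀ᶠ z in 𝓝 (c s), ContDiffAt ℝ 1 φ z :=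
      (hφ.of_le (by exact_mod_cast le_top)).eventually (by simp)
    filter_upwards [hc, hcs.continuousAt.eventually h1] with r hr hr'
    exact (hr'.differentiableAt (by simp)).hasFDerivAt.comp_hasDerivAt r hr
  · have h2 : DifferentiableAt ℝ (fderiv ℝ φ) (c s) :=
      (hφ.fderiv_right (m := 1) (by norm_cast)).differentiableAt (by simp)
    exact (h2.hasFDerivAt.comp_hasDerivAt s hcs).clm_apply hc'

/-! ### Action of a point transformation on 2-jets -/

/-- A quadratic polynomial in `(t, x)` with a prescribed jet at `(t₀, x₀)`. -/
noncomputable def quad (p : Pt) (a b c d : ℝ) (t x : ℝ) : ℝ :=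
  p.2.2 + a * (t - p.1) + b * (x - p.2.1) + c / 2 * (x - p.2.1) ^ 2 + d / 2 * (t - p.1) ^ 2

theorem contDiff_quad (p : Pt) (a b c d : ℝ) :
    ContDiff ℝ ∞ (Function.uncurry (quad p a b c d)) := by
  unfold quad Function.uncurry
  fun_prop

theorem quad_self (p : Pt) (a b c d : ℝ) : quad p a b c d p.1 p.2.1 = p.2.2 := by
  simp [quad]

theorem hasDerivAt_quad_left (p : Pt) (a b c d t x : ℝ) :
    HasDerivAt (fun s => quad p a b c d s x) (a + d * (t - p.1)) t := by
  unfold quad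
  have h : HasDerivAt (fun s : ℝ => s - p.1) 1 t := (hasDerivAt_id t).sub_const _
  have := ((((h.const_mul a).const_add p.2.2).add_const (b * (x - p.2.1))).add_const
    (c / 2 * (x - p.2.1) ^ 2)).add ((h.pow 2).const_mul (d / 2))
  convert! this using 1
  ring

theorem hasDerivAt_quad_right (p : Pt) (a b c d t x : ℝ) :
    HasDerivAt (quad p a b c d t) (b + c * (x - p.2.1)) x := by
  unfold quad
  have h : HasDerivAt (fun s : ℝ => s - p.2.1) 1 x := (hasDerivAt_id x).sub_const _
  have := (((h.const_mul b).const_add (p.2.2 + a * (t - p.1))).add ((h.pow 2).const_mul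
    (c / 2))).add_const (d / 2 * (t - p.1) ^ 2)
  convert! this using 1
  ring

theorem pdeResidual_quad (θ : Coeffs) (p : Pt) (a b c d : ℝ) :
    pdeResidual θ (quad p a b c d) p.1 p.2.1 =
      a + p.2.2 ^ θ.n * b + θ.h p.1 * p.2.2 - θ.g p.1 * c := by
  have h : deriv (quad p a b c d p.1) = fun x => b + c * (x - p.2.1) :=
    funext fun x => (hasDerivAt_quad_right p a b c d p.1 x).deriv
  have h2 : HasDerivAt (fun x => b + c * (x - p.2.1)) c p.2.1 := by
    simpa using (((hasDerivAt_id p.2.1).sub_const p.2.1).const_mul c).const_add b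
  rw [pdeResidual, (hasDerivAt_quad_left p a b c d p.1 p.2.1).deriv, h, h2.deriv, quad_self]
  simp

/-- If the `(t, x)`-components of `φ` restricted to the graph of `f` are nondegenerate at a point,
then the image of the graph is locally the graph of a smooth function. -/
theorem exists_image_graph {φ : Pt → Pt} {p : Pt} (hφ : ContDiffAt ℝ ∞ φ p) {f : ℝ → ℝ → ℝ}
    {a b : ℝ} (hp : f p.1 p.2.1 = p.2.2) (hf : ContDiffAt ℝ ∞ (Function.uncurry f) (p.1, p.2.1))
    (hfa : HasDerivAt (fun s => f s p.2.1) a p.1) (hfb : HasDerivAt (f p.1) b p.2.1)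
    (hΔ : (fderiv ℝ φ p (1, 0, a)).1 * (fderiv ℝ φ p (0, 1, b)).2.1 -
      (fderiv ℝ φ p (0, 1, b)).1 * (fderiv ℝ φ p (1, 0, a)).2.1 ≠ 0) :
    ∃ f' : ℝ → ℝ → ℝ, ContDiffAt ℝ ∞ (Function.uncurry f') ((φ p).1, (φ p).2.1) ∧
      ∀ᶠ q : ℝ × ℝ in 𝓝 (p.1, p.2.1),
        f' (φ (q.1, q.2, f q.1 q.2)).1 (φ (q.1, q.2, f q.1 q.2)).2.1
          = (φ (q.1, q.2, f q.1 q.2)).2.2 := by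
  set q₀ : ℝ × ℝ := (p.1, p.2.1) with hq₀
  have hpe : (q₀.1, q₀.2, f q₀.1 q₀.2) = p := by simp [hq₀, hp]
  set γ : ℝ × ℝ → Pt := fun q => (q.1, q.2, f q.1 q.2) with hγ
  have hγc : ContDiffAt ℝ ∞ γ q₀ := contDiffAt_fst.prodMk (contDiffAt_snd.prodMk hf)
  have hΦc : ContDiffAt ℝ ∞ (fun q => φ (γ q)) q₀ :=
    ContDiffAt.comp q₀ (by rw [hγ]; simpa only [hpe] using hφ) hγc
  -- `G` is the projection of the transformed graph to the new `(t, x)`-plane. The function sought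
  -- is the remaining component composed with a local inverse of `G`.
  set G : ℝ × ℝ → ℝ × ℝ := fun q => ((φ (γ q)).1, (φ (γ q)).2.1) with hG
  have hGc : ContDiffAt ℝ ∞ G q₀ := hΦc.fst.prodMk hΦc.snd.fst
  have hfd : DifferentiableAt ℝ (Function.uncurry f) q₀ := hf.differentiableAt (by simp)
  have ha : fderiv ℝ (Function.uncurry f) q₀ (1, 0) = a := by
    have h1 : HasDerivAt (fun s : ℝ => (s, p.2.1)) ((1 : ℝ), (0 : ℝ)) p.1 :=
      (hasDerivAt_id _).prodMk (hasDerivAt_const _ _)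
    have h2 : HasDerivAt (fun s => f s p.2.1) (fderiv ℝ (Function.uncurry f) q₀ (1, 0)) p.1 :=
      HasFDerivAt.comp_hasDerivAt (l := Function.uncurry f) p.1 hfd.hasFDerivAt h1
    exact h2.unique hfa
  have hb : fderiv ℝ (Function.uncurry f) q₀ (0, 1) = b := by
    have h1 : HasDerivAt (fun s : ℝ => (p.1, s)) ((0 : ℝ), (1 : ℝ)) p.2.1 :=
      (hasDerivAt_const _ _).prodMk (hasDerivAt_id _)
    have h2 : HasDerivAt (f p.1) (fderiv ℝ (Function.uncurry f) q₀ (0, 1)) p.2.1 :=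
      hfd.hasFDerivAt.comp_hasDerivAt p.2.1 h1
    exact h2.unique hfb
  have hγd : HasFDerivAt γ ((ContinuousLinearMap.fst ℝ ℝ ℝ).prod
      ((ContinuousLinearMap.snd ℝ ℝ ℝ).prod (fderiv ℝ (Function.uncurry f) q₀))) q₀ :=
    hasFDerivAt_fst.prodMk (hasFDerivAt_snd.prodMk hfd.hasFDerivAt)
  have hφd : HasFDerivAt φ (fderiv ℝ φ p) (γ q₀) := by
    have : γ q₀ = p := hpe
    rw [this]; exact (hφ.differentiableAt (by simp)).hasFDerivAt
  have hΦd := hφd.comp q₀ hγd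
  have hGd : HasFDerivAt G (fderiv ℝ G q₀) q₀ := (hGc.differentiableAt (by simp)).hasFDerivAt
  have hGv : ∀ v : ℝ × ℝ, fderiv ℝ G q₀ v = ((v.1 • fderiv ℝ φ p (1, 0, a) + v.2 •
      fderiv ℝ φ p (0, 1, b)).1, (v.1 • fderiv ℝ φ p (1, 0, a) + v.2 •
      fderiv ℝ φ p (0, 1, b)).2.1) := by
    intro v
    have h1 : fderiv ℝ G q₀ = _ := (hΦd.fst.prodMk hΦd.snd.fst).fderiv
    have h2 : fderiv ℝ (Function.uncurry f) q₀ v = v.1 * a + v.2 * b := by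
      rw [← ha, ← hb]
      have : v = v.1 • ((1 : ℝ), (0 : ℝ)) + v.2 • ((0 : ℝ), (1 : ℝ)) := by ext <;> simp
      conv_lhs => rw [this, map_add, map_smul, map_smul]
      simp
    have h3 : ((v.1, v.2, v.1 * a + v.2 * b) : Pt) = v.1 • ((1, 0, a) : Pt) +
        v.2 • ((0, 1, b) : Pt) := by ext <;> simp
    rw [h1, ← map_smul, ← map_smul, ← map_add, ← h3]
    simp [h2]
  -- The quantity in `hΔ` is the Jacobian determinant of `G`; `e1` and `e2` are Cramer's rule.
  have hinj : Function.Injective (fderiv ℝ G q₀) := by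
    rw [injective_iff_map_eq_zero]
    intro v hv
    rw [hGv] at hv
    simp only [Prod.fst_add, Prod.smul_fst, smul_eq_mul, Prod.snd_add, Prod.smul_snd,
      Prod.mk_eq_zero] at hv
    obtain ⟨h1, h2⟩ := hv
    have e1 : v.1 * ((fderiv ℝ φ p (1, 0, a)).1 * (fderiv ℝ φ p (0, 1, b)).2.1 -
      (fderiv ℝ φ p (0, 1, b)).1 * (fderiv ℝ φ p (1, 0, a)).2.1) = 0 := by
      linear_combination (fderiv ℝ φ p (0, 1, b)).2.1 * h1 - (fderiv ℝ φ p (0, 1, b)).1 * h2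
    have e2 : v.2 * ((fderiv ℝ φ p (1, 0, a)).1 * (fderiv ℝ φ p (0, 1, b)).2.1 -
      (fderiv ℝ φ p (0, 1, b)).1 * (fderiv ℝ φ p (1, 0, a)).2.1) = 0 := by
      linear_combination (fderiv ℝ φ p (1, 0, a)).1 * h2 - (fderiv ℝ φ p (1, 0, a)).2.1 * h1
    ext
    · exact (mul_eq_zero.1 e1).resolve_right hΔ
    · exact (mul_eq_zero.1 e2).resolve_right hΔ
  set e : (ℝ × ℝ) ≃L[ℝ] (ℝ × ℝ) :=
    (LinearEquiv.ofInjectiveEndo (fderiv ℝ G q₀ : ℝ × ℝ →ₗ[ℝ] ℝ × ℝ)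
      hinj).toContinuousLinearEquiv with he
  have hGe : HasFDerivAt G (e : ℝ × ℝ →L[ℝ] ℝ × ℝ) q₀ := by
    convert! hGd using 1
  set σ := hGc.localInverse hGe (by simp) with hσ
  have hσc : ContDiffAt ℝ ∞ σ (G q₀) := hGc.to_localInverse hGe (by simp)
  have hσ0 : σ (G q₀) = q₀ := hGc.localInverse_apply_image hGe (by simp)
  have hσl : ∀ᶠ q in 𝓝 q₀, σ (G q) = q :=
    (hGc.hasStrictFDerivAt' hGe (by simp)).eventually_left_inverse
  refine ⟨fun y z => (φ (γ (σ (y, z)))).2.2, ?_, ?_⟩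
  · have hG0 : G q₀ = ((φ p).1, (φ p).2.1) := by simp only [hG, hγ, hpe]
    rw [← hG0]
    have : ContDiffAt ℝ ∞ (fun q => (φ (γ q)).2.2) (σ (G q₀)) := by
      rw [hσ0]; exact hΦc.snd.snd
    exact this.comp (G q₀) hσc
  · filter_upwards [hσl] with q hq
    change (φ (γ (σ (G q)))).2.2 = _
    rw [hq]

/-- The action of the second prolongation of `φ` on jets, in a given direction. -/
theorem jet_relation {φ : Pt → Pt} {p : Pt} (hφ : ContDiffAt ℝ ∞ φ p) {a b c d : ℝ}
    {f' : ℝ → ℝ → ℝ} (hf' : ContDiffAt ℝ ∞ (Function.uncurry f') ((φ p).1, (φ p).2.1))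
    (hgraph : ∀ᶠ q : ℝ × ℝ in 𝓝 (p.1, p.2.1),
        f' (φ (q.1, q.2, quad p a b c d q.1 q.2)).1 (φ (q.1, q.2, quad p a b c d q.1 q.2)).2.1
          = (φ (q.1, q.2, quad p a b c d q.1 q.2)).2.2) (τ ξ : ℝ) (w M : Pt)
    (hw : w = (τ, ξ, a * τ + b * ξ))
    (hM : M = fderiv ℝ (fderiv ℝ φ) p w w + (c * ξ ^ 2 + d * τ ^ 2) • fderiv ℝ φ p (0, 0, 1))
    (D : ℝ × ℝ →L[ℝ] ℝ) (D2 : ℝ × ℝ →L[ℝ] ℝ × ℝ →L[ℝ] ℝ)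
    (hD : D = fderiv ℝ (Function.uncurry f') ((φ p).1, (φ p).2.1))
    (hD2 : D2 = fderiv ℝ (fderiv ℝ (Function.uncurry f')) ((φ p).1, (φ p).2.1)) :
    D ((fderiv ℝ φ p w).1, (fderiv ℝ φ p w).2.1) = (fderiv ℝ φ p w).2.2 ∧
    D2 ((fderiv ℝ φ p w).1, (fderiv ℝ φ p w).2.1) ((fderiv ℝ φ p w).1, (fderiv ℝ φ p w).2.1)
      + D (M.1, M.2.1) = M.2.2 := by
  set κ := c * ξ ^ 2 + d * τ ^ 2 with hκ
  -- The curve on the graph of the quadratic over the line through `(p.1, p.2.1)` in the direction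
  -- `(τ, ξ)`. The identity expressing that the image lies on the graph of `f'` is differentiated
  -- along it once and twice.
  set Γ : ℝ → Pt := fun s => (p.1 + τ * s, p.2.1 + ξ * s, p.2.2 + (a * τ + b * ξ) * s
    + κ / 2 * s ^ 2) with hΓ
  set Γ' : ℝ → Pt := fun s => (τ, ξ, a * τ + b * ξ + κ * s) with hΓ'
  have hΓ0 : Γ 0 = p := by simp [hΓ]
  have hΓ'0 : Γ' 0 = w := by simp [hΓ', hw]
  have hΓd : ∀ s, HasDerivAt Γ (Γ' s) s := by
    intro s
    have h := hasDerivAt_id s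
    refine HasDerivAt.prodMk ?_ (HasDerivAt.prodMk ?_ ?_)
    · simpa using (h.const_mul τ).const_add p.1
    · simpa using (h.const_mul ξ).const_add p.2.1
    · have := ((h.const_mul (a * τ + b * ξ)).const_add p.2.2).add ((h.pow 2).const_mul (κ / 2))
      convert! this using 1
      simp
      ring
  have hΓ'd : HasDerivAt Γ' (0, 0, κ) 0 := by
    refine (hasDerivAt_const _ _).prodMk ((hasDerivAt_const _ _).prodMk ?_)
    simpa using ((hasDerivAt_id (0 : ℝ)).const_mul κ).const_add (a * τ + b * ξ)
  obtain ⟨k1, k2⟩ := hasDerivAt_comp_curve (φ := φ) (by rwa [hΓ0])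
    (Filter.Eventually.of_forall hΓd) hΓ'd
  set Φ' : ℝ → Pt := fun r => fderiv ℝ φ (Γ r) (Γ' r) with hΦ'
  have hΦ'0 : Φ' 0 = fderiv ℝ φ p w := by simp only [hΦ', hΓ0, hΓ'0]
  have hM' : fderiv ℝ (fderiv ℝ φ) (Γ 0) (Γ' 0) (Γ' 0) + fderiv ℝ φ (Γ 0) (0, 0, κ) = M := by
    have : ((0, 0, κ) : Pt) = κ • ((0, 0, 1) : Pt) := by ext <;> simp
    rw [hΓ0, hΓ'0, hM, this, map_smul]
  rw [hM'] at k2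
  obtain ⟨l1, l2⟩ := hasDerivAt_comp_curve (φ := Function.uncurry f')
    (c := fun s => ((φ (Γ s)).1, (φ (Γ s)).2.1)) (c' := fun s => ((Φ' s).1, (Φ' s).2.1))
    (c'' := (M.1, M.2.1)) (s := 0) (by simpa only [hΓ0] using hf')
    (k1.mono fun r hr => (hasDerivAt_fst_comp hr).prodMk
      (hasDerivAt_fst_comp (hasDerivAt_snd_comp hr))) ((hasDerivAt_fst_comp k2).prodMk
      (hasDerivAt_fst_comp (hasDerivAt_snd_comp k2)))
  have hcont : Filter.Tendsto (fun s : ℝ => ((Γ s).1, (Γ s).2.1)) (𝓝 0) (𝓝 (p.1, p.2.1)) := by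
    have := ((hasDerivAt_fst_comp (hΓd 0)).prodMk
      (hasDerivAt_fst_comp (hasDerivAt_snd_comp (hΓd 0)))).continuousAt
    simpa [ContinuousAt, hΓ0] using this
  have heq : ∀ᶠ s in 𝓝 (0 : ℝ), Function.uncurry f' ((φ (Γ s)).1, (φ (Γ s)).2.1)
      = (φ (Γ s)).2.2 := by
    filter_upwards [hcont.eventually hgraph] with s hs
    have : quad p a b c d (Γ s).1 (Γ s).2.1 = (Γ s).2.2 := by
      simp only [quad, hΓ, hκ]; ring
    rw [this] at hs
    exact hs
  have heq' := heq.eventually_nhds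
  have hder : ∀ᶠ s in 𝓝 (0 : ℝ), fderiv ℝ (Function.uncurry f') ((φ (Γ s)).1, (φ (Γ s)).2.1)
      ((Φ' s).1, (Φ' s).2.1) = (Φ' s).2.2 := by
    filter_upwards [heq', k1, l1] with s h1 h2 h3
    exact h3.unique ((hasDerivAt_snd_comp (hasDerivAt_snd_comp h2)).congr_of_eventuallyEq h1)
  have h0 := hder.self_of_nhds
  have h2 := l2.unique ((hasDerivAt_snd_comp (hasDerivAt_snd_comp k2)).congr_of_eventuallyEq hder)
  simp only [hΦ'0, hΓ0, ← hD, ← hD2] at h0 h2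
  exact ⟨h0, h2⟩

theorem pdeResidual_eq_fderiv (θ : Coeffs) {f : ℝ → ℝ → ℝ} {t x : ℝ}
    (hf : ContDiffAt ℝ ∞ (Function.uncurry f) (t, x)) :
    pdeResidual θ f t x = fderiv ℝ (Function.uncurry f) (t, x) (1, 0) +
      f t x ^ θ.n * fderiv ℝ (Function.uncurry f) (t, x) (0, 1) + θ.h t * f t x -
      θ.g t * fderiv ℝ (fderiv ℝ (Function.uncurry f)) (t, x) (0, 1) (0, 1) := by
  have h1 : HasDerivAt (fun s : ℝ => (s, x)) ((1 : ℝ), (0 : ℝ)) t :=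
    (hasDerivAt_id _).prodMk (hasDerivAt_const _ _)
  have h2 : ∀ y, HasDerivAt (fun s : ℝ => (t, s)) ((0 : ℝ), (1 : ℝ)) y := fun y =>
    (hasDerivAt_const _ _).prodMk (hasDerivAt_id _)
  have e1 := ((hf.differentiableAt (by simp)).hasFDerivAt.comp_hasDerivAt t h1).deriv
  obtain ⟨k1, k2⟩ := hasDerivAt_comp_curve (φ := Function.uncurry f) (s := x) hf
    (Filter.Eventually.of_forall h2) (hasDerivAt_const x _)
  have e2 : deriv (f t) =ᶠ[𝓝 x] fun r => fderiv ℝ (Function.uncurry f) (t, r) (0, 1) := by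
    filter_upwards [k1] with r hr using hr.deriv
  have e3 := e2.deriv_eq
  rw [k2.deriv] at e3
  simp only [map_zero, add_zero] at e3
  rw [pdeResidual, e3, e2.self_of_nhds]
  congr 3

/-- The coordinate form of the condition that an equation is mapped to an equation:
for every jet `(a, b, c, d)` of the values of `u_t`, `u_x`, `u_xx`, `u_tt`. -/
theorem MapsEquation.jet {θ θ' : Coeffs} {φ : Pt → Pt} {p : Pt} (h : MapsEquation θ θ' φ p)
    (hφ : ContDiffAt ℝ ∞ φ p) {a b : ℝ}
    (hΔ : (fderiv ℝ φ p (1, 0, a)).1 * (fderiv ℝ φ p (0, 1, b)).2.1 -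
      (fderiv ℝ φ p (0, 1, b)).1 * (fderiv ℝ φ p (1, 0, a)).2.1 ≠ 0) (c d τ ξ : ℝ)
    (w M : Pt) (hw : w = (τ, ξ, a * τ + b * ξ))
    (hM : M = fderiv ℝ (fderiv ℝ φ) p w w + (c * ξ ^ 2 + d * τ ^ 2) • fderiv ℝ φ p (0, 0, 1))
    (h0 : (fderiv ℝ φ p w).1 = 0)
    (hres : a + p.2.2 ^ θ.n * b + θ.h p.1 * p.2.2 - θ.g p.1 * c = 0) :
    ∃ q₁ q₂ r : ℝ,
      q₁ * (fderiv ℝ φ p (1, 0, a)).1 + q₂ * (fderiv ℝ φ p (1, 0, a)).2.1 =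
        (fderiv ℝ φ p (1, 0, a)).2.2 ∧
      q₁ * (fderiv ℝ φ p (0, 1, b)).1 + q₂ * (fderiv ℝ φ p (0, 1, b)).2.1 =
        (fderiv ℝ φ p (0, 1, b)).2.2 ∧
      r * (fderiv ℝ φ p w).2.1 ^ 2 + q₁ * M.1 + q₂ * M.2.1 = M.2.2 ∧
      q₁ + (φ p).2.2 ^ θ'.n * q₂ + θ'.h (φ p).1 * (φ p).2.2 - θ'.g (φ p).1 * r = 0 := by
  obtain ⟨f', hf', hgr⟩ := exists_image_graph hφ (quad_self p a b c d)
    (contDiff_quad p a b c d).contDiffAt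
    (by simpa using hasDerivAt_quad_left p a b c d p.1 p.2.1)
    (by simpa using hasDerivAt_quad_right p a b c d p.1 p.2.1) hΔ
  have hm := (h _ f' (quad_self p a b c d) (contDiff_quad p a b c d).contDiffAt hf' hgr).1
    (by rw [pdeResidual_quad]; exact hres)
  have hval : f' (φ p).1 (φ p).2.1 = (φ p).2.2 := by
    have := hgr.self_of_nhds
    simpa only [quad_self] using this
  rw [pdeResidual_eq_fderiv θ' hf', hval] at hm
  set D := fderiv ℝ (Function.uncurry f') ((φ p).1, (φ p).2.1) with hD
  set D2 := fderiv ℝ (fderiv ℝ (Function.uncurry f')) ((φ p).1, (φ p).2.1) with hD2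
  have hDv : ∀ y z : ℝ, D (y, z) = D (1, 0) * y + D (0, 1) * z := by
    intro y z
    have : ((y, z) : ℝ × ℝ) = y • ((1 : ℝ), (0 : ℝ)) + z • ((0 : ℝ), (1 : ℝ)) := by ext <;> simp
    rw [this, map_add, map_smul, map_smul]; simp; ring
  have j1 := (jet_relation hφ hf' hgr 1 0 (1, 0, a) _ (by simp) rfl D D2 hD hD2).1
  have j2 := (jet_relation hφ hf' hgr 0 1 (0, 1, b) _ (by simp) rfl D D2 hD hD2).1
  have j3 := (jet_relation hφ hf' hgr τ ξ w M hw hM D D2 hD hD2).2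
  rw [hDv] at j1 j2 j3
  refine ⟨D (1, 0), D (0, 1), D2 (0, 1) (0, 1), j1, j2, ?_, hm⟩
  -- By `h0` the image direction has no `t`-component, so `f'_xx` is the only second derivative of
  -- `f'` that enters.
  have : (((fderiv ℝ φ p w).1, (fderiv ℝ φ p w).2.1) : ℝ × ℝ) =
      (fderiv ℝ φ p w).2.1 • ((0 : ℝ), (1 : ℝ)) := by ext <;> simp [h0]
  rw [this] at j3
  simp only [map_smul, smul_apply, smul_eq_mul] at j3
  linear_combination j3

/-! ### Pointwise conditions on the derivatives of an admissible transformation -/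

theorem pt_eq (v : Pt) :
    v = v.1 • ((1, 0, 0) : Pt) + v.2.1 • ((0, 1, 0) : Pt) + v.2.2 • ((0, 0, 1) : Pt) := by
  ext <;> simp

theorem clm_pt_apply {E : Type*} [NormedAddCommGroup E] [NormedSpace ℝ E] (L : Pt →L[ℝ] E)
    (v : Pt) : L v = v.1 • L (1, 0, 0) + v.2.1 • L (0, 1, 0) + v.2.2 • L (0, 0, 1) := by
  conv_lhs => rw [pt_eq v]
  simp only [map_add, map_smul]

section Jets

variable {R : Set ℝ} {θ θ' : Coeffs} {φ : Pt → Pt} {Ω : Set Pt} {p : Pt}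

/-- A conormal of the image of the tangent plane of a graph does not vanish on the image
of the vertical direction. -/
theorem conormal_vertical_ne {L : Pt →L[ℝ] Pt} (hL : Function.Bijective L) {a b q₁ q₂ : ℝ}
    (h1 : q₁ * (L (1, 0, a)).1 + q₂ * (L (1, 0, a)).2.1 = (L (1, 0, a)).2.2)
    (h2 : q₁ * (L (0, 1, b)).1 + q₂ * (L (0, 1, b)).2.1 = (L (0, 1, b)).2.2) :
    (L (0, 0, 1)).2.2 - q₁ * (L (0, 0, 1)).1 - q₂ * (L (0, 0, 1)).2.1 ≠ 0 := by
  intro h3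
  obtain ⟨v, hv⟩ := hL.2 (0, 0, 1)
  rw [clm_pt_apply L (1, 0, a)] at h1
  rw [clm_pt_apply L (0, 1, b)] at h2
  rw [clm_pt_apply L v] at hv
  have e1 := congrArg Prod.fst hv
  have e2 := congrArg (fun z : Pt => z.2.1) hv
  have e3 := congrArg (fun z : Pt => z.2.2) hv
  simp only [Prod.fst_add, Prod.snd_add, Prod.smul_fst, Prod.smul_snd, smul_eq_mul, one_mul,
    zero_mul, add_zero, zero_add] at h1 h2 e1 e2 e3
  -- The covector `(-q₁, -q₂, 1)` annihilates the images of three spanning vectors, hence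
  -- everything, but its value on `L v = (0, 0, 1)` is `1`.
  have : (0 : ℝ) = 1 := by
    linear_combination e3 - q₁ * e1 - q₂ * e2 + v.1 * h1 + v.2.1 * h2
      - (v.2.2 - a * v.1 - b * v.2.1) * h3
  norm_num at this

theorem IsAdmissible.contDiffAt (H : IsAdmissible R θ θ' φ Ω) (hp : p ∈ Ω) :
    ContDiffAt ℝ ∞ φ p :=
  H.smooth.contDiffAt (H.isOpen.mem_nhds hp)

/-- The source equation does not involve `u_tt`, so it admits jets that differ only in this
coordinate. Their images have the same first derivatives, hence, by the target equation and `g̃ ≠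
0`, the same `f'_xx`. If the `t`-component of the image of `(0, 1, b)` were nonzero, `u_tt` would
enter the relation for `f'_xx` with a factor that `conormal_vertical_ne` keeps from vanishing. -/
theorem IsAdmissible.fst_graph_eq_zero (H : IsAdmissible R θ θ' φ Ω) (hp : p ∈ Ω) {a b : ℝ}
    (hΔ : (fderiv ℝ φ p (1, 0, a)).1 * (fderiv ℝ φ p (0, 1, b)).2.1 -
      (fderiv ℝ φ p (0, 1, b)).1 * (fderiv ℝ φ p (1, 0, a)).2.1 ≠ 0) :
    (fderiv ℝ φ p (0, 1, b)).1 = 0 := by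
  by_contra hs
  have hg : θ.g p.1 ≠ 0 := θ.g_ne _ (H.source p hp).1
  have hg' : θ'.g (φ p).1 ≠ 0 := θ'.g_ne _ (H.target p hp).1
  set L := fderiv ℝ φ p with hL
  set c := (a + p.2.2 ^ θ.n * b + θ.h p.1 * p.2.2) / θ.g p.1 with hc
  -- `(τ, ξ)` spans the direction in the tangent plane of the graph whose image has zero
  -- `t`-component. By the assumption to be refuted, `τ ≠ 0`.
  set τ := -(L (0, 1, b)).1 with hτ
  set ξ := (L (1, 0, a)).1 with hξ
  set w : Pt := (τ, ξ, a * τ + b * ξ) with hw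
  have hLw : L w = τ • L (1, 0, a) + ξ • L (0, 1, b) := by
    rw [← map_smul, ← map_smul, ← map_add]
    congr 1
    ext <;> simp [hw]
    ring
  have hw1 : (L w).1 = 0 := by
    rw [hLw]; simp [hτ, hξ]; ring
  have hw2 : (L w).2.1 = ξ * (L (0, 1, b)).2.1 + τ * (L (1, 0, a)).2.1 := by
    rw [hLw]; simp; ring
  have hres : a + p.2.2 ^ θ.n * b + θ.h p.1 * p.2.2 - θ.g p.1 * c = 0 := by
    rw [hc]; field_simp; ring
  obtain ⟨q₁, q₂, r, a1, a2, a3, a4⟩ := (H.maps p hp).jet (H.contDiffAt hp) hΔ c 0 τ ξ w _ hw rfl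
    hw1 hres
  obtain ⟨s₁, s₂, r', b1, b2, b3, b4⟩ := (H.maps p hp).jet (H.contDiffAt hp) hΔ c 1 τ ξ w _ hw rfl
    hw1 hres
  simp only [← hL] at a1 a2 a3 b1 b2 b3 hΔ
  have e1 : s₁ = q₁ := by
    apply mul_right_cancel₀ hΔ
    linear_combination (L (0, 1, b)).2.1 * (b1 - a1) - (L (1, 0, a)).2.1 * (b2 - a2)
  have e2 : s₂ = q₂ := by
    apply mul_right_cancel₀ hΔ
    linear_combination (L (1, 0, a)).1 * (b2 - a2) - (L (0, 1, b)).1 * (b1 - a1)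
  subst e1 e2
  have e3 : r' = r := by
    apply mul_left_cancel₀ hg'
    linear_combination a4 - b4
  subst e3
  have hne := conormal_vertical_ne (H.nondegenerate p hp) a1 a2
  simp only [← hL] at hne
  apply hne
  simp only [Prod.fst_add, Prod.snd_add, Prod.smul_fst, Prod.smul_snd, smul_eq_mul] at a3 b3
  have hτ0 : τ ^ 2 ≠ 0 := pow_ne_zero 2 (neg_ne_zero.2 hs)
  apply mul_left_cancel₀ hτ0
  linear_combination a3 - b3

/-- The `t`-component of an admissible transformation depends only on `t`. -/
theorem IsAdmissible.fst_deriv (H : IsAdmissible R θ θ' φ Ω) (hp : p ∈ Ω) :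
    (fderiv ℝ φ p (0, 1, 0)).1 = 0 ∧ (fderiv ℝ φ p (0, 0, 1)).1 = 0 ∧
      (fderiv ℝ φ p (1, 0, 0)).1 ≠ 0 := by
  have key := fun a b => H.fst_graph_eq_zero hp (a := a) (b := b)
  have hbij := H.nondegenerate p hp
  set L := fderiv ℝ φ p with hL
  obtain ⟨Tt, ht⟩ : ∃ y, y = (L (1, 0, 0)).1 := ⟨_, rfl⟩
  obtain ⟨Tx, hx⟩ : ∃ y, y = (L (0, 1, 0)).1 := ⟨_, rfl⟩
  obtain ⟨Tu, hu⟩ : ∃ y, y = (L (0, 0, 1)).1 := ⟨_, rfl⟩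
  obtain ⟨Xt, hXt⟩ : ∃ y, y = (L (1, 0, 0)).2.1 := ⟨_, rfl⟩
  obtain ⟨Xx, hXx⟩ : ∃ y, y = (L (0, 1, 0)).2.1 := ⟨_, rfl⟩
  obtain ⟨Xu, hXu⟩ : ∃ y, y = (L (0, 0, 1)).2.1 := ⟨_, rfl⟩
  -- The determinant is affine in `(a, b)`, and its coefficients are, up to sign, the `2 × 2` minors
  -- of the first two rows of the Jacobian matrix. They do not all vanish, since these rows are
  -- independent.
  have key' : ∀ a b : ℝ, (Tt * Xx - Tx * Xt) + a * (Tu * Xx - Tx * Xu) +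
      b * (Tt * Xu - Tu * Xt) ≠ 0 → Tx + b * Tu = 0 := by
    intro a b h
    have k := key a b
    rw [clm_pt_apply L (1, 0, a), clm_pt_apply L (0, 1, b)] at k
    simp only [Prod.fst_add, Prod.snd_add, Prod.smul_fst, Prod.smul_snd, smul_eq_mul, one_mul,
      zero_mul, add_zero, zero_add, ← ht, ← hx, ← hu, ← hXt, ← hXx, ← hXu] at k
    exact k fun h' => h (by linear_combination h')
  have hminor : ¬ (Tt * Xx - Tx * Xt = 0 ∧ Tu * Xx - Tx * Xu = 0 ∧ Tt * Xu - Tu * Xt = 0) := by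
    rintro ⟨m1, m2, m3⟩
    obtain ⟨v, hv⟩ := hbij.2 (1, 0, 0)
    obtain ⟨w, hw⟩ := hbij.2 (0, 1, 0)
    rw [clm_pt_apply L v] at hv
    rw [clm_pt_apply L w] at hw
    have e1 := congrArg Prod.fst hv
    have e2 := congrArg (fun z : Pt => z.2.1) hv
    have f1 := congrArg Prod.fst hw
    have f2 := congrArg (fun z : Pt => z.2.1) hw
    simp only [Prod.fst_add, Prod.snd_add, Prod.smul_fst, Prod.smul_snd, smul_eq_mul,
      ← ht, ← hx, ← hu, ← hXt, ← hXx, ← hXu] at e1 e2 f1 f2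
    have h01 : (v.1 * Tt + v.2.1 * Tx + v.2.2 * Tu) * (w.1 * Xt + w.2.1 * Xx + w.2.2 * Xu) -
      (v.1 * Xt + v.2.1 * Xx + v.2.2 * Xu) * (w.1 * Tt + w.2.1 * Tx + w.2.2 * Tu) = 1 := by
      rw [e1, e2, f1, f2]; norm_num
    have : (0 : ℝ) = 1 := by
      linear_combination h01 - (v.1 * w.2.1 - v.2.1 * w.1) * m1 -
        (v.1 * w.2.2 - v.2.2 * w.1) * m3 - (v.2.2 * w.2.1 - v.2.1 * w.2.2) * m2
    norm_num at this
  have hex : ∃ a b : ℝ, (Tt * Xx - Tx * Xt) + a * (Tu * Xx - Tx * Xu) +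
      b * (Tt * Xu - Tu * Xt) ≠ 0 := by
    by_contra! hcon
    have h00 := hcon 0 0
    have h10 := hcon 1 0
    have h01 := hcon 0 1
    exact hminor ⟨by linarith, by linarith, by linarith⟩
  obtain ⟨a, b, hab⟩ := hex
  -- An affine function of `b` with two zeros vanishes identically, so a second admissible slope
  -- exists. Two slopes determine both `Tx` and `Tu`.
  have hex2 : ∃ b', b' ≠ b ∧ (Tt * Xx - Tx * Xt) + a * (Tu * Xx - Tx * Xu) +
      b' * (Tt * Xu - Tu * Xt) ≠ 0 := by
    by_contra! hcon
    have h1 := hcon (b + 1) (by simp)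
    have h2 := hcon (b + 2) (by simp)
    exact hab (by linarith)
  obtain ⟨b', hbb, hab'⟩ := hex2
  have r1 := key' a b hab
  have r2 := key' a b' hab'
  have hTu : Tu = 0 := by
    apply mul_left_cancel₀ (sub_ne_zero.2 hbb)
    linear_combination r2 - r1
  have hTx : Tx = 0 := by rw [hTu] at r1; linarith
  refine ⟨by rw [← hx, hTx], by rw [← hu, hTu], ?_⟩
  rw [← ht]
  intro h
  exact hminor ⟨by rw [h, hTx]; ring, by rw [hTu, hTx]; ring, by rw [h, hTu]; ring⟩

theorem IsAdmissible.fst_graph (H : IsAdmissible R θ θ' φ Ω) (hp : p ∈ Ω) (a : ℝ) :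
    (fderiv ℝ φ p (1, 0, a)).1 = (fderiv ℝ φ p (1, 0, 0)).1 ∧ (fderiv ℝ φ p (0, 1, a)).1 = 0 := by
  obtain ⟨h1, h2, -⟩ := H.fst_deriv hp
  rw [clm_pt_apply _ (1, 0, a), clm_pt_apply _ (0, 1, a)]
  simp [h1, h2]

/-- If a component of a partial derivative vanishes locally, so do the derivatives of this
component. -/
theorem snd_deriv_eq_zero {P : Pt →L[ℝ] ℝ} {e : Pt} (hφ : ContDiffAt ℝ ∞ φ p)
    (h : ∀ᶠ q in 𝓝 p, P (fderiv ℝ φ q e) = 0) (v : Pt) :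
    P (fderiv ℝ (fderiv ℝ φ) p v e) = 0 := by
  have h2 : DifferentiableAt ℝ (fderiv ℝ φ) p :=
    (hφ.fderiv_right (m := 1) (by norm_cast)).differentiableAt (by simp)
  have h2' := h2.hasFDerivAt.clm_apply (hasFDerivAt_const e p)
  have h3 := HasFDerivAt.comp p P.hasFDerivAt h2'
  have h0 : HasFDerivAt (fun _ : Pt => (0 : ℝ)) (0 : Pt →L[ℝ] ℝ) p := hasFDerivAt_const 0 p
  have h4 : HasFDerivAt (fun q => P (fderiv ℝ φ q e)) 0 p := h0.congr_of_eventuallyEq h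
  have := congrArg (fun L : Pt →L[ℝ] ℝ => L v) (h3.unique h4)
  simpa using this

theorem IsAdmissible.fst_snd_deriv (H : IsAdmissible R θ θ' φ Ω) (hp : p ∈ Ω) (v : Pt) (b : ℝ) :
    (fderiv ℝ (fderiv ℝ φ) p v (0, 1, b)).1 = 0 :=
  snd_deriv_eq_zero (P := ContinuousLinearMap.fst ℝ ℝ (ℝ × ℝ)) (H.contDiffAt hp)
    (by filter_upwards [H.isOpen.mem_nhds hp] with q hq using (H.fst_graph hq b).2) v

/-- The conditions on the derivatives of an admissible transformation, once it is known that its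
`t`-component depends only on `t`. -/
theorem IsAdmissible.jet_conditions (H : IsAdmissible R θ θ' φ Ω) (hp : p ∈ Ω) {b : ℝ} (c : ℝ)
    (hb : (fderiv ℝ φ p (0, 1, b)).2.1 ≠ 0) :
    ∃ q₁ q₂ r a : ℝ, a + p.2.2 ^ θ.n * b + θ.h p.1 * p.2.2 - θ.g p.1 * c = 0 ∧
      q₁ * (fderiv ℝ φ p (1, 0, 0)).1 + q₂ * (fderiv ℝ φ p (1, 0, a)).2.1 =
        (fderiv ℝ φ p (1, 0, a)).2.2 ∧
      q₂ * (fderiv ℝ φ p (0, 1, b)).2.1 = (fderiv ℝ φ p (0, 1, b)).2.2 ∧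
      r * (fderiv ℝ φ p (0, 1, b)).2.1 ^ 2 + q₂ * ((fderiv ℝ (fderiv ℝ φ) p (0, 1, b)
          (0, 1, b)).2.1 + c * (fderiv ℝ φ p (0, 0, 1)).2.1) =
        (fderiv ℝ (fderiv ℝ φ) p (0, 1, b) (0, 1, b)).2.2 + c * (fderiv ℝ φ p (0, 0, 1)).2.2 ∧
      q₁ + (φ p).2.2 ^ θ'.n * q₂ + θ'.h (φ p).1 * (φ p).2.2 - θ'.g (φ p).1 * r = 0 ∧
      (fderiv ℝ φ p (0, 0, 1)).2.2 - q₂ * (fderiv ℝ φ p (0, 0, 1)).2.1 ≠ 0 := by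
  obtain ⟨a, ha⟩ : ∃ a, a = θ.g p.1 * c - p.2.2 ^ θ.n * b - θ.h p.1 * p.2.2 := ⟨_, rfl⟩
  have hres : a + p.2.2 ^ θ.n * b + θ.h p.1 * p.2.2 - θ.g p.1 * c = 0 := by rw [ha]; ring
  obtain ⟨-, hu, ht⟩ := H.fst_deriv hp
  have h1 := (H.fst_graph hp a).1
  have h2 := (H.fst_graph hp b).2
  have hS := H.fst_snd_deriv hp (0, 1, b) b
  have hΔ : (fderiv ℝ φ p (1, 0, a)).1 * (fderiv ℝ φ p (0, 1, b)).2.1 -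
      (fderiv ℝ φ p (0, 1, b)).1 * (fderiv ℝ φ p (1, 0, a)).2.1 ≠ 0 := by
    rw [h1, h2]; simpa using ⟨ht, hb⟩
  obtain ⟨q₁, q₂, r, e1, e2, e3, e4⟩ := (H.maps p hp).jet (H.contDiffAt hp) hΔ c 0 0 1 (0, 1, b) _
    (by simp) rfl h2 hres
  have hne := conormal_vertical_ne (H.nondegenerate p hp) e1 e2
  simp only [Prod.fst_add, Prod.snd_add, Prod.smul_fst, Prod.smul_snd, smul_eq_mul, h1, h2, hu,
    hS] at e1 e2 e3 hne
  refine ⟨q₁, q₂, r, a, hres, e1, by linarith, by linarith, e4, fun h => hne (by linarith)⟩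

/-- The `x`-component of an admissible transformation depends only on `(t, x)`. -/
theorem IsAdmissible.snd_deriv (H : IsAdmissible R θ θ' φ Ω) (hp : p ∈ Ω) :
    (fderiv ℝ φ p (0, 0, 1)).2.1 = 0 ∧ (fderiv ℝ φ p (0, 1, 0)).2.1 ≠ 0 ∧
      (fderiv ℝ φ p (0, 0, 1)).2.2 ≠ 0 ∧
      θ.g p.1 * (fderiv ℝ φ p (0, 1, 0)).2.1 ^ 2 =
        θ'.g (φ p).1 * (fderiv ℝ φ p (1, 0, 0)).1 := by
  have hg : θ.g p.1 ≠ 0 := θ.g_ne _ (H.source p hp).1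
  obtain ⟨hx, hu, ht⟩ := H.fst_deriv hp
  have hbij := H.nondegenerate p hp
  have key : ∀ b, (fderiv ℝ φ p (0, 1, b)).2.1 ≠ 0 →
      θ.g p.1 * (fderiv ℝ φ p (0, 1, b)).2.1 ^ 2 =
        θ'.g (φ p).1 * (fderiv ℝ φ p (1, 0, 0)).1 := by
    intro b hb
    -- `u_xx` is raised from `0` to `1` with `u_x = b` fixed, so `u_t` grows by `g`. The slope `q₂`
    -- does not change, and the increments of `q₁` and `r` are compared.
    obtain ⟨q₁, q₂, r, a, a1, a2, a3, a4, a5, a6⟩ := H.jet_conditions hp 0 hb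
    obtain ⟨s₁, s₂, r', a', b1, b2, b3, b4, b5, b6⟩ := H.jet_conditions hp 1 hb
    rw [clm_pt_apply _ (1, 0, a)] at a2
    rw [clm_pt_apply _ (1, 0, a')] at b2
    simp only [Prod.snd_add, Prod.smul_fst, Prod.smul_snd, smul_eq_mul, Prod.fst_add, one_mul,
      zero_mul, add_zero] at a2 b2
    have e2 : s₂ = q₂ := by
      apply mul_right_cancel₀ hb
      linear_combination b3 - a3
    subst e2
    apply mul_left_cancel₀ a6
    have ha : a' = a + θ.g p.1 := by linarith
    subst ha
    have d1 : s₁ - q₁ = θ'.g (φ p).1 * (r' - r) := by linear_combination b5 - a5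
    have d2 : θ'.g (φ p).1 * (r' - r) * (fderiv ℝ φ p (1, 0, 0)).1 =
      θ.g p.1 * ((fderiv ℝ φ p (0, 0, 1)).2.2 - s₂ * (fderiv ℝ φ p (0, 0, 1)).2.1) := by
      rw [← d1]; linear_combination b2 - a2
    have d3 : (r' - r) * (fderiv ℝ φ p (0, 1, b)).2.1 ^ 2 =
      ((fderiv ℝ φ p (0, 0, 1)).2.2 - s₂ * (fderiv ℝ φ p (0, 0, 1)).2.1) := by
      linear_combination b4 - a4
    linear_combination (-(fderiv ℝ φ p (0, 1, b)).2.1 ^ 2) * d2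
      + θ'.g (φ p).1 * (fderiv ℝ φ p (1, 0, 0)).1 * d3
  have hXu : (fderiv ℝ φ p (0, 0, 1)).2.1 = 0 := by
    -- If `X_u ≠ 0`, then `X_x + b X_u` takes the values `1` and `2`, while the right-hand side of
    -- `key` is independent of `b`; this gives `g = 4 g`.
    by_contra hne
    have hval : ∀ y : ℝ, ∃ b, (fderiv ℝ φ p (0, 1, b)).2.1 = y := by
      intro y
      refine ⟨(y - (fderiv ℝ φ p (0, 1, 0)).2.1) / (fderiv ℝ φ p (0, 0, 1)).2.1, ?_⟩
      rw [clm_pt_apply _ (0, 1, (y - (fderiv ℝ φ p (0, 1, 0)).2.1) /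
        (fderiv ℝ φ p (0, 0, 1)).2.1)]
      simp [hne]
    obtain ⟨b, hb⟩ := hval 1
    obtain ⟨b', hb'⟩ := hval 2
    have k1 := key b (by rw [hb]; norm_num)
    have k2 := key b' (by rw [hb']; norm_num)
    rw [hb] at k1
    rw [hb'] at k2
    exact hg (by linarith)
  have hXx : (fderiv ℝ φ p (0, 1, 0)).2.1 ≠ 0 := by
    intro h
    obtain ⟨v, hv⟩ := hbij.2 (0, 1, 0)
    rw [clm_pt_apply _ v] at hv
    have e1 := congrArg Prod.fst hv
    have e2 := congrArg (fun z : Pt => z.2.1) hv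
    simp only [Prod.fst_add, Prod.snd_add, Prod.smul_fst, Prod.smul_snd, smul_eq_mul, hx, hu,
      hXu, h, mul_zero, add_zero, mul_eq_zero, ht, or_false] at e1 e2
    rw [e1] at e2
    norm_num at e2
  refine ⟨hXu, hXx, ?_, key 0 hXx⟩
  intro h
  have := hbij.1.ne (show ((0, 0, 1) : Pt) ≠ 0 by simp)
  apply this
  rw [map_zero]
  ext
  · exact hu
  · exact hXu
  · exact h

/-- An admissible transformation is affine in the dependent variable. -/
theorem IsAdmissible.snd_snd_deriv (H : IsAdmissible R θ θ' φ Ω) (hp : p ∈ Ω) :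
    (fderiv ℝ (fderiv ℝ φ) p (0, 0, 1) (0, 0, 1)).2.2 = 0 := by
  have hg' : θ'.g (φ p).1 ≠ 0 := θ'.g_ne _ (H.target p hp).1
  obtain ⟨hx, hu, ht⟩ := H.fst_deriv hp
  obtain ⟨hXu, hXx, -, -⟩ := H.snd_deriv hp
  obtain ⟨Xx, hXx, hX⟩ : ∃ y : ℝ, y ≠ 0 ∧ ∀ b, (fderiv ℝ φ p (0, 1, b)).2.1 = y := by
    refine ⟨_, hXx, fun b => ?_⟩
    rw [clm_pt_apply _ (0, 1, b)]; simp [hXu]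
  obtain ⟨Xt, hX'⟩ : ∃ y : ℝ, ∀ b, (fderiv ℝ φ p (1, 0, b)).2.1 = y := by
    refine ⟨(fderiv ℝ φ p (1, 0, 0)).2.1, fun b => ?_⟩
    rw [clm_pt_apply _ (1, 0, b)]; simp [hXu]
  obtain ⟨Uu, hUu⟩ : ∃ y : ℝ, (fderiv ℝ φ p (0, 0, 1)).2.2 = y := ⟨_, rfl⟩
  obtain ⟨Ux, hU⟩ : ∃ y : ℝ, ∀ b, (fderiv ℝ φ p (0, 1, b)).2.2 = y + b * Uu := by
    refine ⟨(fderiv ℝ φ p (0, 1, 0)).2.2, fun b => ?_⟩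
    rw [clm_pt_apply _ (0, 1, b)]; simp [hUu]
  obtain ⟨Ut, hU'⟩ : ∃ y : ℝ, ∀ b, (fderiv ℝ φ p (1, 0, b)).2.2 = y + b * Uu := by
    refine ⟨(fderiv ℝ φ p (1, 0, 0)).2.2, fun b => ?_⟩
    rw [clm_pt_apply _ (1, 0, b)]; simp [hUu]
  have hS : ∀ b, fderiv ℝ (fderiv ℝ φ) p (0, 1, b) (0, 1, b) =
      fderiv ℝ (fderiv ℝ φ) p (0, 1, 0) (0, 1, 0) +
      b • (fderiv ℝ (fderiv ℝ φ) p (0, 0, 1) (0, 1, 0) +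
        fderiv ℝ (fderiv ℝ φ) p (0, 1, 0) (0, 0, 1)) +
      b ^ 2 • fderiv ℝ (fderiv ℝ φ) p (0, 0, 1) (0, 0, 1) := by
    intro b
    have : ((0, 1, b) : Pt) = (0, 1, 0) + b • ((0, 0, 1) : Pt) := by ext <;> simp
    rw [this]
    simp only [map_add, map_smul, add_apply, smul_apply]
    module
  have hsymm : fderiv ℝ (fderiv ℝ φ) p (0, 0, 1) (0, 1, 0) =
      fderiv ℝ (fderiv ℝ φ) p (0, 1, 0) (0, 0, 1) :=
    ((H.contDiffAt hp).isSymmSndFDerivAt (by simp; norm_cast)) _ _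
  have hz : ∀ v, (fderiv ℝ (fderiv ℝ φ) p v (0, 0, 1)).2.1 = 0 := fun v =>
    snd_deriv_eq_zero (P := (ContinuousLinearMap.fst ℝ ℝ ℝ).comp
      (ContinuousLinearMap.snd ℝ ℝ (ℝ × ℝ))) (H.contDiffAt hp)
      (by filter_upwards [H.isOpen.mem_nhds hp] with q hq using (H.snd_deriv hq).1) v
  -- Second difference over `u_x = 0, 1, -1` with `u_xx = 0`. The quantities `a`, `q₂`, `q₁`, and
  -- hence `r`, are affine in `u_x` and drop out, which leaves `2 U_uu = 0`.
  have key := fun b => H.jet_conditions hp (b := b) 0 (by rw [hX]; exact hXx)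
  obtain ⟨q₁, q₂, r, a, a1, a2, a3, a4, a5, -⟩ := key 0
  obtain ⟨s₁, s₂, r', a', b1, b2, b3, b4, b5, -⟩ := key 1
  obtain ⟨t₁, t₂, r'', a'', c1, c2, c3, c4, c5, -⟩ := key (-1)
  rw [hS] at a4 b4 c4
  simp only [hX, hX', hU, hU', Prod.fst_add, Prod.snd_add, Prod.smul_fst, Prod.smul_snd,
    smul_eq_mul, hsymm, hz] at a2 a3 a4 b2 b3 b4 c2 c3 c4
  have d0 : a' + a'' - 2 * a = 0 := by linear_combination b1 + c1 - 2 * a1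
  have d2 : s₂ + t₂ - 2 * q₂ = 0 := by
    apply mul_right_cancel₀ hXx
    linear_combination b3 + c3 - 2 * a3
  have d1 : s₁ + t₁ - 2 * q₁ = 0 := by
    apply mul_right_cancel₀ ht
    linear_combination b2 + c2 - 2 * a2 - Xt * d2 +
      Uu * d0
  have d3 : r' + r'' - 2 * r = 0 := by
    apply mul_left_cancel₀ hg'
    linear_combination d1 + (φ p).2.2 ^ θ'.n * d2 - (b5 + c5 - 2 * a5)
  have d4 : 2 * (fderiv ℝ (fderiv ℝ φ) p (0, 0, 1) (0, 0, 1)).2.2 = 0 := by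
    linear_combination (-1 : ℝ) * (b4 + c4 - 2 * a4) +
      Xx ^ 2 * d3 +
      (fderiv ℝ (fderiv ℝ φ) p (0, 1, 0) (0, 1, 0)).2.1 * d2
  linarith

end Jets

/-! ### Integration of the pointwise conditions to a form affine in `x` and `u` -/

section Slices

theorem hasDerivAt_slice_fst {E : Type*} [NormedAddCommGroup E] [NormedSpace ℝ E] {f : Pt → E}
    {t x u : ℝ} (h : DifferentiableAt ℝ f (t, x, u)) :
    HasDerivAt (fun s => f (s, x, u)) (fderiv ℝ f (t, x, u) (1, 0, 0)) t := by
  have h1 : HasDerivAt (fun s : ℝ => ((s, x, u) : Pt)) (1, 0, 0) t :=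
    (hasDerivAt_id _).prodMk (hasDerivAt_const _ _)
  exact HasFDerivAt.comp_hasDerivAt (l := f) t h.hasFDerivAt h1

theorem hasDerivAt_slice_snd {E : Type*} [NormedAddCommGroup E] [NormedSpace ℝ E] {f : Pt → E}
    {t x u : ℝ} (h : DifferentiableAt ℝ f (t, x, u)) :
    HasDerivAt (fun s => f (t, s, u)) (fderiv ℝ f (t, x, u) (0, 1, 0)) x := by
  have h1 : HasDerivAt (fun s : ℝ => ((t, s, u) : Pt)) (0, 1, 0) x :=
    (hasDerivAt_const _ _).prodMk ((hasDerivAt_id _).prodMk (hasDerivAt_const _ _))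
  exact HasFDerivAt.comp_hasDerivAt (l := f) x h.hasFDerivAt h1

theorem hasDerivAt_slice_trd {E : Type*} [NormedAddCommGroup E] [NormedSpace ℝ E] {f : Pt → E}
    {t x u : ℝ} (h : DifferentiableAt ℝ f (t, x, u)) :
    HasDerivAt (fun s => f (t, x, s)) (fderiv ℝ f (t, x, u) (0, 0, 1)) u := by
  have h1 : HasDerivAt (fun s : ℝ => ((t, x, s) : Pt)) (0, 0, 1) u :=
    (hasDerivAt_const _ _).prodMk ((hasDerivAt_const _ _).prodMk (hasDerivAt_id _))
  exact HasFDerivAt.comp_hasDerivAt (l := f) u h.hasFDerivAt h1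

theorem eq_of_hasDerivAt_zero {s : Set ℝ} (hs : IsOpen s) (hc : IsPreconnected s) {f : ℝ → ℝ}
    (h : ∀ y ∈ s, HasDerivAt f 0 y) {y z : ℝ} (hy : y ∈ s) (hz : z ∈ s) : f y = f z :=
  hs.is_const_of_deriv_eq_zero hc (fun y hy => (h y hy).differentiableAt.differentiableWithinAt)
    (fun y hy => (h y hy).deriv) hy hz

theorem isPreconnected_ball (c ε : ℝ) : IsPreconnected (Metric.ball c ε) :=
  (convex_ball c ε).isPreconnected

end Slices

variable {R : Set ℝ} {θ θ' : Coeffs} {φ : Pt → Pt} {Ω : Set Pt} {p : Pt}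

/-- An admissible transformation is locally affine in `x` and in `u`. -/
theorem IsAdmissible.exists_affine_form (H : IsAdmissible R θ θ' φ Ω) (hp : p ∈ Ω) :
    ∃ ε > 0, ∃ (T X₁ X₀ : ℝ → ℝ) (A B : ℝ → ℝ → ℝ),
      (∀ t ∈ Metric.ball p.1 ε, ∀ x ∈ Metric.ball p.2.1 ε, ∀ u ∈ Metric.ball p.2.2 ε,
        (t, x, u) ∈ Ω ∧ φ (t, x, u) = (T t, X₁ t * x + X₀ t, A t x * u + B t x)) ∧
      ContDiffOn ℝ ∞ T (Metric.ball p.1 ε) ∧ ContDiffOn ℝ ∞ X₁ (Metric.ball p.1 ε) ∧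
      ContDiffOn ℝ ∞ X₀ (Metric.ball p.1 ε) ∧
      ContDiffOn ℝ ∞ (Function.uncurry A) (Metric.ball p.1 ε ×ˢ Metric.ball p.2.1 ε) ∧
      ContDiffOn ℝ ∞ (Function.uncurry B) (Metric.ball p.1 ε ×ˢ Metric.ball p.2.1 ε) ∧
      (∀ t ∈ Metric.ball p.1 ε, deriv T t ≠ 0 ∧ X₁ t ≠ 0 ∧
        θ.g t * X₁ t ^ 2 = θ'.g (T t) * deriv T t) ∧
      ∀ t ∈ Metric.ball p.1 ε, ∀ x ∈ Metric.ball p.2.1 ε, A t x ≠ 0 := by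
  obtain ⟨ε, hε, hball⟩ := Metric.isOpen_iff.1 H.isOpen p hp
  have hΩ : ∀ t ∈ Metric.ball p.1 ε, ∀ x ∈ Metric.ball p.2.1 ε, ∀ u ∈ Metric.ball p.2.2 ε,
      ((t, x, u) : Pt) ∈ Ω := by
    intro t ht x hx u hu
    apply hball
    rw [show p = (p.1, p.2.1, p.2.2) from rfl, ← ball_prod_same, ← ball_prod_same]
    exact ⟨ht, hx, hu⟩
  set I := Metric.ball p.1 ε with hI
  set J := Metric.ball p.2.1 ε with hJ
  set K := Metric.ball p.2.2 ε with hK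
  have hx₀ : p.2.1 ∈ J := Metric.mem_ball_self hε
  have hu₀ : p.2.2 ∈ K := Metric.mem_ball_self hε
  have hd : ∀ {q}, q ∈ Ω → DifferentiableAt ℝ φ q := fun hq =>
    (H.contDiffAt hq).differentiableAt (by simp)
  have hd2 : ∀ {q}, q ∈ Ω → DifferentiableAt ℝ (fderiv ℝ φ) q := fun hq =>
    ((H.contDiffAt hq).fderiv_right (m := 1) (by norm_cast)).differentiableAt (by simp)
  have hfd : ContDiffOn ℝ ∞ (fderiv ℝ φ) Ω := H.smooth.fderiv_of_isOpen H.isOpen (by norm_cast)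
  have hT : ∀ t ∈ I, ∀ x ∈ J, ∀ u ∈ K, (φ (t, x, u)).1 = (φ (t, p.2.1, p.2.2)).1 := by
    intro t ht x hx u hu
    refine (eq_of_hasDerivAt_zero Metric.isOpen_ball (isPreconnected_ball p.2.2 ε)
      (f := fun s => (φ (t, x, s)).1) (fun s hs => ?_) hu hu₀).trans
      (eq_of_hasDerivAt_zero Metric.isOpen_ball (isPreconnected_ball p.2.1 ε)
      (f := fun s => (φ (t, s, p.2.2)).1) (fun s hs => ?_) hx hx₀)
    · have := hasDerivAt_fst_comp (hasDerivAt_slice_trd (hd (hΩ t ht x hx s hs)))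
      rwa [(H.fst_deriv (hΩ t ht x hx s hs)).2.1] at this
    · have := hasDerivAt_fst_comp (hasDerivAt_slice_snd (hd (hΩ t ht s hs p.2.2 hu₀)))
      rwa [(H.fst_deriv (hΩ t ht s hs p.2.2 hu₀)).1] at this
  have hTd : ∀ t ∈ I, ∀ x ∈ J, deriv (fun t => (φ (t, p.2.1, p.2.2)).1) t =
      (fderiv ℝ φ (t, x, p.2.2) (1, 0, 0)).1 := by
    intro t ht x hx
    have h1 := hasDerivAt_fst_comp (hasDerivAt_slice_fst (hd (hΩ t ht x hx p.2.2 hu₀)))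
    refine (h1.congr_of_eventuallyEq ?_).deriv
    filter_upwards [Metric.isOpen_ball.mem_nhds ht] with s hs using (hT s hs x hx _ hu₀).symm
  have hX : ∀ t ∈ I, ∀ x ∈ J, ∀ u ∈ K, (φ (t, x, u)).2.1 = (φ (t, x, p.2.2)).2.1 := by
    intro t ht x hx u hu
    refine eq_of_hasDerivAt_zero Metric.isOpen_ball (isPreconnected_ball p.2.2 ε)
      (f := fun s => (φ (t, x, s)).2.1) (fun s hs => ?_) hu hu₀
    have := hasDerivAt_fst_comp (hasDerivAt_snd_comp (hasDerivAt_slice_trd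
      (hd (hΩ t ht x hx s hs))))
    rwa [(H.snd_deriv (hΩ t ht x hx s hs)).1] at this
  have hXx : ∀ t ∈ I, ∀ x ∈ J, (fderiv ℝ φ (t, x, p.2.2) (0, 1, 0)).2.1 =
      (fderiv ℝ φ (t, p.2.1, p.2.2) (0, 1, 0)).2.1 := by
    intro t ht x hx
    have hcont : ContinuousOn (fun x => (fderiv ℝ φ (t, x, p.2.2) (0, 1, 0)).2.1) J := by
      have h1 : ContinuousOn (fun x : ℝ => fderiv ℝ φ (t, x, p.2.2)) J :=
        hfd.continuousOn.comp (by fun_prop) (fun x hx => hΩ t ht x hx _ hu₀)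
      exact (h1.clm_apply continuousOn_const).snd.fst
    -- `X_x² = g̃ T_t / g` does not depend on `x`. Since `X_x` is continuous and has no zeros, its
    -- sign is constant too.
    refine (isPreconnected_ball p.2.1 ε).eq_of_sq_eq hcont
      (g := fun _ => (fderiv ℝ φ (t, p.2.1, p.2.2) (0, 1, 0)).2.1) continuousOn_const ?_
      (fun {_} _ => (H.snd_deriv (hΩ t ht _ hx₀ _ hu₀)).2.1) hx₀ rfl hx
    intro y hy
    have h1 := (H.snd_deriv (hΩ t ht _ hy _ hu₀)).2.2.2
    have h2 := (H.snd_deriv (hΩ t ht _ hx₀ _ hu₀)).2.2.2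
    rw [hT t ht y hy _ hu₀, ← hTd t ht y hy, hTd t ht _ hx₀, ← h2] at h1
    exact mul_left_cancel₀ (θ.g_ne t (H.source _ (hΩ t ht _ hx₀ _ hu₀)).1) h1
  have hX' : ∀ t ∈ I, ∀ x ∈ J, (φ (t, x, p.2.2)).2.1 =
      (fderiv ℝ φ (t, p.2.1, p.2.2) (0, 1, 0)).2.1 * x + ((φ (t, p.2.1, p.2.2)).2.1 -
        (fderiv ℝ φ (t, p.2.1, p.2.2) (0, 1, 0)).2.1 * p.2.1) := by
    intro t ht x hx
    have := eq_of_hasDerivAt_zero Metric.isOpen_ball (isPreconnected_ball p.2.1 ε)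
      (f := fun s => (φ (t, s, p.2.2)).2.1 - (fderiv ℝ φ (t, p.2.1, p.2.2) (0, 1, 0)).2.1 * s)
      (fun s hs => ?_) hx hx₀
    · linear_combination this
    · have h1 := hasDerivAt_fst_comp (hasDerivAt_snd_comp (hasDerivAt_slice_snd
        (hd (hΩ t ht s hs _ hu₀))))
      have h2 := h1.sub ((hasDerivAt_id s).const_mul
        (fderiv ℝ φ (t, p.2.1, p.2.2) (0, 1, 0)).2.1)
      rw [hXx t ht s hs] at h2
      convert! h2 using 1
      ring
  have hUu : ∀ t ∈ I, ∀ x ∈ J, ∀ u ∈ K, (fderiv ℝ φ (t, x, u) (0, 0, 1)).2.2 =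
      (fderiv ℝ φ (t, x, p.2.2) (0, 0, 1)).2.2 := by
    intro t ht x hx u hu
    refine eq_of_hasDerivAt_zero Metric.isOpen_ball (isPreconnected_ball p.2.2 ε)
      (f := fun s => (fderiv ℝ φ (t, x, s) (0, 0, 1)).2.2) (fun s hs => ?_) hu hu₀
    have h1 := (hasDerivAt_slice_trd (hd2 (hΩ t ht x hx s hs))).clm_apply
      (hasDerivAt_const s ((0, 0, 1) : Pt))
    have h2 := hasDerivAt_snd_comp (hasDerivAt_snd_comp h1)
    simp only [map_zero, add_zero] at h2
    rwa [H.snd_snd_deriv (hΩ t ht x hx s hs)] at h2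
  have hU : ∀ t ∈ I, ∀ x ∈ J, ∀ u ∈ K, (φ (t, x, u)).2.2 =
      (fderiv ℝ φ (t, x, p.2.2) (0, 0, 1)).2.2 * u + ((φ (t, x, p.2.2)).2.2 -
        (fderiv ℝ φ (t, x, p.2.2) (0, 0, 1)).2.2 * p.2.2) := by
    intro t ht x hx u hu
    have := eq_of_hasDerivAt_zero Metric.isOpen_ball (isPreconnected_ball p.2.2 ε)
      (f := fun s => (φ (t, x, s)).2.2 - (fderiv ℝ φ (t, x, p.2.2) (0, 0, 1)).2.2 * s)
      (fun s hs => ?_) hu hu₀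
    · linear_combination this
    · have h1 := hasDerivAt_snd_comp (hasDerivAt_snd_comp (hasDerivAt_slice_trd
        (hd (hΩ t ht x hx s hs))))
      have h2 := h1.sub ((hasDerivAt_id s).const_mul
        (fderiv ℝ φ (t, x, p.2.2) (0, 0, 1)).2.2)
      rw [hUu t ht x hx s hs] at h2
      convert! h2 using 1
      ring
  have hline : ContDiff ℝ ∞ (fun t : ℝ => ((t, p.2.1, p.2.2) : Pt)) := by fun_prop
  have hplane : ContDiff ℝ ∞ (fun q : ℝ × ℝ => ((q.1, q.2, p.2.2) : Pt)) := by fun_prop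
  have m1 : Set.MapsTo (fun t : ℝ => ((t, p.2.1, p.2.2) : Pt)) I Ω := fun t ht =>
    hΩ t ht _ hx₀ _ hu₀
  have m2 : Set.MapsTo (fun q : ℝ × ℝ => ((q.1, q.2, p.2.2) : Pt)) (I ×ˢ J) Ω := fun q hq =>
    hΩ _ hq.1 _ hq.2 _ hu₀
  have c1 : ContDiffOn ℝ ∞ (fun t : ℝ => φ (t, p.2.1, p.2.2)) I := H.smooth.comp hline.contDiffOn m1
  have c2 : ContDiffOn ℝ ∞ (fun t : ℝ => fderiv ℝ φ (t, p.2.1, p.2.2) (0, 1, 0)) I :=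
    (hfd.comp hline.contDiffOn m1).clm_apply contDiffOn_const
  have c3 : ContDiffOn ℝ ∞ (fun q : ℝ × ℝ => φ (q.1, q.2, p.2.2)) (I ×ˢ J) :=
    H.smooth.comp hplane.contDiffOn m2
  have c4 : ContDiffOn ℝ ∞ (fun q : ℝ × ℝ => fderiv ℝ φ (q.1, q.2, p.2.2) (0, 0, 1)) (I ×ˢ J) :=
    (hfd.comp hplane.contDiffOn m2).clm_apply contDiffOn_const
  refine ⟨ε, hε, fun t => (φ (t, p.2.1, p.2.2)).1,
    fun t => (fderiv ℝ φ (t, p.2.1, p.2.2) (0, 1, 0)).2.1,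
    fun t => (φ (t, p.2.1, p.2.2)).2.1 - (fderiv ℝ φ (t, p.2.1, p.2.2) (0, 1, 0)).2.1 * p.2.1,
    fun t x => (fderiv ℝ φ (t, x, p.2.2) (0, 0, 1)).2.2,
    fun t x => (φ (t, x, p.2.2)).2.2 - (fderiv ℝ φ (t, x, p.2.2) (0, 0, 1)).2.2 * p.2.2,
    ?_, c1.fst, c2.snd.fst, c1.snd.fst.sub (c2.snd.fst.mul contDiffOn_const), c4.snd.snd,
    c3.snd.snd.sub (c4.snd.snd.mul contDiffOn_const), ?_, ?_⟩
  · intro t ht x hx u hu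
    refine ⟨hΩ t ht x hx u hu, ?_⟩
    ext
    · exact hT t ht x hx u hu
    · exact (hX t ht x hx u hu).trans (hX' t ht x hx)
    · exact hU t ht x hx u hu
  · intro t ht
    rw [hTd t ht _ hx₀]
    have h1 := H.snd_deriv (hΩ t ht _ hx₀ _ hu₀)
    exact ⟨(H.fst_deriv (hΩ t ht _ hx₀ _ hu₀)).2.2, h1.2.1, h1.2.2.2⟩
  · intro t ht x hx
    exact (H.snd_deriv (hΩ t ht x hx _ hu₀)).2.2.1

/-! ### The equation under an affine transformation -/

theorem contDiffAt_slice_right {f : ℝ → ℝ → ℝ} {t x : ℝ}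
    (hf : ContDiffAt ℝ ∞ (Function.uncurry f) (t, x)) : ContDiffAt ℝ ∞ (f t) x :=
  ContDiffAt.comp x (f := fun y : ℝ => (t, y)) hf (contDiffAt_const.prodMk contDiffAt_id)

theorem contDiffAt_slice_left {f : ℝ → ℝ → ℝ} {t x : ℝ}
    (hf : ContDiffAt ℝ ∞ (Function.uncurry f) (t, x)) : ContDiffAt ℝ ∞ (fun s => f s x) t :=
  ContDiffAt.comp t (f := fun s : ℝ => (s, x)) hf (contDiffAt_id.prodMk contDiffAt_const)

theorem hasDerivAt_slice_left {f : ℝ → ℝ → ℝ} {t x : ℝ}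
    (hf : ContDiffAt ℝ ∞ (Function.uncurry f) (t, x)) :
    HasDerivAt (fun s => f s x) (deriv (fun s => f s x) t) t :=
  ((contDiffAt_slice_left hf).differentiableAt (by simp)).hasDerivAt

theorem eventually_hasDerivAt {f : ℝ → ℝ} {x : ℝ} (hf : ContDiffAt ℝ ∞ f x) :
    ∀ᶠ y in 𝓝 x, HasDerivAt f (deriv f y) y := by
  filter_upwards [(hf.of_le (m := 1) (by norm_cast)).eventually (by simp)] with y hy
  exact (hy.differentiableAt (by simp)).hasDerivAt

theorem hasDerivAt_deriv {f : ℝ → ℝ} {x : ℝ} (hf : ContDiffAt ℝ ∞ f x) :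
    HasDerivAt (deriv f) (deriv (deriv f) x) x := by
  have : ContDiffAt ℝ 1 (deriv f) x := by
    have h := (hf.fderiv_right (m := 1) (by norm_cast)).clm_apply (contDiffAt_const (c := (1 : ℝ)))
    exact h
  exact (this.differentiableAt (by simp)).hasDerivAt

/-- The transformation of the residual of the equation under a transformation that is affine in
`x` and in `u`. -/
theorem residual_identity {θ θ' : Coeffs} {f f' : ℝ → ℝ → ℝ} {T X₁ X₀ : ℝ → ℝ}
    {A B : ℝ → ℝ → ℝ} {t x T' X₁' X₀' u U : ℝ}
    (hf : ContDiffAt ℝ ∞ (Function.uncurry f) (t, x))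
    (hf' : ContDiffAt ℝ ∞ (Function.uncurry f') (T t, X₁ t * x + X₀ t))
    (hA : ContDiffAt ℝ ∞ (Function.uncurry A) (t, x))
    (hB : ContDiffAt ℝ ∞ (Function.uncurry B) (t, x))
    (hT : HasDerivAt T T' t) (hX₁ : HasDerivAt X₁ X₁' t) (hX₀ : HasDerivAt X₀ X₀' t)
    (hrel : ∀ᶠ q : ℝ × ℝ in 𝓝 (t, x), f' (T q.1) (X₁ q.1 * q.2 + X₀ q.1) =
      A q.1 q.2 * f q.1 q.2 + B q.1 q.2)
    (hg : θ.g t * X₁ t ^ 2 = θ'.g (T t) * T') (hne : X₁ t ≠ 0)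
    (hu : f t x = u) (hU : U = A t x * u + B t x) :
    T' * pdeResidual θ' f' (T t) (X₁ t * x + X₀ t) = A t x * pdeResidual θ f t x +
      deriv (f t) x * ((T' * U ^ θ'.n - (X₁' * x + X₀')) * A t x / X₁ t - A t x * u ^ θ.n
        - 2 * θ.g t * deriv (A t) x) +
      (deriv (fun s => A s x) t * u + deriv (fun s => B s x) t - A t x * θ.h t * u +
        (T' * U ^ θ'.n - (X₁' * x + X₀')) * (deriv (A t) x * u + deriv (B t) x) / X₁ t +
        T' * θ'.h (T t) * U - θ.g t * (deriv (deriv (A t)) x * u + deriv (deriv (B t)) x)) := by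
  have hval : f' (T t) (X₁ t * x + X₀ t) = U := by
    rw [hU, ← hu]; exact hrel.self_of_nhds
  -- the derivative with respect to `t`
  have kt : deriv (fun s => f' s (X₁ t * x + X₀ t)) (T t) * T' +
      deriv (f' (T t)) (X₁ t * x + X₀ t) * (X₁' * x + X₀') =
      deriv (fun s => A s x) t * u + A t x * deriv (fun s => f s x) t +
        deriv (fun s => B s x) t := by
    have h1 : ∀ᶠ s in 𝓝 t, Function.uncurry f' (T s, X₁ s * x + X₀ s) =
        A s x * f s x + B s x :=
      (Continuous.tendsto' (f := fun s : ℝ => (s, x)) (by fun_prop) t (t, x) rfl).eventually hrel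
    have h2 : HasDerivAt (fun s => (T s, X₁ s * x + X₀ s)) (T', X₁' * x + X₀') t :=
      hT.prodMk ((hX₁.mul_const x).add hX₀)
    have h3 := HasFDerivAt.comp_hasDerivAt (l := Function.uncurry f') t
      (hf'.differentiableAt (by simp)).hasFDerivAt h2
    have h4 := ((hasDerivAt_slice_left hA).mul (hasDerivAt_slice_left hf)).add
      (hasDerivAt_slice_left hB)
    have h5 := h3.unique (h4.congr_of_eventuallyEq h1)
    rw [hu] at h5
    rw [← h5]
    have e1 : HasDerivAt (fun s : ℝ => (s, X₁ t * x + X₀ t)) ((1 : ℝ), (0 : ℝ)) (T t) :=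
      (hasDerivAt_id _).prodMk (hasDerivAt_const _ _)
    have e2 : HasDerivAt (fun s : ℝ => (T t, s)) ((0 : ℝ), (1 : ℝ)) (X₁ t * x + X₀ t) :=
      (hasDerivAt_const _ _).prodMk (hasDerivAt_id _)
    have e3 : deriv (fun s => f' s (X₁ t * x + X₀ t)) (T t) = _ :=
      (HasFDerivAt.comp_hasDerivAt (l := Function.uncurry f') (T t)
      (hf'.differentiableAt (by simp)).hasFDerivAt e1).deriv
    have e4 : deriv (f' (T t)) (X₁ t * x + X₀ t) = _ :=
      (HasFDerivAt.comp_hasDerivAt (l := Function.uncurry f') (X₁ t * x + X₀ t)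
      (hf'.differentiableAt (by simp)).hasFDerivAt e2).deriv
    have e5 : ((T', X₁' * x + X₀') : ℝ × ℝ) = T' • ((1 : ℝ), (0 : ℝ)) +
        (X₁' * x + X₀') • ((0 : ℝ), (1 : ℝ)) := by ext <;> simp
    rw [e3, e4, e5, map_add, map_smul, map_smul]
    simp only [smul_eq_mul]; ring
  -- the derivatives with respect to `x`
  have hF := contDiffAt_slice_right hf'
  have h1 : ∀ᶠ y in 𝓝 x, f' (T t) (X₁ t * y + X₀ t) = A t y * f t y + B t y :=
    (Continuous.tendsto' (f := fun s : ℝ => (t, s)) (by fun_prop) x (t, x) rfl).eventually hrel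
  have hlin : ∀ y, HasDerivAt (fun y => X₁ t * y + X₀ t) (X₁ t) y := fun y => by
    simpa using ((hasDerivAt_id y).const_mul (X₁ t)).add_const (X₀ t)
  have hx1 : ∀ᶠ y in 𝓝 x, deriv (f' (T t)) (X₁ t * y + X₀ t) * X₁ t =
      deriv (A t) y * f t y + A t y * deriv (f t) y + deriv (B t) y := by
    filter_upwards [h1.eventually_nhds,
      (hlin x).continuousAt.eventually (eventually_hasDerivAt hF),
      eventually_hasDerivAt (contDiffAt_slice_right hf),
      eventually_hasDerivAt (contDiffAt_slice_right hA),
      eventually_hasDerivAt (contDiffAt_slice_right hB)] with y k1 k2 k3 k4 k5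
    exact (k2.comp y (hlin y)).unique (((k4.mul k3).add k5).congr_of_eventuallyEq k1)
  have kx := hx1.self_of_nhds
  have kxx : deriv (deriv (f' (T t))) (X₁ t * x + X₀ t) * X₁ t * X₁ t =
      deriv (deriv (A t)) x * u + 2 * deriv (A t) x * deriv (f t) x +
        A t x * deriv (deriv (f t)) x + deriv (deriv (B t)) x := by
    have e1 := ((hasDerivAt_deriv hF).comp x (hlin x)).mul_const (X₁ t)
    have e2 := (((hasDerivAt_deriv (contDiffAt_slice_right hA)).mul
      (eventually_hasDerivAt (contDiffAt_slice_right hf)).self_of_nhds).add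
      ((eventually_hasDerivAt (contDiffAt_slice_right hA)).self_of_nhds.mul
      (hasDerivAt_deriv (contDiffAt_slice_right hf)))).add
      (hasDerivAt_deriv (contDiffAt_slice_right hB))
    have e3 := e1.unique (e2.congr_of_eventuallyEq hx1)
    rw [e3, hu]; ring
  rw [hu] at kx
  rw [pdeResidual, pdeResidual, hval, hu]
  have k1 : deriv (f' (T t)) (X₁ t * x + X₀ t) =
      (deriv (A t) x * u + A t x * deriv (f t) x + deriv (B t) x) / X₁ t := by
    rw [eq_div_iff hne, kx]
  have k2 : T' * θ'.g (T t) * deriv (deriv (f' (T t))) (X₁ t * x + X₀ t) =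
      θ.g t * (deriv (deriv (A t)) x * u + 2 * deriv (A t) x * deriv (f t) x +
        A t x * deriv (deriv (f t)) x + deriv (deriv (B t)) x) := by
    rw [← kxx]
    linear_combination (-deriv (deriv (f' (T t))) (X₁ t * x + X₀ t)) * hg
  rw [k1] at kt ⊢
  field_simp
  field_simp at kt
  linear_combination kt - X₁ t * k2

variable {T X₁ X₀ : ℝ → ℝ} {A B : ℝ → ℝ → ℝ} {t x u : ℝ}

/-- The function `f` on the graph of which a germ of a transformation is evaluated. -/
theorem tendsto_graph {f : ℝ → ℝ → ℝ} (hu : f t x = u)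
    (hf : ContDiffAt ℝ ∞ (Function.uncurry f) (t, x)) :
    Filter.Tendsto (fun q : ℝ × ℝ => ((q.1, q.2, f q.1 q.2) : Pt)) (𝓝 (t, x)) (𝓝 (t, x, u)) := by
  have h := (continuousAt_fst (p := (t, x))).prodMk
    ((continuousAt_snd (p := (t, x))).prodMk hf.continuousAt)
  have := h.tendsto
  simpa only [Function.uncurry, hu] using this

/-- `h1` and `h0` make the coefficient of `u_x` and the free term in `residual_identity` vanish. The
two residuals then differ by the nonzero factors `T'` and `A`. -/
theorem mapsEquation_of_affine
    (hφ : ∀ᶠ q : Pt in 𝓝 (t, x, u),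
      φ q = (T q.1, X₁ q.1 * q.2.1 + X₀ q.1, A q.1 q.2.1 * q.2.2 + B q.1 q.2.1))
    (hA : ContDiffAt ℝ ∞ (Function.uncurry A) (t, x))
    (hB : ContDiffAt ℝ ∞ (Function.uncurry B) (t, x))
    (hT : DifferentiableAt ℝ T t) (hX₁ : DifferentiableAt ℝ X₁ t) (hX₀ : DifferentiableAt ℝ X₀ t)
    (hg : θ.g t * X₁ t ^ 2 = θ'.g (T t) * deriv T t) (hne : X₁ t ≠ 0) (hTne : deriv T t ≠ 0)
    (hAne : A t x ≠ 0)
    (h1 : (deriv T t * (A t x * u + B t x) ^ θ'.n - (deriv X₁ t * x + deriv X₀ t)) * A t x / X₁ t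
      - A t x * u ^ θ.n - 2 * θ.g t * deriv (A t) x = 0)
    (h0 : deriv (fun s => A s x) t * u + deriv (fun s => B s x) t - A t x * θ.h t * u +
        (deriv T t * (A t x * u + B t x) ^ θ'.n - (deriv X₁ t * x + deriv X₀ t)) *
          (deriv (A t) x * u + deriv (B t) x) / X₁ t +
        deriv T t * θ'.h (T t) * (A t x * u + B t x) -
        θ.g t * (deriv (deriv (A t)) x * u + deriv (deriv (B t)) x) = 0) :
    MapsEquation θ θ' φ (t, x, u) := by
  intro f f' hfu hf hf' hgr
  have hφ0 := hφ.self_of_nhds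
  dsimp only at hfu hf hφ0
  rw [hφ0] at hf' ⊢
  have hrel : ∀ᶠ q : ℝ × ℝ in 𝓝 (t, x), f' (T q.1) (X₁ q.1 * q.2 + X₀ q.1) =
      A q.1 q.2 * f q.1 q.2 + B q.1 q.2 := by
    filter_upwards [hgr, (tendsto_graph hfu hf).eventually hφ] with q k1 k2
    rw [k2] at k1
    exact k1
  have key := residual_identity hf hf' hA hB hT.hasDerivAt hX₁.hasDerivAt hX₀.hasDerivAt hrel hg
    hne hfu rfl
  rw [h1, h0, mul_zero, add_zero, add_zero] at key
  dsimp only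
  constructor
  · intro h
    rw [h, mul_zero] at key
    exact (mul_eq_zero.1 key).resolve_left hTne
  · intro h
    rw [h, mul_zero] at key
    exact (mul_eq_zero.1 key.symm).resolve_left hAne

/-- Converse of `mapsEquation_of_affine`. When both residuals in `residual_identity` vanish, an
expression affine in `u_x` remains; since `u_x` is arbitrary, both of its coefficients are zero. -/
theorem IsAdmissible.determining_equations (H : IsAdmissible R θ θ' φ Ω) (hp : (t, x, u) ∈ Ω)
    (hφ : ∀ᶠ q : Pt in 𝓝 (t, x, u),
      φ q = (T q.1, X₁ q.1 * q.2.1 + X₀ q.1, A q.1 q.2.1 * q.2.2 + B q.1 q.2.1))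
    (hA : ContDiffAt ℝ ∞ (Function.uncurry A) (t, x))
    (hB : ContDiffAt ℝ ∞ (Function.uncurry B) (t, x))
    (hT : DifferentiableAt ℝ T t) (hX₁ : DifferentiableAt ℝ X₁ t) (hX₀ : DifferentiableAt ℝ X₀ t)
    (hg : θ.g t * X₁ t ^ 2 = θ'.g (T t) * deriv T t) (hne : X₁ t ≠ 0) :
    (deriv T t * (A t x * u + B t x) ^ θ'.n - (deriv X₁ t * x + deriv X₀ t)) * A t x / X₁ t
      - A t x * u ^ θ.n - 2 * θ.g t * deriv (A t) x = 0 ∧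
    deriv (fun s => A s x) t * u + deriv (fun s => B s x) t - A t x * θ.h t * u +
        (deriv T t * (A t x * u + B t x) ^ θ'.n - (deriv X₁ t * x + deriv X₀ t)) *
          (deriv (A t) x * u + deriv (B t) x) / X₁ t +
        deriv T t * θ'.h (T t) * (A t x * u + B t x) -
        θ.g t * (deriv (deriv (A t)) x * u + deriv (deriv (B t)) x) = 0 := by
  have hφ0 := hφ.self_of_nhds
  dsimp only at hφ0
  have key : ∀ b : ℝ, b * ((deriv T t * (A t x * u + B t x) ^ θ'.n -
      (deriv X₁ t * x + deriv X₀ t)) * A t x / X₁ t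
      - A t x * u ^ θ.n - 2 * θ.g t * deriv (A t) x) +
      (deriv (fun s => A s x) t * u + deriv (fun s => B s x) t - A t x * θ.h t * u +
        (deriv T t * (A t x * u + B t x) ^ θ'.n - (deriv X₁ t * x + deriv X₀ t)) *
          (deriv (A t) x * u + deriv (B t) x) / X₁ t +
        deriv T t * θ'.h (T t) * (A t x * u + B t x) -
        θ.g t * (deriv (deriv (A t)) x * u + deriv (deriv (B t)) x)) = 0 := by
    intro b
    set p : Pt := (t, x, u) with hpdef
    -- A test jet with `u_xx = 0` and prescribed `u_x = b`; `u_t = a` is then fixed by the source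
    -- equation.
    obtain ⟨a, ha⟩ : ∃ a, a = - (u ^ θ.n * b) - θ.h t * u := ⟨_, rfl⟩
    set f := quad p a b 0 0 with hf
    have hfu : f t x = u := quad_self p a b 0 0
    have hfc : ContDiffAt ℝ ∞ (Function.uncurry f) (t, x) := (contDiff_quad p a b 0 0).contDiffAt
    have hfb : HasDerivAt (f t) b x := by
      simpa [hpdef] using hasDerivAt_quad_right p a b 0 0 t x
    obtain ⟨-, hu, ht⟩ := H.fst_deriv hp
    obtain ⟨hXu, hXx, -⟩ := H.snd_deriv hp
    have hΔ : (fderiv ℝ φ p (1, 0, a)).1 * (fderiv ℝ φ p (0, 1, b)).2.1 -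
        (fderiv ℝ φ p (0, 1, b)).1 * (fderiv ℝ φ p (1, 0, a)).2.1 ≠ 0 := by
      rw [(H.fst_graph hp b).2, (H.fst_graph hp a).1, clm_pt_apply _ (0, 1, b)]
      simpa [hXu] using ⟨ht, hXx⟩
    obtain ⟨f', hf', hgr⟩ := exists_image_graph (H.contDiffAt hp) hfu hfc
      (by simpa [hpdef] using hasDerivAt_quad_left p a b 0 0 t x) hfb hΔ
    have hres : pdeResidual θ f t x = 0 := by
      have := pdeResidual_quad θ p a b 0 0
      simp only [hpdef] at this
      rw [hf, this, ha]; ring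
    have hres' := (H.maps p hp f f' hfu hfc hf' hgr).1 hres
    rw [hφ0] at hf' hres'
    have hrel : ∀ᶠ q : ℝ × ℝ in 𝓝 (t, x), f' (T q.1) (X₁ q.1 * q.2 + X₀ q.1) =
        A q.1 q.2 * f q.1 q.2 + B q.1 q.2 := by
      filter_upwards [hgr, (tendsto_graph hfu hfc).eventually hφ] with q k1 k2
      rw [k2] at k1
      exact k1
    have key := residual_identity hfc hf' hA hB hT.hasDerivAt hX₁.hasDerivAt hX₀.hasDerivAt hrel hg
      hne hfu rfl
    dsimp only at hres'
    rw [hres, hres', hfb.deriv] at key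
    linear_combination -key
  have k0 := key 0
  have k1 := key 1
  rw [zero_mul, zero_add] at k0
  rw [k0, one_mul, add_zero] at k1
  exact ⟨k1, k0⟩

/-! ### Splitting with respect to `u` and `x`: the normal form -/

/-- Two affine functions of `u` that agree locally. -/
theorem affine_identity {a b u₀ : ℝ} (h : ∀ᶠ u in 𝓝 u₀, a * u + b = 0) : a = 0 ∧ b = 0 := by
  have h1 : HasDerivAt (fun u : ℝ => a * u + b) a u₀ := by
    simpa using ((hasDerivAt_id u₀).const_mul a).add_const b
  have h2 : HasDerivAt (fun u : ℝ => a * u + b) 0 u₀ :=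
    (hasDerivAt_const u₀ (0 : ℝ)).congr_of_eventuallyEq h
  have h3 := h1.unique h2
  have h4 := h.self_of_nhds
  rw [h3] at h4
  exact ⟨h3, by linarith⟩

/-- Dividing the second derivative of the identity by the first gives `(m - 1) a / (a u + b) = (n -
1) / u`. After clearing denominators this is an affine identity in `u`, which yields `m = n` and `(n
- 1) b = 0`; the remaining constants follow by substitution. -/
theorem power_identity {n m a b c d u₀ : ℝ} (hn : n ≠ 0) (hu₀ : 0 < u₀)
    (h : ∀ᶠ u in 𝓝 u₀, 0 < a * u + b ∧ d * (a * u + b) ^ m = u ^ n + c) (ha : a ≠ 0) :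
    m = n ∧ (n ≠ 1 → b = 0 ∧ c = 0 ∧ 0 < a ∧ d * a ^ n = 1) := by
  have hlin : ∀ u, HasDerivAt (fun u : ℝ => a * u + b) a u := fun u => by
    simpa using ((hasDerivAt_id u).const_mul a).add_const b
  have hpos : ∀ᶠ u in 𝓝 u₀, 0 < u := lt_mem_nhds hu₀
  have h1 : ∀ᶠ u in 𝓝 u₀, d * (a * m * (a * u + b) ^ (m - 1)) = n * u ^ (n - 1) := by
    filter_upwards [h.eventually_nhds, hpos] with u k1 k2
    have e1 := ((hlin u).rpow_const (p := m) (Or.inl k1.self_of_nhds.1.ne')).const_mul d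
    have e2 := (Real.hasDerivAt_rpow_const (p := n) (Or.inl k2.ne')).add_const c
    exact e1.unique (e2.congr_of_eventuallyEq (k1.mono fun v hv => hv.2))
  have h2 : ∀ᶠ u in 𝓝 u₀, d * (a * m * (a * (m - 1) * (a * u + b) ^ (m - 1 - 1))) =
      n * ((n - 1) * u ^ (n - 1 - 1)) := by
    filter_upwards [h.eventually_nhds, h1.eventually_nhds, hpos] with u k0 k1 k2
    have e1 := (((hlin u).rpow_const (p := m - 1)
      (Or.inl k0.self_of_nhds.1.ne')).const_mul (a * m)).const_mul d
    have e2 := (Real.hasDerivAt_rpow_const (p := n - 1) (Or.inl k2.ne')).const_mul n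
    exact e1.unique (e2.congr_of_eventuallyEq k1)
  have h3 : ∀ᶠ u in 𝓝 u₀, ((m - 1) * a - (n - 1) * a) * u + (-(n - 1) * b) = 0 := by
    filter_upwards [h, h1, h2, hpos] with u k0 k1 k2 k3
    have e1 : (a * u + b) ^ (m - 1) = (a * u + b) ^ (m - 1 - 1) * (a * u + b) := by
      conv_rhs => rw [← Real.rpow_add_one k0.1.ne', sub_add_cancel]
    have e2 : u ^ (n - 1) = u ^ (n - 1 - 1) * u := by
      conv_rhs => rw [← Real.rpow_add_one k3.ne', sub_add_cancel]
    -- The factor to be cancelled is nonzero because the first derivative equals `n u^(n-1) ≠ 0`. No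
    -- assumption on `d` or `m` is needed.
    have e3 : d * (a * m * (a * u + b) ^ (m - 1 - 1)) ≠ 0 := by
      intro hz
      have : n * u ^ (n - 1) = 0 := by
        rw [← k1, e1]; linear_combination (a * u + b) * hz
      exact (mul_ne_zero hn (Real.rpow_pos_of_pos k3 _).ne') this
    apply mul_left_cancel₀ e3
    rw [e1] at k1
    rw [e2] at k1
    linear_combination u * k2 - (n - 1) * k1
  obtain ⟨h4, h5⟩ := affine_identity h3
  have hmn : m = n := by
    have : (m - n) * a = 0 := by linear_combination h4
    exact sub_eq_zero.1 ((mul_eq_zero.1 this).resolve_right ha)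
  refine ⟨hmn, fun hn1 => ?_⟩
  subst hmn
  have hb : b = 0 := by
    have : (m - 1) * b = 0 := by linear_combination -h5
    exact (mul_eq_zero.1 this).resolve_left (sub_ne_zero.2 hn1)
  subst hb
  have ha0 : 0 < a := by
    have := h.self_of_nhds.1
    rw [add_zero] at this
    exact pos_of_mul_pos_left this hu₀.le
  have h6 : d * a ^ m = 1 := by
    have k := h1.self_of_nhds
    rw [add_zero, Real.mul_rpow ha0.le hu₀.le] at k
    have e : a ^ m = a ^ (m - 1) * a := by
      conv_rhs => rw [← Real.rpow_add_one ha0.ne', sub_add_cancel]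
    rw [e]
    apply mul_left_cancel₀ (mul_ne_zero hn (Real.rpow_pos_of_pos hu₀ (m - 1)).ne')
    linear_combination k
  refine ⟨rfl, ?_, ha0, h6⟩
  have k := h.self_of_nhds.2
  rw [add_zero, Real.mul_rpow ha0.le hu₀.le] at k
  linear_combination u₀ ^ m * h6 - k

/-- The normal form of an admissible transformation on a box around the point `p`. -/
structure NormalForm (θ θ' : Coeffs) (φ : Pt → Pt) (Ω : Set Pt) (p : Pt) (ε : ℝ)
    (T X₁ X₀ A B₁ B₀ : ℝ → ℝ) : Prop where
  pos : 0 < ε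
  eq : ∀ t ∈ Metric.ball p.1 ε, ∀ x ∈ Metric.ball p.2.1 ε, ∀ u ∈ Metric.ball p.2.2 ε,
    (t, x, u) ∈ Ω ∧ φ (t, x, u) = (T t, X₁ t * x + X₀ t, A t * u + (B₁ t * x + B₀ t))
  smooth_T : ContDiffOn ℝ ∞ T (Metric.ball p.1 ε)
  smooth_X₁ : ContDiffOn ℝ ∞ X₁ (Metric.ball p.1 ε)
  smooth_X₀ : ContDiffOn ℝ ∞ X₀ (Metric.ball p.1 ε)
  smooth_A : ContDiffOn ℝ ∞ A (Metric.ball p.1 ε)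
  smooth_B₁ : ContDiffOn ℝ ∞ B₁ (Metric.ball p.1 ε)
  smooth_B₀ : ContDiffOn ℝ ∞ B₀ (Metric.ball p.1 ε)
  T_ne : ∀ t ∈ Metric.ball p.1 ε, deriv T t ≠ 0
  X₁_ne : ∀ t ∈ Metric.ball p.1 ε, X₁ t ≠ 0
  A_ne : ∀ t ∈ Metric.ball p.1 ε, A t ≠ 0
  g_eq : ∀ t ∈ Metric.ball p.1 ε, θ.g t * X₁ t ^ 2 = θ'.g (T t) * deriv T t
  X₁_eq : ∀ t ∈ Metric.ball p.1 ε, deriv T t * B₁ t = deriv X₁ t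
  X₀_eq : ∀ t ∈ Metric.ball p.1 ε, deriv T t * B₀ t = deriv X₀ t
  A_eq : ∀ t ∈ Metric.ball p.1 ε,
    deriv A t + B₁ t - A t * θ.h t + deriv T t * θ'.h (T t) * A t = 0
  B₁_eq : ∀ t ∈ Metric.ball p.1 ε, deriv B₁ t + deriv T t * θ'.h (T t) * B₁ t = 0
  B₀_eq : ∀ t ∈ Metric.ball p.1 ε, deriv B₀ t + deriv T t * θ'.h (T t) * B₀ t = 0
  of_one : θ.n = 1 → ∀ t ∈ Metric.ball p.1 ε, deriv T t * A t = X₁ t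
  of_ne_one : θ.n ≠ 1 → ∀ t ∈ Metric.ball p.1 ε, B₁ t = 0 ∧ B₀ t = 0 ∧ deriv X₁ t = 0 ∧
    deriv X₀ t = 0 ∧ 0 < A t ∧ deriv T t * A t ^ θ.n = X₁ t

/-- The conditions on the derivatives at a fixed `t` of a transformation that is affine in `x`
and in `u`. -/
theorem coefficient_conditions {R : Set ℝ} {n m g T' X₁ Xt a ax b u₀ : ℝ} (hn : n ≠ 0)
    (hX : X₁ ≠ 0) (ha : a ≠ 0)
    (hR : R = Set.Ioi 0 ∨ (R = Set.univ ∧ n = 1 ∧ m = 1))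
    (h : ∀ᶠ u in 𝓝 u₀, u ∈ R ∧ a * u + b ∈ R ∧
      (T' * (a * u + b) ^ m - Xt) * a / X₁ - a * u ^ n - 2 * g * ax = 0) :
    m = n ∧ (n = 1 → T' * a = X₁ ∧ T' * b = Xt + 2 * g * ax * X₁ / a) ∧
      (n ≠ 1 → b = 0 ∧ Xt + 2 * g * ax * X₁ / a = 0 ∧ 0 < a ∧ T' * a ^ n = X₁) := by
  have h' : ∀ᶠ u in 𝓝 u₀, u ∈ R ∧ a * u + b ∈ R ∧
      T' / X₁ * (a * u + b) ^ m = u ^ n + (Xt / X₁ + 2 * g * ax / a) := by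
    filter_upwards [h] with u hu
    refine ⟨hu.1, hu.2.1, ?_⟩
    have h3 := hu.2.2
    field_simp at h3 ⊢
    linear_combination h3
  have hmn : m = n := by
    rcases hR with rfl | ⟨-, h1, h2⟩
    · exact (power_identity hn h'.self_of_nhds.1 (h'.mono fun u hu => hu.2) ha).1
    · rw [h1, h2]
  refine ⟨hmn, fun h1 => ?_, fun h1 => ?_⟩
  · have k : ∀ᶠ u in 𝓝 u₀, (T' / X₁ * a - 1) * u + (T' / X₁ * b -
        (Xt / X₁ + 2 * g * ax / a)) = 0 := by
      filter_upwards [h'] with u hu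
      have h3 := hu.2.2
      rw [hmn, h1, Real.rpow_one, Real.rpow_one] at h3
      linear_combination h3
    obtain ⟨k1, k2⟩ := affine_identity k
    constructor
    · field_simp at k1
      linear_combination k1
    · field_simp at k2 ⊢
      linear_combination k2
  · rcases hR with rfl | ⟨-, h2, -⟩
    · obtain ⟨k1, k2, k3, k4⟩ :=
        (power_identity hn h'.self_of_nhds.1 (h'.mono fun u hu => hu.2) ha).2 h1
      refine ⟨k1, ?_, k3, ?_⟩
      · field_simp at k2 ⊢
        linear_combination k2
      · field_simp at k4
        linear_combination k4
    · exact absurd h2 h1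

theorem ball_mem_nhds {c ε y : ℝ} (h : y ∈ Metric.ball c ε) : Metric.ball c ε ∈ 𝓝 y :=
  Metric.isOpen_ball.mem_nhds h

theorem box_mem_nhds {p : Pt} {ε t x u : ℝ} (ht : t ∈ Metric.ball p.1 ε)
    (hx : x ∈ Metric.ball p.2.1 ε) (hu : u ∈ Metric.ball p.2.2 ε) :
    ∀ᶠ q : Pt in 𝓝 (t, x, u), q.1 ∈ Metric.ball p.1 ε ∧ q.2.1 ∈ Metric.ball p.2.1 ε ∧
      q.2.2 ∈ Metric.ball p.2.2 ε :=
  prod_mem_nhds (ball_mem_nhds ht) (prod_mem_nhds (ball_mem_nhds hx) (ball_mem_nhds hu))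

/-- The coefficient of `u_x` is an identity between powers of `u`, which gives the equality of
exponents. It also gives the relation between `T'`, `A` and `X₁`, which shows that `A` does not
depend on `x`, and it determines `B`. The free term becomes a polynomial in `u` and `x`, and its
coefficients are the remaining differential equations. -/
theorem IsAdmissible.normal_form {R : Set ℝ} {θ θ' : Coeffs} {φ : Pt → Pt} {Ω : Set Pt} {p : Pt}
    (hR : R = Set.Ioi 0 ∨ (R = Set.univ ∧ θ.n = 1 ∧ θ'.n = 1)) (H : IsAdmissible R θ θ' φ Ω)
    (hp : p ∈ Ω) : θ'.n = θ.n ∧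
      ∃ (ε : ℝ) (T X₁ X₀ A B₁ B₀ : ℝ → ℝ), NormalForm θ θ' φ Ω p ε T X₁ X₀ A B₁ B₀ := by
  obtain ⟨ε, hε, T, X₁, X₀, A, B, hφ, sT, s1, s0, sA, sB, hI, hAne⟩ := H.exists_affine_form hp
  set I := Metric.ball p.1 ε with hIdef
  set J := Metric.ball p.2.1 ε with hJ
  set K := Metric.ball p.2.2 ε with hK
  have ht₀ : p.1 ∈ I := Metric.mem_ball_self hε
  have hx₀ : p.2.1 ∈ J := Metric.mem_ball_self hε
  have hu₀ : p.2.2 ∈ K := Metric.mem_ball_self hε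
  have cT : ∀ t ∈ I, DifferentiableAt ℝ T t := fun t ht =>
    (sT.contDiffAt (ball_mem_nhds ht)).differentiableAt (by simp)
  have c1 : ∀ t ∈ I, DifferentiableAt ℝ X₁ t := fun t ht =>
    (s1.contDiffAt (ball_mem_nhds ht)).differentiableAt (by simp)
  have c0 : ∀ t ∈ I, DifferentiableAt ℝ X₀ t := fun t ht =>
    (s0.contDiffAt (ball_mem_nhds ht)).differentiableAt (by simp)
  have cA : ∀ t ∈ I, ∀ x ∈ J, ContDiffAt ℝ ∞ (Function.uncurry A) (t, x) := fun t ht x hx =>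
    sA.contDiffAt (prod_mem_nhds (ball_mem_nhds ht) (ball_mem_nhds hx))
  have cB : ∀ t ∈ I, ∀ x ∈ J, ContDiffAt ℝ ∞ (Function.uncurry B) (t, x) := fun t ht x hx =>
    sB.contDiffAt (prod_mem_nhds (ball_mem_nhds ht) (ball_mem_nhds hx))
  have hdet := fun t ht x hx u hu => H.determining_equations (hφ t ht x hx u hu).1
    ((box_mem_nhds ht hx hu).mono fun q hq => (hφ _ hq.1 _ hq.2.1 _ hq.2.2).2)
    (cA t ht x hx) (cB t ht x hx) (cT t ht) (c1 t ht) (c0 t ht) (hI t ht).2.2 (hI t ht).2.1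
  have hcoef := fun t ht x hx => coefficient_conditions (u₀ := p.2.2) θ.n_ne (hI t ht).2.1
    (hAne t ht x hx) hR (by
      filter_upwards [ball_mem_nhds hu₀] with u hu
      have h1 := (hφ t ht x hx u hu)
      have h2 := (H.target _ h1.1).2
      rw [h1.2] at h2
      exact ⟨(H.source _ h1.1).2, h2, (hdet t ht x hx u hu).1⟩)
  have hmn := (hcoef _ ht₀ _ hx₀).1
  -- the coefficient of `u` depends only on `t`
  have hAt : ∀ t ∈ I, ∀ x ∈ J, A t x = A t p.2.1 := by
    intro t ht x hx
    by_cases h1 : θ.n = 1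
    · apply mul_left_cancel₀ (hI t ht).1
      rw [((hcoef t ht x hx).2.1 h1).1, ((hcoef t ht _ hx₀).2.1 h1).1]
    · have k1 := (hcoef t ht x hx).2.2 h1
      have k2 := (hcoef t ht _ hx₀).2.2 h1
      refine Real.rpow_left_injOn θ.n_ne k1.2.2.1.le k2.2.2.1.le ?_
      apply mul_left_cancel₀ (hI t ht).1
      dsimp only
      rw [k1.2.2.2, k2.2.2.2]
  have hAx : ∀ t ∈ I, ∀ x ∈ J, deriv (A t) x = 0 := by
    intro t ht x hx
    have : A t =ᶠ[𝓝 x] fun _ => A t p.2.1 := by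
      filter_upwards [ball_mem_nhds hx] with y hy using hAt t ht y hy
    rw [this.deriv_eq, deriv_const]
  have hAxx : ∀ t ∈ I, ∀ x ∈ J, deriv (deriv (A t)) x = 0 := by
    intro t ht x hx
    have : deriv (A t) =ᶠ[𝓝 x] fun _ => 0 := by
      filter_upwards [ball_mem_nhds hx] with y hy using hAx t ht y hy
    rw [this.deriv_eq, deriv_const]
  have hX' : ∀ t ∈ I, θ.n ≠ 1 → deriv X₁ t = 0 ∧ deriv X₀ t = 0 := by
    intro t ht h1
    apply affine_identity (u₀ := p.2.1)
    filter_upwards [ball_mem_nhds hx₀] with x hx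
    have := ((hcoef t ht x hx).2.2 h1).2.1
    rw [hAx t ht x hx] at this
    simpa using this
  have hBt : ∀ t ∈ I, ∀ x ∈ J, B t x = deriv X₁ t / deriv T t * x + deriv X₀ t / deriv T t := by
    intro t ht x hx
    by_cases h1 : θ.n = 1
    · have := ((hcoef t ht x hx).2.1 h1).2
      rw [hAx t ht x hx] at this
      have hT := (hI t ht).1
      field_simp
      linear_combination this
    · rw [((hcoef t ht x hx).2.2 h1).1, (hX' t ht h1).1, (hX' t ht h1).2]; simp
  have sT' : ContDiffOn ℝ ∞ (deriv T) I := sT.deriv_of_isOpen Metric.isOpen_ball (by norm_cast)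
  have s1' : ContDiffOn ℝ ∞ (deriv X₁) I := s1.deriv_of_isOpen Metric.isOpen_ball (by norm_cast)
  have s0' : ContDiffOn ℝ ∞ (deriv X₀) I := s0.deriv_of_isOpen Metric.isOpen_ball (by norm_cast)
  have sA' : ContDiffOn ℝ ∞ (fun t => A t p.2.1) I :=
    ContDiffOn.comp (t := I ×ˢ J) (g := Function.uncurry A) (f := fun t => (t, p.2.1)) sA
      (contDiff_id.prodMk contDiff_const).contDiffOn (fun t ht => ⟨ht, hx₀⟩)
  have sB₁ : ContDiffOn ℝ ∞ (fun t => deriv X₁ t / deriv T t) I :=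
    s1'.div sT' fun t ht => (hI t ht).1
  have sB₀ : ContDiffOn ℝ ∞ (fun t => deriv X₀ t / deriv T t) I :=
    s0'.div sT' fun t ht => (hI t ht).1
  have hBx : ∀ t ∈ I, ∀ x ∈ J, deriv (B t) x = deriv X₁ t / deriv T t := by
    intro t ht x hx
    have : B t =ᶠ[𝓝 x] fun x => deriv X₁ t / deriv T t * x + deriv X₀ t / deriv T t := by
      filter_upwards [ball_mem_nhds hx] with y hy using hBt t ht y hy
    rw [this.deriv_eq]
    simp
  have hBxx : ∀ t ∈ I, ∀ x ∈ J, deriv (deriv (B t)) x = 0 := by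
    intro t ht x hx
    have : deriv (B t) =ᶠ[𝓝 x] fun _ => deriv X₁ t / deriv T t := by
      filter_upwards [ball_mem_nhds hx] with y hy using hBx t ht y hy
    rw [this.deriv_eq, deriv_const]
  have hAs : ∀ t ∈ I, ∀ x ∈ J, deriv (fun s => A s x) t = deriv (fun s => A s p.2.1) t := by
    intro t ht x hx
    apply Filter.EventuallyEq.deriv_eq
    filter_upwards [ball_mem_nhds ht] with s hs using hAt s hs x hx
  have hBs : ∀ t ∈ I, ∀ x ∈ J, deriv (fun s => B s x) t =
      deriv (fun t => deriv X₁ t / deriv T t) t * x +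
        deriv (fun t => deriv X₀ t / deriv T t) t := by
    intro t ht x hx
    have k1 := ((sB₁.contDiffAt (ball_mem_nhds ht)).differentiableAt (by simp)).hasDerivAt
    have k0 := ((sB₀.contDiffAt (ball_mem_nhds ht)).differentiableAt (by simp)).hasDerivAt
    refine (((k1.mul_const x).add k0).congr_of_eventuallyEq ?_).deriv
    filter_upwards [ball_mem_nhds ht] with s hs using hBt s hs x hx
  have hfin : ∀ t ∈ I, ∀ x ∈ J, ∀ u ∈ K,
      (deriv (fun s => A s p.2.1) t + deriv X₁ t / deriv T t - A t p.2.1 * θ.h t +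
        deriv T t * θ'.h (T t) * A t p.2.1) * u +
      ((deriv (fun t => deriv X₁ t / deriv T t) t +
        deriv T t * θ'.h (T t) * (deriv X₁ t / deriv T t)) * x +
      (deriv (fun t => deriv X₀ t / deriv T t) t +
        deriv T t * θ'.h (T t) * (deriv X₀ t / deriv T t))) = 0 := by
    intro t ht x hx u hu
    obtain ⟨d1, d0⟩ := hdet t ht x hx u hu
    rw [hAxx t ht x hx, hBxx t ht x hx, hAs t ht x hx, hBs t ht x hx, hAx t ht x hx,
      hBx t ht x hx, hAt t ht x hx] at d0
    rw [hAx t ht x hx] at d1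
    have hA0 := hAne t ht x hx
    have hX0 := (hI t ht).2.1
    have d2 : (deriv T t * (A t x * u + B t x) ^ θ'.n - (deriv X₁ t * x + deriv X₀ t)) / X₁ t =
        u ^ θ.n := by
      apply mul_left_cancel₀ hA0
      linear_combination d1
    -- Here both cases merge: the power is linear if `n = 1`, and otherwise its factor vanishes
    -- since `X₁' = 0`.
    have d3 : u ^ θ.n * (deriv X₁ t / deriv T t) = u * (deriv X₁ t / deriv T t) := by
      by_cases h1 : θ.n = 1
      · rw [h1, Real.rpow_one]
      · rw [(hX' t ht h1).1]; simp
    rw [hBt t ht x hx] at d0 d2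
    rw [hAt t ht x hx] at d2
    linear_combination d0 - d2 * (deriv X₁ t / deriv T t) - d3
  have hfin' : ∀ t ∈ I, (deriv (fun s => A s p.2.1) t + deriv X₁ t / deriv T t -
        A t p.2.1 * θ.h t + deriv T t * θ'.h (T t) * A t p.2.1) = 0 ∧
      (deriv (fun t => deriv X₁ t / deriv T t) t +
        deriv T t * θ'.h (T t) * (deriv X₁ t / deriv T t)) = 0 ∧
      (deriv (fun t => deriv X₀ t / deriv T t) t +
        deriv T t * θ'.h (T t) * (deriv X₀ t / deriv T t)) = 0 := by
    intro t ht
    have k : ∀ x ∈ J, _ := fun x hx => affine_identity (u₀ := p.2.2) (by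
      filter_upwards [ball_mem_nhds hu₀] with u hu using hfin t ht x hx u hu)
    refine ⟨(k _ hx₀).1, affine_identity (u₀ := p.2.1) ?_⟩
    filter_upwards [ball_mem_nhds hx₀] with x hx using (k x hx).2
  refine ⟨hmn, ε, T, X₁, X₀, fun t => A t p.2.1, fun t => deriv X₁ t / deriv T t,
    fun t => deriv X₀ t / deriv T t, ⟨hε, ?_, sT, s1, s0, sA', sB₁, sB₀, fun t ht => (hI t ht).1,
    fun t ht => (hI t ht).2.1, fun t ht => hAne t ht _ hx₀, fun t ht => (hI t ht).2.2, ?_, ?_,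
    fun t ht => (hfin' t ht).1, fun t ht => (hfin' t ht).2.1, fun t ht => (hfin' t ht).2.2,
    fun h1 t ht => ((hcoef t ht _ hx₀).2.1 h1).1, fun h1 t ht => ?_⟩⟩
  · intro t ht x hx u hu
    have h1 := hφ t ht x hx u hu
    rw [hAt t ht x hx, hBt t ht x hx] at h1
    exact h1
  · intro t ht
    have := (hI t ht).1
    field_simp
  · intro t ht
    have := (hI t ht).1
    field_simp
  · have k := (hcoef t ht _ hx₀).2.2 h1
    have k' := hX' t ht h1
    refine ⟨by rw [k'.1]; simp, by rw [k'.2]; simp, k'.1, k'.2, k.2.2.1, k.2.2.2⟩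

/-! ### Sufficient conditions for admissibility and the target equation -/

theorem exists_local_inverse {T : ℝ → ℝ} {I : Set ℝ} (hI : IsOpen I) {t₀ : ℝ} (ht₀ : t₀ ∈ I)
    (hT : ContDiffOn ℝ ∞ T I) (hT' : ∀ t ∈ I, deriv T t ≠ 0) :
    ∃ (I' : Set ℝ) (σ : ℝ → ℝ), IsOpen I' ∧ t₀ ∈ I' ∧ I' ⊆ I ∧ IsOpen (T '' I') ∧
      ContDiffOn ℝ ∞ σ (T '' I') ∧ ∀ t ∈ I', σ (T t) = t ∧ HasDerivAt σ (deriv T t)⁻¹ (T t) := by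
  have hc : ∀ t ∈ I, ContDiffAt ℝ ∞ T t := fun t ht => hT.contDiffAt (hI.mem_nhds ht)
  have hs := ((hc t₀ ht₀).hasStrictDerivAt (by simp)).hasStrictFDerivAt_equiv (hT' t₀ ht₀)
  set e := hs.toOpenPartialHomeomorph T with he
  have hcoe : ∀ t, e t = T t := fun t => rfl
  have hmem : t₀ ∈ e.source := hs.mem_toOpenPartialHomeomorph_source
  have hinv : ∀ t ∈ I ∩ e.source, e.symm (T t) = t := fun t ht => e.left_inv ht.2
  have hopen : IsOpen (T '' (I ∩ e.source)) :=
    e.isOpen_image_of_subset_source (hI.inter e.open_source) Set.inter_subset_right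
  have htgt : ∀ t ∈ I ∩ e.source, T t ∈ e.target := fun t ht => e.map_source ht.2
  refine ⟨I ∩ e.source, e.symm, hI.inter e.open_source, ⟨ht₀, hmem⟩, Set.inter_subset_left, hopen,
    ?_, ?_⟩
  · rintro _ ⟨t, ht, rfl⟩
    refine (e.contDiffAt_symm_deriv (hT' t ht.1) (htgt t ht) ?_ ?_).contDiffWithinAt
    · rw [hinv t ht]
      exact ((hc t ht.1).differentiableAt (by simp)).hasDerivAt
    · rw [hinv t ht]
      exact hc t ht.1
  · intro t ht
    refine ⟨hinv t ht, e.hasDerivAt_symm (htgt t ht) (hT' t ht.1) ?_⟩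
    rw [hinv t ht]
    exact ((hc t ht.1).differentiableAt (by simp)).hasDerivAt

/-- A transformation that is affine in `x` and in `u` is nondegenerate. -/
theorem bijective_fderiv_of_affine {φ : Pt → Pt} {p : Pt} {T X₁ X₀ A B₁ B₀ : ℝ → ℝ}
    (hd : DifferentiableAt ℝ φ p)
    (hφ : ∀ᶠ q : Pt in 𝓝 p,
      φ q = (T q.1, X₁ q.1 * q.2.1 + X₀ q.1, A q.1 * q.2.2 + (B₁ q.1 * q.2.1 + B₀ q.1)))
    (hT : DifferentiableAt ℝ T p.1) (hT' : deriv T p.1 ≠ 0) (hX : X₁ p.1 ≠ 0) (hA : A p.1 ≠ 0) :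
    Function.Bijective (fderiv ℝ φ p) := by
  obtain ⟨t, x, u⟩ := p
  dsimp only at *
  have e1 : (fderiv ℝ φ (t, x, u) (1, 0, 0)).1 = deriv T t := by
    have h1 := hasDerivAt_fst_comp (hasDerivAt_slice_fst hd)
    refine h1.unique (hT.hasDerivAt.congr_of_eventuallyEq ?_)
    filter_upwards [(Continuous.tendsto' (f := fun s : ℝ => ((s, x, u) : Pt)) (by fun_prop) t
      (t, x, u) rfl).eventually hφ] with s hs
    rw [hs]
  have e2 : fderiv ℝ φ (t, x, u) (0, 1, 0) = (0, X₁ t, B₁ t) := by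
    have h1 := hasDerivAt_slice_snd hd
    have h2 : HasDerivAt (fun s : ℝ => ((T t, X₁ t * s + X₀ t, A t * u + (B₁ t * s + B₀ t)) : Pt))
        (0, X₁ t, B₁ t) x := by
      refine (hasDerivAt_const _ _).prodMk (HasDerivAt.prodMk ?_ ?_)
      · simpa using ((hasDerivAt_id x).const_mul (X₁ t)).add_const (X₀ t)
      · simpa using (((hasDerivAt_id x).const_mul (B₁ t)).add_const (B₀ t)).const_add (A t * u)
    refine h1.unique (h2.congr_of_eventuallyEq ?_)
    filter_upwards [(Continuous.tendsto' (f := fun s : ℝ => ((t, s, u) : Pt)) (by fun_prop) x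
      (t, x, u) rfl).eventually hφ] with s hs using hs
  have e3 : fderiv ℝ φ (t, x, u) (0, 0, 1) = (0, 0, A t) := by
    have h1 := hasDerivAt_slice_trd hd
    have h2 : HasDerivAt (fun s : ℝ => ((T t, X₁ t * x + X₀ t, A t * s + (B₁ t * x + B₀ t)) : Pt))
        (0, 0, A t) u := by
      refine (hasDerivAt_const _ _).prodMk (HasDerivAt.prodMk (hasDerivAt_const _ _) ?_)
      simpa using ((hasDerivAt_id u).const_mul (A t)).add_const (B₁ t * x + B₀ t)
    refine h1.unique (h2.congr_of_eventuallyEq ?_)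
    filter_upwards [(Continuous.tendsto' (f := fun s : ℝ => ((t, x, s) : Pt)) (by fun_prop) u
      (t, x, u) rfl).eventually hφ] with s hs using hs
  have hinj : Function.Injective (fderiv ℝ φ (t, x, u)) := by
    rw [injective_iff_map_eq_zero]
    intro v hv
    rw [clm_pt_apply, e2, e3] at hv
    have k1 := congrArg Prod.fst hv
    have k2 := congrArg (fun z : Pt => z.2.1) hv
    have k3 := congrArg (fun z : Pt => z.2.2) hv
    simp only [Prod.fst_add, Prod.snd_add, Prod.smul_fst, Prod.smul_snd, smul_eq_mul, mul_zero,
      add_zero, e1, Prod.fst_zero, Prod.snd_zero, mul_eq_zero, hT', or_false] at k1 k2 k3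
    simp only [k1, zero_mul, zero_add, mul_eq_zero, hX, or_false] at k2 k3
    simp only [k2, zero_mul, zero_add, mul_eq_zero, hA, or_false] at k3
    ext
    · exact k1
    · exact k2
    · exact k3
  exact ⟨hinj, (LinearMap.injective_iff_surjective
    (f := (fderiv ℝ φ (t, x, u) : Pt →ₗ[ℝ] Pt))).1 hinj⟩

/-- Sufficient conditions for an affine transformation to be admissible:
it maps the equation `θ` to an equation `θ'`, the coefficients of which are, as functions of the
old variable `t`, equal to `h'` and `g'`. -/
theorem exists_target {R : Set ℝ} {θ : Coeffs} {I : Set ℝ} {t₀ : ℝ}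
    {T X₁ X₀ A B₁ B₀ h' g' : ℝ → ℝ} (hI : IsOpen I) (ht₀ : t₀ ∈ I) (hdom : I ⊆ θ.dom)
    (sT : ContDiffOn ℝ ∞ T I) (s1 : ContDiffOn ℝ ∞ X₁ I) (s0 : ContDiffOn ℝ ∞ X₀ I)
    (sA : ContDiffOn ℝ ∞ A I) (sB₁ : ContDiffOn ℝ ∞ B₁ I) (sB₀ : ContDiffOn ℝ ∞ B₀ I)
    (sh : ContDiffOn ℝ ∞ h' I) (sg : ContDiffOn ℝ ∞ g' I)
    (hT' : ∀ t ∈ I, deriv T t ≠ 0) (hX : ∀ t ∈ I, X₁ t ≠ 0) (hA : ∀ t ∈ I, A t ≠ 0)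
    (hg : ∀ t ∈ I, θ.g t * X₁ t ^ 2 = g' t * deriv T t)
    (h₁ : ∀ t ∈ I, deriv T t * B₁ t = deriv X₁ t) (h₀ : ∀ t ∈ I, deriv T t * B₀ t = deriv X₀ t)
    (hA' : ∀ t ∈ I, deriv A t + B₁ t - A t * θ.h t + deriv T t * h' t * A t = 0)
    (hB₁ : ∀ t ∈ I, deriv B₁ t + deriv T t * h' t * B₁ t = 0)
    (hB₀ : ∀ t ∈ I, deriv B₀ t + deriv T t * h' t * B₀ t = 0)
    (hone : θ.n = 1 → ∀ t ∈ I, deriv T t * A t = X₁ t)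
    (hother : θ.n ≠ 1 → R = Set.Ioi 0 ∧ ∀ t ∈ I, B₁ t = 0 ∧ B₀ t = 0 ∧ 0 < A t ∧
      deriv T t * A t ^ θ.n = X₁ t) :
    ∃ (I' : Set ℝ) (θ' : Coeffs) (σ : ℝ → ℝ), IsOpen I' ∧ t₀ ∈ I' ∧ I' ⊆ I ∧ θ'.n = θ.n ∧
      θ'.dom = T '' I' ∧
      (∀ t ∈ I', θ'.h (T t) = h' t ∧ θ'.g (T t) = g' t ∧ σ (T t) = t ∧
        HasDerivAt σ (deriv T t)⁻¹ (T t)) ∧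
      ∀ (φ : Pt → Pt) (Ω' : Set Pt), IsOpen Ω' →
        (∀ q ∈ Ω', q.1 ∈ I' ∧ q.2.2 ∈ R ∧ (φ q).2.2 ∈ R ∧
          φ q = (T q.1, X₁ q.1 * q.2.1 + X₀ q.1,
            A q.1 * q.2.2 + (B₁ q.1 * q.2.1 + B₀ q.1))) → IsAdmissible R θ θ' φ Ω' := by
  obtain ⟨I', σ, hI', ht₀', hsub, hopen, sσ, hσ⟩ := exists_local_inverse hI ht₀ sT hT'
  have hmaps : Set.MapsTo σ (T '' I') I := by
    rintro _ ⟨t, ht, rfl⟩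
    rw [(hσ t ht).1]; exact hsub ht
  have hg'ne : ∀ t ∈ I, g' t ≠ 0 := by
    intro t ht hz
    have := hg t ht
    rw [hz, zero_mul] at this
    exact (mul_ne_zero (θ.g_ne t (hdom ht)) (pow_ne_zero 2 (hX t ht))) this
  refine ⟨I', ⟨θ.n, fun s => h' (σ s), fun s => g' (σ s), T '' I', hopen, θ.n_ne,
    sh.comp sσ hmaps, sg.comp sσ hmaps, fun s hs => hg'ne _ (hmaps hs)⟩, σ, hI', ht₀', hsub, rfl,
    rfl, fun t ht => ⟨?_, ?_, hσ t ht⟩, ?_⟩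
  · simp only [(hσ t ht).1]
  · simp only [(hσ t ht).1]
  intro φ Ω' hΩ' hφ
  have hsm : ∀ p ∈ Ω', ContDiffAt ℝ ∞ φ p := by
    intro p hp
    have hn := hI.mem_nhds (hsub (hφ p hp).1)
    have kT := (sT.contDiffAt hn).comp p contDiffAt_fst
    have k1 := (s1.contDiffAt hn).comp p contDiffAt_fst
    have k0 := (s0.contDiffAt hn).comp p contDiffAt_fst
    have kA := (sA.contDiffAt hn).comp p contDiffAt_fst
    have kB₁ := (sB₁.contDiffAt hn).comp p contDiffAt_fst
    have kB₀ := (sB₀.contDiffAt hn).comp p contDiffAt_fst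
    have kx : ContDiffAt ℝ ∞ (fun q : Pt => q.2.1) p := contDiffAt_snd.fst
    have ku : ContDiffAt ℝ ∞ (fun q : Pt => q.2.2) p := contDiffAt_snd.snd
    refine (kT.prodMk (((k1.mul kx).add k0).prodMk
      ((kA.mul ku).add ((kB₁.mul kx).add kB₀)))).congr_of_eventuallyEq ?_
    filter_upwards [hΩ'.mem_nhds hp] with q hq using (hφ q hq).2.2.2
  have hev : ∀ p ∈ Ω', ∀ᶠ q : Pt in 𝓝 p, φ q = (T q.1, X₁ q.1 * q.2.1 + X₀ q.1,
            A q.1 * q.2.2 + (B₁ q.1 * q.2.1 + B₀ q.1)) := by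
    intro p hp
    filter_upwards [hΩ'.mem_nhds hp] with q hq using (hφ q hq).2.2.2
  have hdiff : ∀ {f : ℝ → ℝ}, ContDiffOn ℝ ∞ f I → ∀ t ∈ I, DifferentiableAt ℝ f t :=
    fun hf t ht => (hf.contDiffAt (hI.mem_nhds ht)).differentiableAt (by simp)
  refine ⟨hΩ', ?_, ?_, fun p hp => (hsm p hp).contDiffWithinAt, ?_, ?_⟩
  · exact fun p hp => ⟨hdom (hsub (hφ p hp).1), (hφ p hp).2.1⟩
  · refine fun p hp => ⟨?_, (hφ p hp).2.2.1⟩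
    rw [(hφ p hp).2.2.2]
    exact ⟨p.1, (hφ p hp).1, rfl⟩
  · intro p hp
    have hpI := hsub (hφ p hp).1
    exact bijective_fderiv_of_affine ((hsm p hp).differentiableAt (by simp)) (hev p hp)
      (hdiff sT _ hpI) (hT' _ hpI) (hX _ hpI) (hA _ hpI)
  · rintro ⟨t, x, u⟩ hp
    have htI' : t ∈ I' := (hφ _ hp).1
    have ht : t ∈ I := hsub htI'
    have hn := hI.mem_nhds ht
    have hu : u ∈ R := (hφ _ hp).2.1
    have hU := (hφ _ hp).2.2.1
    rw [(hφ _ hp).2.2.2] at hU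
    dsimp only at hU
    have hTne := hT' t ht
    have hXne := hX t ht
    have kA : deriv (fun _ : ℝ => A t) = fun _ => 0 := by ext; simp
    have kB : deriv (fun x : ℝ => B₁ t * x + B₀ t) = fun _ => B₁ t := by
      ext y
      simp
    -- The convective coefficients match. This is the only place where the relations specific to `n
    -- = 1` and to `n ≠ 1` make the powers of `u` agree.
    have kpow : deriv T t * (A t * u + (B₁ t * x + B₀ t)) ^ θ.n -
        (deriv X₁ t * x + deriv X₀ t) = X₁ t * u ^ θ.n := by
      rw [← h₁ t ht, ← h₀ t ht]
      by_cases h1 : θ.n = 1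
      · rw [h1, Real.rpow_one, Real.rpow_one, ← hone h1 t ht]; ring
      · obtain ⟨rfl, hq⟩ := hother h1
        obtain ⟨q1, q2, q3, q4⟩ := hq t ht
        rw [q1, q2, ← q4, zero_mul, add_zero, add_zero, Real.mul_rpow q3.le (le_of_lt hu)]
        ring
    have kB1 : u ^ θ.n * B₁ t = u * B₁ t := by
      by_cases h1 : θ.n = 1
      · rw [h1, Real.rpow_one]
      · rw [((hother h1).2 t ht).1]; simp
    have kBt : deriv (fun s => B₁ s * x + B₀ s) t = deriv B₁ t * x + deriv B₀ t :=
      (((hdiff sB₁ t ht).hasDerivAt.mul_const x).add (hdiff sB₀ t ht).hasDerivAt).deriv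
    refine mapsEquation_of_affine (A := fun t _ => A t) (B := fun t x => B₁ t * x + B₀ t)
      (hev _ hp) ?_ ?_ (hdiff sT t ht) (hdiff s1 t ht) (hdiff s0 t ht) ?_ hXne hTne (hA t ht)
      ?_ ?_
    · exact (sA.contDiffAt hn).comp (t, x) contDiffAt_fst
    · exact (((sB₁.contDiffAt hn).comp (t, x) contDiffAt_fst).mul contDiffAt_snd).add
        ((sB₀.contDiffAt hn).comp (t, x) contDiffAt_fst)
    · simp only [(hσ t htI').1]
      exact hg t ht
    · simp only [kpow, kA]
      field_simp
      ring
    · simp only [kpow, kA, kB, kBt, (hσ t htI').1]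
      have : X₁ t * u ^ θ.n * (0 * u + B₁ t) / X₁ t = u * B₁ t := by
        rw [← kB1]; field_simp; ring
      rw [this]
      simp only [deriv_const]
      linear_combination u * hA' t ht + x * hB₁ t ht + hB₀ t ht

/-! ### Equivalence transformations for exponents other than `1` -/

section PowerEquivalence

variable {T : ℝ → ℝ} {I : Set ℝ} {κ l : ℝ} {ν : ℝ → ℝ}

/-- The coefficient `(κ / T') ^ (1 / m)` of `u` in an equivalence transformation. -/
noncomputable def powerCoeff (T : ℝ → ℝ) (κ m t : ℝ) : ℝ :=
  Real.exp (Real.log (κ / deriv T t) / m)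

/-- The equivalence transformation of a class of equations with exponents different from `1`. -/
noncomputable def powerEquivalence (T : ℝ → ℝ) (κ l : ℝ) (ν : ℝ → ℝ)
    (z : Pt × (ℝ × ℝ × ℝ) × (Fin 0 → ℝ)) : Pt × (ℝ × ℝ × ℝ) × (Fin 0 → ℝ) :=
  ((T z.1.1, κ * z.1.2.1 + l, powerCoeff T κ (ν z.2.1.1) z.1.1 * z.1.2.2),
    (z.2.1.1, (z.2.1.2.1 + deriv (deriv T) z.1.1 / (ν z.2.1.1 * deriv T z.1.1)) / deriv T z.1.1,
      z.2.1.2.2 * κ ^ 2 / deriv T z.1.1), z.2.2)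

theorem deriv_powerCoeff {m t : ℝ} (hT : DifferentiableAt ℝ (deriv T) t)
    (hpos : 0 < κ / deriv T t) :
    HasDerivAt (powerCoeff T κ m)
      (-(powerCoeff T κ m t * deriv (deriv T) t / (m * deriv T t))) t := by
  have hne : deriv T t ≠ 0 := fun h => by simp [h] at hpos
  have hκ : κ ≠ 0 := fun h => by simp [h] at hpos
  have h1 := (((hasDerivAt_const t κ).div hT.hasDerivAt hne).log hpos.ne').div_const m |>.exp
  convert! h1 using 1
  simp only [powerCoeff, Pi.div_apply]
  -- For `m = 0` the division convention makes the function constantly `1` and the stated derivative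
  -- `0`.
  by_cases hm : m = 0
  · simp [hm]
  field_simp
  ring

theorem powerCoeff_rpow {m t : ℝ} (hm : m ≠ 0) (hpos : 0 < κ / deriv T t) :
    deriv T t * powerCoeff T κ m t ^ m = κ := by
  have hne : deriv T t ≠ 0 := fun h => by simp [h] at hpos
  rw [powerCoeff, ← Real.exp_mul, div_mul_cancel₀ _ hm, Real.exp_log hpos]
  field_simp

theorem eq_powerCoeff {m t a : ℝ} (hm : m ≠ 0) (ha : 0 < a) (hT : deriv T t ≠ 0)
    (h : deriv T t * a ^ m = κ) : a = powerCoeff T κ m t := by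
  rw [powerCoeff, ← h, mul_div_cancel_left₀ _ hT, Real.log_rpow ha, mul_div_cancel_left₀ _ hm,
    Real.exp_log ha]

theorem contDiffOn_powerEquivalence (hI : IsOpen I) (sT : ContDiffOn ℝ ∞ T I)
    (hT : ∀ t ∈ I, deriv T t ≠ 0) (hpos : ∀ t ∈ I, 0 < κ / deriv T t)
    (sν : ContDiffOn ℝ ∞ ν {0}ᶜ) (hν : ∀ n, n ≠ 0 → ν n ≠ 0) :
    ContDiffOn ℝ ∞ (powerEquivalence T κ l ν)
      ((I ×ˢ Set.univ) ×ˢ valueSpace ×ˢ (Set.univ : Set (Fin 0 → ℝ))) := by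
  have sT' : ContDiffOn ℝ ∞ (deriv T) I := sT.deriv_of_isOpen hI (by norm_cast)
  have sT'' : ContDiffOn ℝ ∞ (deriv (deriv T)) I := sT'.deriv_of_isOpen hI (by norm_cast)
  set Z : Set (Pt × (ℝ × ℝ × ℝ) × (Fin 0 → ℝ)) :=
    (I ×ˢ Set.univ) ×ˢ valueSpace ×ˢ (Set.univ : Set (Fin 0 → ℝ)) with hZ
  have pt : ContDiffOn ℝ ∞ (fun z : Pt × (ℝ × ℝ × ℝ) × (Fin 0 → ℝ) => z.1.1) Z := by fun_prop
  have px : ContDiffOn ℝ ∞ (fun z : Pt × (ℝ × ℝ × ℝ) × (Fin 0 → ℝ) => z.1.2.1) Z := by fun_prop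
  have pu : ContDiffOn ℝ ∞ (fun z : Pt × (ℝ × ℝ × ℝ) × (Fin 0 → ℝ) => z.1.2.2) Z := by fun_prop
  have pn : ContDiffOn ℝ ∞ (fun z : Pt × (ℝ × ℝ × ℝ) × (Fin 0 → ℝ) => z.2.1.1) Z := by fun_prop
  have ph : ContDiffOn ℝ ∞ (fun z : Pt × (ℝ × ℝ × ℝ) × (Fin 0 → ℝ) => z.2.1.2.1) Z := by fun_prop
  have pg : ContDiffOn ℝ ∞ (fun z : Pt × (ℝ × ℝ × ℝ) × (Fin 0 → ℝ) => z.2.1.2.2) Z := by fun_prop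
  have py : ContDiffOn ℝ ∞ (fun z : Pt × (ℝ × ℝ × ℝ) × (Fin 0 → ℝ) => z.2.2) Z := by fun_prop
  have mt : Set.MapsTo (fun z : Pt × (ℝ × ℝ × ℝ) × (Fin 0 → ℝ) => z.1.1) Z I := fun z hz => hz.1.1
  have mn : Set.MapsTo (fun z : Pt × (ℝ × ℝ × ℝ) × (Fin 0 → ℝ) => z.2.1.1) Z {0}ᶜ :=
    fun z hz => hz.2.1.1
  have q0 := sT.comp pt mt
  have q1 := sT'.comp pt mt
  have q2 := sT''.comp pt mt
  have q3 := sν.comp pn mn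
  have n1 : ∀ z ∈ Z, deriv T z.1.1 ≠ 0 := fun z hz => hT _ (mt hz)
  have n3 : ∀ z ∈ Z, ν z.2.1.1 ≠ 0 := fun z hz => hν _ (mn hz)
  refine (q0.prodMk (((contDiffOn_const.mul px).add contDiffOn_const).prodMk
    (ContDiffOn.mul (ContDiffOn.exp (ContDiffOn.div (ContDiffOn.log
      (contDiffOn_const.div q1 n1) ?_) q3 n3)) pu))).prodMk
    ((pn.prodMk (((ph.add (q2.div (q3.mul q1) ?_)).div q1 n1).prodMk
      ((pg.mul contDiffOn_const).div q1 n1))).prodMk py)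
  · exact fun z hz => (hpos _ (mt hz)).ne'
  · exact fun z hz => mul_ne_zero (n3 z hz) (n1 z hz)

/-- The derivative along a line. -/
theorem hasDerivAt_line {E F : Type*} [NormedAddCommGroup E] [NormedSpace ℝ E]
    [NormedAddCommGroup F] [NormedSpace ℝ F] {Ψ : E → F} {z : E} (h : DifferentiableAt ℝ Ψ z)
    (δ : E) : HasDerivAt (fun s : ℝ => Ψ (z + s • δ)) (fderiv ℝ Ψ z δ) 0 := by
  have h1 : HasDerivAt (fun s : ℝ => z + s • δ) δ 0 := by
    simpa using ((hasDerivAt_id (0 : ℝ)).smul_const δ).const_add z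
  have h2 : HasFDerivAt Ψ (fderiv ℝ Ψ z) (z + (0 : ℝ) • δ) := by simpa using h.hasFDerivAt
  exact h2.comp_hasDerivAt 0 h1

/-- A component of `Ψ` that is affine along a line on which the derivative of `Ψ` vanishes. -/
theorem eq_zero_of_line {f : ℝ → ℝ} {a b d : ℝ} (h : HasDerivAt f 0 0)
    (hf : ∀ s, f s = a * (b + s * d)) (ha : a ≠ 0) : d = 0 := by
  have h1 : HasDerivAt (fun s : ℝ => a * (b + s * d)) (a * d) 0 := by
    simpa using (((hasDerivAt_id (0 : ℝ)).mul_const d).const_add b).const_mul a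
  have h2 := h.unique (h1.congr_of_eventuallyEq (Filter.Eventually.of_forall hf))
  exact (mul_eq_zero.1 h2.symm).resolve_left ha

theorem bijective_of_kernel {E : Type*} [NormedAddCommGroup E] [NormedSpace ℝ E]
    [FiniteDimensional ℝ E] (L : E →L[ℝ] E) (h : ∀ v, L v = 0 → v = 0) : Function.Bijective L := by
  have hinj : Function.Injective L := (injective_iff_map_eq_zero L).2 h
  exact ⟨hinj, (LinearMap.injective_iff_surjective (f := (L : E →ₗ[ℝ] E))).1 hinj⟩

/-- If the derivative of `Ψ` annihilates `δ` and a component of `Ψ` is a function of `t` with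
nonvanishing derivative, then the `t`-component of `δ` vanishes. -/
theorem eq_zero_of_comp_line {f : ℝ → ℝ} {t d : ℝ} (h : HasDerivAt f 0 0)
    (hT : DifferentiableAt ℝ T t) (hT' : deriv T t ≠ 0) (hf : ∀ s, f s = T (t + s * d)) :
    d = 0 := by
  have h1 : HasDerivAt (fun s : ℝ => t + s * d) d 0 := by
    simpa using ((hasDerivAt_id (0 : ℝ)).mul_const d).const_add t
  have h2 : HasDerivAt T (deriv T t) (t + 0 * d) := by simpa using hT.hasDerivAt
  have h3 := h.unique ((h2.comp 0 h1).congr_of_eventuallyEq (Filter.Eventually.of_forall hf))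
  exact (mul_eq_zero.1 h3.symm).resolve_left hT'

/-- The transformation is triangular, so a kernel vector can be eliminated one component at a time.
The component for `n` has to precede the one for `u`, since the coefficient of `u` depends on `ν n`.
-/
theorem bijective_fderiv_powerEquivalence {z : Pt × (ℝ × ℝ × ℝ) × (Fin 0 → ℝ)}
    (hd : DifferentiableAt ℝ (powerEquivalence T κ l ν) z) (hT : DifferentiableAt ℝ T z.1.1)
    (hT' : deriv T z.1.1 ≠ 0) (hκ : κ ≠ 0) :
    Function.Bijective (fderiv ℝ (powerEquivalence T κ l ν) z) := by
  obtain ⟨⟨t, x, u⟩, ⟨n, h, g⟩, y⟩ := z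
  apply bijective_of_kernel
  rintro ⟨⟨δt, δx, δu⟩, ⟨δn, δh, δg⟩, δy⟩ hδ
  have hl := hasDerivAt_line hd ((δt, δx, δu), (δn, δh, δg), δy)
  rw [hδ] at hl
  have l1 := hasDerivAt_fst_comp hl
  have l2 := hasDerivAt_fst_comp (hasDerivAt_snd_comp hl)
  have h1 : δt = 0 := eq_zero_of_comp_line (hasDerivAt_fst_comp l1) hT hT' fun s => rfl
  subst h1
  have h2 : δx = 0 := by
    have := (hasDerivAt_fst_comp (hasDerivAt_snd_comp l1)).sub_const l
    exact eq_zero_of_line this (a := κ) (b := x) (fun s => by simp [powerEquivalence]) hκ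
  have h3 : δn = 0 :=
    eq_zero_of_line (hasDerivAt_fst_comp l2) (a := 1) (b := n)
      (fun s => by simp [powerEquivalence]) one_ne_zero
  subst h3
  have h4 : δu = 0 :=
    eq_zero_of_line (hasDerivAt_snd_comp (hasDerivAt_snd_comp l1))
      (a := powerCoeff T κ (ν n) t) (b := u)
      (fun s => by simp [powerEquivalence]) (Real.exp_pos _).ne'
  have h5 : δh = 0 :=
    eq_zero_of_line (hasDerivAt_fst_comp (hasDerivAt_snd_comp l2))
      (a := (deriv T t)⁻¹) (b := h + deriv (deriv T) t / (ν n * deriv T t))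
      (fun s => by simp [powerEquivalence]; ring) (inv_ne_zero hT')
  have h6 : δg = 0 :=
    eq_zero_of_line (hasDerivAt_snd_comp (hasDerivAt_snd_comp l2))
      (a := κ ^ 2 / deriv T t) (b := g)
      (fun s => by simp [powerEquivalence]; ring) (div_ne_zero (pow_ne_zero 2 hκ) hT')
  subst h2 h4 h5 h6
  have h7 : δy = 0 := Subsingleton.elim _ _
  subst h7
  rfl

end PowerEquivalence

theorem isOpen_valueSpace : IsOpen valueSpace := by
  have e : valueSpace = (fun v : ℝ × ℝ × ℝ => v.1) ⁻¹' {0}ᶜ ∩ (fun v => v.2.2) ⁻¹' {0}ᶜ := rfl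
  rw [e]
  exact (isOpen_compl_singleton.preimage (by fun_prop)).inter
    (isOpen_compl_singleton.preimage (by fun_prop))

theorem isLift_trivial (θ : Coeffs) (Y : ℝ → Fin Reparam.trivial.k → ℝ) :
    Reparam.trivial.IsLift θ Y := by
  intro t _
  have h : Subsingleton (Fin Reparam.trivial.k → ℝ) :=
    inferInstanceAs (Subsingleton (Fin 0 → ℝ))
  have : Y = fun _ => 0 := funext fun t => Subsingleton.elim _ _
  rw [this]
  exact hasDerivAt_const _ _

/-- The function `ν` supplies the exponent used in the formulas. A constant `ν` makes the components
for the variables independent of the arbitrary elements; `ν = id` serves several exponents at once.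
Only `ν n = n` on the class matters for mapping its equations, while `hν` keeps the formulas smooth
at the other exponents. The target equation has the same exponent, so `hclosed` keeps it in the
class. -/
theorem isEquivalence_powerEquivalence {S : Set Coeffs} (hS : ∀ θ ∈ S, θ.n ≠ 1)
    (hclosed : ∀ θ ∈ S, ∀ θ' : Coeffs, θ'.n = θ.n → θ' ∈ S)
    {T : ℝ → ℝ} {I : Set ℝ} {κ l : ℝ} {ν : ℝ → ℝ} (hI : IsOpen I) (sT : ContDiffOn ℝ ∞ T I)
    (hpos : ∀ t ∈ I, 0 < κ / deriv T t) (sν : ContDiffOn ℝ ∞ ν {0}ᶜ)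
    (hν : ∀ n, n ≠ 0 → ν n ≠ 0) (hνS : ∀ θ ∈ S, ν θ.n = θ.n) (hκ : κ ≠ 0) :
    IsEquivalence (Set.Ioi 0) S Reparam.trivial (I ×ˢ Set.univ) Set.univ
      (powerEquivalence T κ l ν) := by
  have hT : ∀ t ∈ I, deriv T t ≠ 0 := fun t ht h => by
    have := hpos t ht
    simp [h] at this
  have hsm := contDiffOn_powerEquivalence (l := l) hI sT hT hpos sν hν
  have sT' : ContDiffOn ℝ ∞ (deriv T) I := sT.deriv_of_isOpen hI (by norm_cast)
  have sT'' : ContDiffOn ℝ ∞ (deriv (deriv T)) I := sT'.deriv_of_isOpen hI (by norm_cast)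
  have hZ : IsOpen ((I ×ˢ Set.univ) ×ˢ valueSpace ×ˢ (Set.univ : Set (Fin 0 → ℝ)) :
      Set (Pt × (ℝ × ℝ × ℝ) × (Fin 0 → ℝ))) :=
    (hI.prod isOpen_univ).prod (isOpen_valueSpace.prod isOpen_univ)
  have dT : ∀ t ∈ I, DifferentiableAt ℝ T t := fun t ht =>
    (sT.contDiffAt (hI.mem_nhds ht)).differentiableAt (by simp)
  have dT' : ∀ t ∈ I, DifferentiableAt ℝ (deriv T) t := fun t ht =>
    (sT'.contDiffAt (hI.mem_nhds ht)).differentiableAt (by simp)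
  refine ⟨hI.prod isOpen_univ, isOpen_univ, hsm, ?_, ?_⟩
  · intro z hz
    exact bijective_fderiv_powerEquivalence
      ((hsm.contDiffAt (hZ.mem_nhds hz)).differentiableAt (by simp)) (dT _ hz.1.1) (hT _ hz.1.1) hκ
  · intro θ hθ Y _ p hp hpd hpu _
    have hn := θ.n_ne
    set J := I ∩ θ.dom with hJ
    have hJo : IsOpen J := hI.inter θ.isOpen_dom
    have hJI : J ⊆ I := Set.inter_subset_left
    have hJd : J ⊆ θ.dom := Set.inter_subset_right
    -- The value of `h̃` solves `A' - A h + T' h̃ A = 0`, where `A'/A = -T''/(n T')`; that of `g̃`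
    -- solves `g κ² = g̃ T'`.
    set h' : ℝ → ℝ := fun t => (θ.h t + deriv (deriv T) t / (θ.n * deriv T t)) / deriv T t with hh'
    set g' : ℝ → ℝ := fun t => θ.g t * κ ^ 2 / deriv T t with hg'
    have sJ' := sT'.mono hJI
    have neJ : ∀ t ∈ J, deriv T t ≠ 0 := fun t ht => hT t (hJI ht)
    obtain ⟨I', θ', σ, hI', hpI', hsub, hn', hdom', hval, hadm⟩ := exists_target (R := Set.Ioi 0)
      (θ := θ) (T := T) (X₁ := fun _ => κ) (X₀ := fun _ => l) (A := powerCoeff T κ θ.n)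
      (B₁ := fun _ => 0) (B₀ := fun _ => 0) (h' := h') (g' := g') (t₀ := p.1) hJo
      ⟨hp.1, hpd⟩ hJd (sT.mono hJI) contDiffOn_const contDiffOn_const
      (((contDiffOn_const.div sJ' neJ).log fun t ht => (hpos t (hJI ht)).ne').div_const _).exp
      contDiffOn_const contDiffOn_const
      (((θ.smooth_h.mono hJd).add ((sT''.mono hJI).div (contDiffOn_const.mul sJ')
        fun t ht => mul_ne_zero hn (neJ t ht))).div sJ' neJ)
      (((θ.smooth_g.mono hJd).mul contDiffOn_const).div sJ' neJ) neJ (fun _ _ => hκ)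
      (fun t _ => (Real.exp_pos _).ne')
      (fun t ht => by have := neJ t ht; simp only [hg']; field_simp)
      (fun t _ => by simp) (fun t _ => by simp)
      (fun t ht => by
        have := neJ t ht
        rw [(deriv_powerCoeff (dT' t (hJI ht)) (hpos t (hJI ht))).deriv]
        simp only [hh']
        field_simp
        ring) (fun t _ => by simp) (fun t _ => by simp)
      (fun h1 => absurd h1 (hS θ hθ))
      (fun _ => ⟨rfl, fun t ht => ⟨rfl, rfl, Real.exp_pos _,
        powerCoeff_rpow hn (hpos t (hJI ht))⟩⟩)
    refine ⟨θ', hclosed θ hθ θ' hn', fun _ => 0, isLift_trivial _ _,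
      {q | q.1 ∈ I' ∧ 0 < q.2.2}, ?_, ⟨hpI', hpu⟩, ?_, ?_⟩
    · exact fun q hq => ⟨hJI (hsub hq.1), trivial⟩
    · apply hadm
      · exact (hI'.preimage continuous_fst).inter
          (isOpen_Ioi.preimage (continuous_snd.comp continuous_snd))
      · intro q hq
        refine ⟨hq.1, hq.2, ?_, ?_⟩
        · exact mul_pos (Real.exp_pos _) hq.2
        · simp [powerEquivalence, Coeffs.val, hνS θ hθ]
    · intro q hq
      obtain ⟨v1, v2, -, -⟩ := hval q.1 hq.1
      refine Prod.ext (Prod.ext ?_ (Prod.ext ?_ ?_)) (Subsingleton.elim (α := Fin 0 → ℝ) _ _)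
      · exact hn'.symm
      · simp only [powerEquivalence, Coeffs.val, hνS θ hθ]
        exact v1.symm
      · simp only [powerEquivalence, Coeffs.val]
        exact v2.symm

/-- In the normal form with `n ≠ 1`, the constants are `κ = X₁` and `l = X₀`, and `A` is the
positive root of `T' Aⁿ = κ`. The equations for `A'` and `g` then determine `h̃` and `g̃`, so they
agree with the components of `powerEquivalence`. -/
theorem exists_equivalence_of_ne_one {S : Set Coeffs} (hS : ∀ θ ∈ S, θ.n ≠ 1)
    (hclosed : ∀ θ ∈ S, ∀ θ' : Coeffs, θ'.n = θ.n → θ' ∈ S) {ν : ℝ → ℝ}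
    (sν : ContDiffOn ℝ ∞ ν {0}ᶜ) (hν : ∀ n, n ≠ 0 → ν n ≠ 0) (hνS : ∀ θ ∈ S, ν θ.n = θ.n)
    {θ θ' : Coeffs} (hθ : θ ∈ S) {φ : Pt → Pt} {Ω : Set Pt} {p : Pt}
    (H : IsAdmissible (Set.Ioi 0) θ θ' φ Ω) (hp : p ∈ Ω)
    (Y Y' : ℝ → Fin Reparam.trivial.k → ℝ) :
    ∃ (T : ℝ → ℝ) (κ l : ℝ) (Ω' : Set Pt),
      IsEquivalence (Set.Ioi 0) S Reparam.trivial Ω' Set.univ (powerEquivalence T κ l ν) ∧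
      p ∈ Ω' ∧ Induces Reparam.trivial (powerEquivalence T κ l ν) θ θ' Y Y' φ p := by
  obtain ⟨hn', ε, T, X₁, X₀, A, B₁, B₀, N⟩ := H.normal_form (Or.inl rfl) hp
  have hn1 := hS θ hθ
  have hn := θ.n_ne
  have hM := N.of_ne_one hn1
  have hp0 : p.1 ∈ Metric.ball p.1 ε := Metric.mem_ball_self N.pos
  set I := Metric.ball p.1 ε with hI
  have hX₁ : ∀ t ∈ I, X₁ t = X₁ p.1 := fun t ht =>
    eq_of_hasDerivAt_zero Metric.isOpen_ball (isPreconnected_ball _ _) (fun s hs => by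
      rw [← (hM s hs).2.2.1]
      exact ((N.smooth_X₁.contDiffAt (ball_mem_nhds hs)).differentiableAt (by simp)).hasDerivAt)
      ht hp0
  have hX₀ : ∀ t ∈ I, X₀ t = X₀ p.1 := fun t ht =>
    eq_of_hasDerivAt_zero Metric.isOpen_ball (isPreconnected_ball _ _) (fun s hs => by
      rw [← (hM s hs).2.2.2.1]
      exact ((N.smooth_X₀.contDiffAt (ball_mem_nhds hs)).differentiableAt (by simp)).hasDerivAt)
      ht hp0
  have hpow : ∀ t ∈ I, deriv T t * A t ^ θ.n = X₁ p.1 := fun t ht => by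
    rw [(hM t ht).2.2.2.2.2, hX₁ t ht]
  have hpos : ∀ t ∈ I, 0 < X₁ p.1 / deriv T t := fun t ht => by
    rw [← hpow t ht, mul_div_cancel_left₀ _ (N.T_ne t ht)]
    exact Real.rpow_pos_of_pos (hM t ht).2.2.2.2.1 _
  have hA : ∀ t ∈ I, A t = powerCoeff T (X₁ p.1) θ.n t := fun t ht =>
    eq_powerCoeff hn (hM t ht).2.2.2.2.1 (N.T_ne t ht) (hpow t ht)
  have sT' : ContDiffOn ℝ ∞ (deriv T) I :=
    N.smooth_T.deriv_of_isOpen Metric.isOpen_ball (by norm_cast)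
  refine ⟨T, X₁ p.1, X₀ p.1, I ×ˢ Set.univ, isEquivalence_powerEquivalence hS hclosed
    Metric.isOpen_ball N.smooth_T hpos sν hν hνS (N.X₁_ne _ hp0), ⟨hp0, trivial⟩, ?_⟩
  have hbox := box_mem_nhds (t := p.1) (x := p.2.1) (u := p.2.2) hp0 (Metric.mem_ball_self N.pos)
    (Metric.mem_ball_self N.pos)
  filter_upwards [hbox] with q hq
  obtain ⟨ht, hx, hu⟩ := hq
  have hφ := (N.eq _ ht _ hx _ hu).2
  obtain ⟨b1, b0, -⟩ := hM _ ht
  have hAd : deriv A q.1 =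
      -(powerCoeff T (X₁ p.1) θ.n q.1 * deriv (deriv T) q.1 / (θ.n * deriv T q.1)) := by
    rw [← (deriv_powerCoeff ((sT'.contDiffAt (ball_mem_nhds ht)).differentiableAt (by simp))
      (hpos _ ht)).deriv]
    apply Filter.EventuallyEq.deriv_eq
    filter_upwards [ball_mem_nhds ht] with s hs using hA s hs
  have hh := N.A_eq _ ht
  have hg := N.g_eq _ ht
  rw [hAd, b1, hA _ ht] at hh
  rw [hX₁ _ ht] at hg
  have hTne := N.T_ne _ ht
  have hAne : powerCoeff T (X₁ p.1) θ.n q.1 ≠ 0 := (Real.exp_pos _).ne'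
  change φ q = _ at hφ
  rw [hφ, b1, b0, hX₁ _ ht, hX₀ _ ht, hA _ ht]
  refine Prod.ext (Prod.ext rfl (Prod.ext rfl ?_)) (Prod.ext (Prod.ext ?_ (Prod.ext ?_ ?_))
    (Subsingleton.elim (α := Fin 0 → ℝ) _ _))
  · simp [powerEquivalence, Coeffs.val, hνS θ hθ]
  · exact hn'.symm
  · simp only [powerEquivalence, Coeffs.val, hνS θ hθ]
    field_simp at hh ⊢
    apply mul_left_cancel₀ hAne
    linear_combination -hh
  · simp only [powerEquivalence, Coeffs.val]
    rw [div_eq_iff hTne]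
    linear_combination hg

/-- With `ν` constantly `n`, the components for `t, x, u` do not involve the arbitrary elements at
all. -/
theorem normalizedUsual_fixedClass {n : ℝ} (hn : n ≠ 0) (hn1 : n ≠ 1) :
    NormalizedUsual (Set.Ioi 0) (fixedClass n) := by
  intro θ hθ θ' hθ' Y Y' _ _ φ Ω H p hp
  obtain ⟨T, κ, l, Ω', h1, h2, h3⟩ := exists_equivalence_of_ne_one (S := fixedClass n)
    (ν := fun _ => n) (fun θ hθ h => hn1 (hθ.symm.trans h)) (fun θ hθ θ' h => h.trans hθ)
    contDiffOn_const (fun _ _ => hn) (fun θ hθ => Eq.symm hθ) hθ H hp Y Y'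
  exact ⟨Ω', Set.univ, _, h1, fun q _ v _ v' _ y _ y' _ => rfl, h2, trivial, h3⟩

/-- With `ν = id`, a single transformation acts on all the exponents of `N`, through the coefficient
`(κ/T')^(1/n)` of `u`. -/
theorem normalizedGen_iUnion {N : Set ℝ} (h1 : 1 ∉ N) :
    NormalizedGen (Set.Ioi 0) (⋃ n ∈ N, fixedClass n) := by
  intro θ hθ θ' hθ' Y Y' _ _ φ Ω H p hp
  have hmem : ∀ θ : Coeffs, θ ∈ (⋃ n ∈ N, fixedClass n) ↔ θ.n ∈ N := by
    intro θ
    simp [fixedClass]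
  obtain ⟨T, κ, l, Ω', k1, k2, k3⟩ := exists_equivalence_of_ne_one (S := ⋃ n ∈ N, fixedClass n)
    (ν := fun n => n) (fun θ hθ h => h1 (h ▸ (hmem θ).1 hθ))
    (fun θ hθ θ' h => (hmem θ').2 (h ▸ (hmem θ).1 hθ))
    contDiffOn_id (fun _ h => h) (fun θ _ => rfl) hθ H hp Y Y'
  exact ⟨Ω', Set.univ, _, k1, k2, trivial, k3⟩

theorem not_connected {n m : ℝ} (h : n ≠ m) :
    ¬ Connected (Set.Ioi 0) (fixedClass n) (fixedClass m) := by
  rintro ⟨θ, hθ, θ', hθ', φ, Ω, ⟨p, hp⟩, H⟩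
  have := (H.normal_form (Or.inl rfl) hp).1
  exact h ((show θ.n = n from hθ) ▸ (show θ'.n = m from hθ') ▸ this.symm)

/-! ### Integration of the equations for `n = 1` -/

/-- Two solutions of the same homogeneous linear equation of first order are proportional. -/
theorem proportional_of_linear_ode {s : Set ℝ} (hs : IsOpen s) (hc : IsPreconnected s)
    (hne : s.Nonempty) {f w r : ℝ → ℝ} (hf : ∀ t ∈ s, HasDerivAt f (r t * f t) t)
    (hw : ∀ t ∈ s, HasDerivAt w (r t * w t) t) (h0 : ∀ t ∈ s, w t ≠ 0) :
    ∃ c, ∀ t ∈ s, f t = c * w t := by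
  obtain ⟨t₀, ht₀⟩ := hne
  refine ⟨f t₀ / w t₀, fun t ht => ?_⟩
  have := eq_of_hasDerivAt_zero hs hc (f := fun t => f t / w t) (fun t ht => by
    have := (hf t ht).div (hw t ht) (h0 t ht)
    convert! this using 1
    ring) ht ht₀
  rw [← this, div_mul_cancel₀ _ (h0 t ht)]

/-- The linear fractional form of the solutions of `a' = c₁ a² y'`, `v' = c a² y'`. -/
theorem linear_fractional_of_ode {s : Set ℝ} (hs : IsOpen s) (hc : IsPreconnected s)
    (hne : s.Nonempty) {a v y y' : ℝ → ℝ} {c₁ c : ℝ} (ha0 : ∀ t ∈ s, a t ≠ 0)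
    (hy : ∀ t ∈ s, HasDerivAt y (y' t) t) (ha : ∀ t ∈ s, HasDerivAt a (c₁ * a t ^ 2 * y' t) t)
    (hv : ∀ t ∈ s, HasDerivAt v (c * a t ^ 2 * y' t) t) :
    ∃ d₁ d₀, ∀ t ∈ s, v t = a t * (d₁ * y t + d₀) ∧ c * a t = d₁ + c₁ * v t := by
  obtain ⟨t₀, ht₀⟩ := hne
  -- A first integral, with value `d`. It also gives `(v/a)' = (c a - c₁ v) y' = d y'`, so `v/a` is
  -- affine in `y`.
  have h1 : ∀ t ∈ s, c * a t - c₁ * v t = c * a t₀ - c₁ * v t₀ := fun t ht =>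
    eq_of_hasDerivAt_zero hs hc (f := fun t => c * a t - c₁ * v t) (fun t ht => by
      have := ((ha t ht).const_mul c).sub ((hv t ht).const_mul c₁)
      convert! this using 1
      ring) ht ht₀
  obtain ⟨d, hd⟩ : ∃ d, d = c * a t₀ - c₁ * v t₀ := ⟨_, rfl⟩
  rw [← hd] at h1
  have h2 : ∀ t ∈ s, v t / a t - d * y t = v t₀ / a t₀ - d * y t₀ := fun t ht =>
    eq_of_hasDerivAt_zero hs hc (f := fun t => v t / a t - d * y t) (fun t ht => by
      have := ((hv t ht).div (ha t ht) (ha0 t ht)).sub ((hy t ht).const_mul d)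
      convert! this using 1
      have := ha0 t ht
      rw [← h1 t ht]
      field_simp
      ring) ht ht₀
  refine ⟨d, v t₀ / a t₀ - d * y t₀, fun t ht => ⟨?_, by linarith [h1 t ht]⟩⟩
  have := ha0 t ht
  rw [← h2 t ht]
  field_simp
  ring

/-- `(1/a)' = -c₁ y'`; this provides the denominator of the linear fractional functions. -/
theorem reciprocal_of_ode {s : Set ℝ} (hs : IsOpen s) (hc : IsPreconnected s)
    (hne : s.Nonempty) {a y y' : ℝ → ℝ} {c₁ : ℝ} (ha0 : ∀ t ∈ s, a t ≠ 0)
    (hy : ∀ t ∈ s, HasDerivAt y (y' t) t) (ha : ∀ t ∈ s, HasDerivAt a (c₁ * a t ^ 2 * y' t) t) :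
    ∃ c₂, ∀ t ∈ s, (a t)⁻¹ = c₂ - c₁ * y t := by
  obtain ⟨t₀, ht₀⟩ := hne
  refine ⟨(a t₀)⁻¹ + c₁ * y t₀, fun t ht => ?_⟩
  have := eq_of_hasDerivAt_zero hs hc (f := fun t => (a t)⁻¹ + c₁ * y t) (fun t ht => by
    have := ((ha t ht).inv (ha0 t ht)).add ((hy t ht).const_mul c₁)
    convert! this using 1
    have := ha0 t ht
    field_simp
    ring) ht ht₀
  linear_combination this

/-! ### Equivalence transformations of the reparameterized class with `n = 1` -/

/-- The virtual arbitrary elements of the class of Burgers equations: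
`Y₁' = h`, `Y₂' = exp (-Y₁)`. -/
noncomputable abbrev burgersReparam : Reparam where
  k := 2
  F := fun z => ![z.2.1.2.1, Real.exp (-z.2.2 0)]
  smooth := by
    apply ContDiff.contDiffOn
    rw [contDiff_pi]
    intro i
    fin_cases i
    · simp only [Fin.zero_eta, Matrix.cons_val_zero]; fun_prop
    · simp only [Fin.mk_one, Matrix.cons_val_one, Matrix.cons_val_fin_one]; fun_prop

theorem isLift_burgersReparam {θ : Coeffs} {Y : ℝ → Fin 2 → ℝ} :
    burgersReparam.IsLift θ Y ↔ ∀ t ∈ θ.dom, HasDerivAt (fun s => Y s 0) (θ.h t) t ∧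
      HasDerivAt (fun s => Y s 1) (Real.exp (-Y t 0)) t := by
  refine forall₂_congr fun t _ => ?_
  rw [hasDerivAt_pi, Fin.forall_fin_two]
  rfl

/-- The parameters of an equivalence transformation of the class of Burgers equations. -/
structure BurgersParams where
  T : ℝ → ℝ
  c₁ : ℝ
  c₂ : ℝ
  d₁ : ℝ
  d₀ : ℝ
  e₁ : ℝ
  e₀ : ℝ

namespace BurgersParams

variable (P : BurgersParams)

/-- Determinant of the linear fractional function `X₀ = (d₁ y + d₀)/(c₂ - c₁ y)`, so that its
derivative in `y` is `c₀ X²`. -/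
def c₀ : ℝ := P.d₁ * P.c₂ + P.c₁ * P.d₀

/-- Determinant of the linear fractional function that transforms the second virtual element. Its
sign has to be that of `T'`, since `exp(-Y₁)` is positive before and after. -/
def k : ℝ := P.e₁ * P.c₂ + P.c₁ * P.e₀

/-- The coefficient of `x`. -/
noncomputable def X (y : ℝ) : ℝ := (P.c₂ - P.c₁ * y)⁻¹

/-- The common factor of the coefficients of `x` and `1` in the component for `u`. -/
noncomputable def W (t y₁ y₂ : ℝ) : ℝ := P.X y₂ ^ 2 * Real.exp (-y₁) / deriv P.T t

/-- `A = X₁/T'`, `B₁ = X₁'/T'` and `B₀ = X₀'/T'`, with the derivatives in `t` computed from `Y₂' =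
exp(-Y₁)`. -/
noncomputable def U (q : Pt) (y : Fin 2 → ℝ) : ℝ :=
  P.X (y 1) / deriv P.T q.1 * q.2.2 +
    (P.c₁ * P.W q.1 (y 0) (y 1) * q.2.1 + P.c₀ * P.W q.1 (y 0) (y 1))

/-- Solution `h̃` of `A' + B₁ - A h + T' h̃ A = 0`. Both `A'` and `B₁` contribute `c₁ W`, whence the
factor `2`. -/
noncomputable def h' (t h y₁ y₂ : ℝ) : ℝ :=
  (h - 2 * P.c₁ * P.X y₂ * Real.exp (-y₁) + deriv (deriv P.T) t / deriv P.T t) / deriv P.T t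

/-- Chosen so that `exp(-y₁')` is the derivative of `y₂'` with respect to the new time, namely `k X²
exp(-y₁) / T'`. -/
noncomputable def y₁' (t y₁ y₂ : ℝ) : ℝ := y₁ - Real.log (P.k / deriv P.T t * P.X y₂ ^ 2)

noncomputable def y₂' (y₂ : ℝ) : ℝ := P.X y₂ * (P.e₁ * y₂ + P.e₀)

/-- The equivalence transformation of the reparameterized class of Burgers equations. -/
noncomputable def equivalence (z : Pt × (ℝ × ℝ × ℝ) × (Fin 2 → ℝ)) :
    Pt × (ℝ × ℝ × ℝ) × (Fin 2 → ℝ) :=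
  ((P.T z.1.1, P.X (z.2.2 1) * z.1.2.1 + P.X (z.2.2 1) * (P.d₁ * z.2.2 1 + P.d₀), P.U z.1 z.2.2),
    (z.2.1.1, P.h' z.1.1 z.2.1.2.1 (z.2.2 0) (z.2.2 1),
      z.2.1.2.2 * P.X (z.2.2 1) ^ 2 / deriv P.T z.1.1),
    ![P.y₁' z.1.1 (z.2.2 0) (z.2.2 1), P.y₂' (z.2.2 1)])

variable {P} {I : Set ℝ}

theorem X_ne {y : ℝ} (h : P.c₂ - P.c₁ * y ≠ 0) : P.X y ≠ 0 := inv_ne_zero h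

theorem hasDerivAt_X {y : ℝ} (h : P.c₂ - P.c₁ * y ≠ 0) :
    HasDerivAt P.X (P.c₁ * P.X y ^ 2) y := by
  have h1 : HasDerivAt (fun y => P.c₂ - P.c₁ * y) (-P.c₁) y := by
    simpa using ((hasDerivAt_id y).const_mul P.c₁).const_sub P.c₂
  have := h1.inv h
  convert! this using 1
  simp only [X]
  field_simp

theorem hasDerivAt_mul_X {y : ℝ} (h : P.c₂ - P.c₁ * y ≠ 0) (d e : ℝ) :
    HasDerivAt (fun y => P.X y * (d * y + e)) ((d * P.c₂ + P.c₁ * e) * P.X y ^ 2) y := by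
  have := (hasDerivAt_X h).mul (((hasDerivAt_id y).const_mul d).add_const e)
  convert! this using 1
  simp only [X, id]
  field_simp
  ring

theorem contDiffOn_X : ContDiffOn ℝ ∞ P.X {y | P.c₂ - P.c₁ * y ≠ 0} :=
  ContDiffOn.inv (by fun_prop) fun _ h => h

theorem contDiffOn_equivalence (hI : IsOpen I) (sT : ContDiffOn ℝ ∞ P.T I)
    (hk : ∀ t ∈ I, 0 < P.k / deriv P.T t) :
    ContDiffOn ℝ ∞ P.equivalence {z | z.1.1 ∈ I ∧ P.c₂ - P.c₁ * z.2.2 1 ≠ 0} := by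
  have hT : ∀ t ∈ I, deriv P.T t ≠ 0 := fun t ht h => by
    have := hk t ht
    simp [h] at this
  have sT' : ContDiffOn ℝ ∞ (deriv P.T) I := sT.deriv_of_isOpen hI (by norm_cast)
  have sT'' : ContDiffOn ℝ ∞ (deriv (deriv P.T)) I := sT'.deriv_of_isOpen hI (by norm_cast)
  set Z : Set (Pt × (ℝ × ℝ × ℝ) × (Fin 2 → ℝ)) :=
    {z | z.1.1 ∈ I ∧ P.c₂ - P.c₁ * z.2.2 1 ≠ 0} with hZ
  have pt : ContDiffOn ℝ ∞ (fun z : Pt × (ℝ × ℝ × ℝ) × (Fin 2 → ℝ) => z.1.1) Z := by fun_prop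
  have px : ContDiffOn ℝ ∞ (fun z : Pt × (ℝ × ℝ × ℝ) × (Fin 2 → ℝ) => z.1.2.1) Z := by fun_prop
  have pu : ContDiffOn ℝ ∞ (fun z : Pt × (ℝ × ℝ × ℝ) × (Fin 2 → ℝ) => z.1.2.2) Z := by fun_prop
  have pn : ContDiffOn ℝ ∞ (fun z : Pt × (ℝ × ℝ × ℝ) × (Fin 2 → ℝ) => z.2.1.1) Z := by fun_prop
  have ph : ContDiffOn ℝ ∞ (fun z : Pt × (ℝ × ℝ × ℝ) × (Fin 2 → ℝ) => z.2.1.2.1) Z := by fun_prop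
  have pg : ContDiffOn ℝ ∞ (fun z : Pt × (ℝ × ℝ × ℝ) × (Fin 2 → ℝ) => z.2.1.2.2) Z := by fun_prop
  have p0 : ContDiffOn ℝ ∞ (fun z : Pt × (ℝ × ℝ × ℝ) × (Fin 2 → ℝ) => z.2.2 0) Z := by fun_prop
  have p1 : ContDiffOn ℝ ∞ (fun z : Pt × (ℝ × ℝ × ℝ) × (Fin 2 → ℝ) => z.2.2 1) Z := by fun_prop
  have mt : Set.MapsTo (fun z : Pt × (ℝ × ℝ × ℝ) × (Fin 2 → ℝ) => z.1.1) Z I := fun z hz => hz.1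
  have q0 := sT.comp pt mt
  have q1 := sT'.comp pt mt
  have q2 := sT''.comp pt mt
  have qX := contDiffOn_X.comp p1 (show Set.MapsTo _ Z _ from fun z hz => hz.2)
  have n1 : ∀ z ∈ Z, deriv P.T z.1.1 ≠ 0 := fun z hz => hT _ (mt hz)
  have qW := ((qX.pow 2).mul p0.neg.exp).div q1 n1
  refine (q0.prodMk (((qX.mul px).add (qX.mul ((contDiffOn_const.mul p1).add
    contDiffOn_const))).prodMk (((qX.div q1 n1).mul pu).add
    (((contDiffOn_const.mul qW).mul px).add (contDiffOn_const.mul qW))))).prodMk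
    ((pn.prodMk (((((ph.sub ((contDiffOn_const.mul qX).mul p0.neg.exp)).add
      (q2.div q1 n1)).div q1 n1).prodMk ((pg.mul (qX.pow 2)).div q1 n1)))).prodMk ?_)
  rw [contDiffOn_pi]
  intro i
  fin_cases i
  · exact p0.sub (((contDiffOn_const.div q1 n1).mul (qX.pow 2)).log fun z hz =>
      mul_ne_zero (hk _ (mt hz)).ne' (pow_ne_zero 2 (X_ne hz.2)))
  · exact qX.mul ((contDiffOn_const.mul p1).add contDiffOn_const)

/-- Triangular elimination again, now starting with `t` and the virtual elements, on which the other
components depend. The derivative of `y₂'` is `k X²`, which is nonzero. -/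
theorem bijective_fderiv_equivalence {z : Pt × (ℝ × ℝ × ℝ) × (Fin 2 → ℝ)}
    (hd : DifferentiableAt ℝ P.equivalence z) (hT : DifferentiableAt ℝ P.T z.1.1)
    (hk : 0 < P.k / deriv P.T z.1.1) (hc : P.c₂ - P.c₁ * z.2.2 1 ≠ 0) :
    Function.Bijective (fderiv ℝ P.equivalence z) := by
  have hT' : deriv P.T z.1.1 ≠ 0 := fun h => by simp [h] at hk
  have hk0 : P.k ≠ 0 := fun h => by simp [h] at hk
  have hX := X_ne hc
  obtain ⟨⟨t, x, u⟩, ⟨n, h, g⟩, y⟩ := z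
  apply bijective_of_kernel
  rintro ⟨⟨δt, δx, δu⟩, ⟨δn, δh, δg⟩, δy⟩ hδ
  dsimp only at hX hc hT'
  have hl := hasDerivAt_line hd ((δt, δx, δu), (δn, δh, δg), δy)
  rw [hδ] at hl
  have l1 := hasDerivAt_fst_comp hl
  have l2 := hasDerivAt_fst_comp (hasDerivAt_snd_comp hl)
  have l3 := hasDerivAt_pi.1 (hasDerivAt_snd_comp (hasDerivAt_snd_comp hl))
  have h1 : δt = 0 := eq_zero_of_comp_line (hasDerivAt_fst_comp l1) hT hT' fun s => rfl
  subst h1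
  have hy2 : δy 1 = 0 := by
    have hm := hasDerivAt_mul_X hc P.e₁ P.e₀
    refine eq_zero_of_comp_line (l3 1) hm.differentiableAt ?_ fun s => rfl
    rw [hm.deriv]
    exact mul_ne_zero hk0 (pow_ne_zero 2 hX)
  have hy1 : δy 0 = 0 :=
    eq_zero_of_line (l3 0) (a := 1) (b := y 0 - Real.log (P.k / deriv P.T t * P.X (y 1) ^ 2))
      (fun s => by simp [equivalence, y₁', hy2]; ring) one_ne_zero
  have hy : δy = 0 := by
    ext i
    fin_cases i
    · exact hy1
    · exact hy2
  subst hy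
  have h2 : δx = 0 :=
    eq_zero_of_line (hasDerivAt_fst_comp (hasDerivAt_snd_comp l1))
      (a := P.X (y 1)) (b := x + (P.d₁ * y 1 + P.d₀))
      (fun s => by simp [equivalence]; ring) hX
  subst h2
  have h3 : δn = 0 :=
    eq_zero_of_line (hasDerivAt_fst_comp l2) (a := 1) (b := n)
      (fun s => by simp [equivalence]) one_ne_zero
  subst h3
  have h4 : δu = 0 := by
    have := (hasDerivAt_snd_comp (hasDerivAt_snd_comp l1)).sub_const
      (P.c₁ * P.W t (y 0) (y 1) * x + P.c₀ * P.W t (y 0) (y 1))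
    exact eq_zero_of_line this (a := P.X (y 1) / deriv P.T t) (b := u)
      (fun s => by simp [equivalence, U]) (div_ne_zero hX hT')
  have h5 : δh = 0 :=
    eq_zero_of_line (hasDerivAt_fst_comp (hasDerivAt_snd_comp l2))
      (a := (deriv P.T t)⁻¹) (b := h - 2 * P.c₁ * P.X (y 1) * Real.exp (-y 0) +
        deriv (deriv P.T) t / deriv P.T t)
      (fun s => by simp [equivalence, h']; ring) (inv_ne_zero hT')
  have h6 : δg = 0 :=
    eq_zero_of_line (hasDerivAt_snd_comp (hasDerivAt_snd_comp l2))
      (a := P.X (y 1) ^ 2 / deriv P.T t) (b := g)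
      (fun s => by simp [equivalence]; ring) (div_ne_zero (pow_ne_zero 2 hX) hT')
  subst h4 h5 h6
  rfl

variable {R : Set ℝ}

/-- Along any lift the formulas satisfy the conditions of `exists_target`, since `Y₁' = h` and `Y₂'
= exp(-Y₁)` produce the required derivatives. The additive term in `U` can destroy positivity, so
`hU` requires `Ω` and `B` small enough for `U` to stay in `R`. -/
theorem isEquivalence_equivalence (hI : IsOpen I) (sT : ContDiffOn ℝ ∞ P.T I)
    (hk : ∀ t ∈ I, 0 < P.k / deriv P.T t) {Ω : Set Pt} {B : Set (Fin 2 → ℝ)} (hΩ : IsOpen Ω)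
    (hB : IsOpen B) (hΩI : ∀ q ∈ Ω, q.1 ∈ I) (hBc : ∀ y ∈ B, P.c₂ - P.c₁ * y 1 ≠ 0)
    (hU : ∀ q ∈ Ω, ∀ y ∈ B, P.U q y ∈ R) (hR : IsOpen R) :
    IsEquivalence R (fixedClass 1) burgersReparam Ω B P.equivalence := by
  have hT : ∀ t ∈ I, deriv P.T t ≠ 0 := fun t ht h => by
    have := hk t ht
    simp [h] at this
  have hsm := contDiffOn_equivalence hI sT hk
  have sT' : ContDiffOn ℝ ∞ (deriv P.T) I := sT.deriv_of_isOpen hI (by norm_cast)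
  have sT'' : ContDiffOn ℝ ∞ (deriv (deriv P.T)) I := sT'.deriv_of_isOpen hI (by norm_cast)
  have hZ : IsOpen {z : Pt × (ℝ × ℝ × ℝ) × (Fin 2 → ℝ) | z.1.1 ∈ I ∧
      P.c₂ - P.c₁ * z.2.2 1 ≠ 0} :=
    (hI.preimage (by fun_prop)).inter (isOpen_compl_singleton.preimage (by fun_prop))
  have dT : ∀ t ∈ I, HasDerivAt P.T (deriv P.T t) t := fun t ht =>
    ((sT.contDiffAt (hI.mem_nhds ht)).differentiableAt (by simp)).hasDerivAt
  have dT' : ∀ t ∈ I, HasDerivAt (deriv P.T) (deriv (deriv P.T) t) t := fun t ht =>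
    ((sT'.contDiffAt (hI.mem_nhds ht)).differentiableAt (by simp)).hasDerivAt
  refine ⟨hΩ, hB, hsm.mono fun z hz => ⟨hΩI _ hz.1, hBc _ hz.2.2⟩, ?_, ?_⟩
  · intro z hz
    exact bijective_fderiv_equivalence ((hsm.contDiffAt (hZ.mem_nhds
      ⟨hΩI _ hz.1, hBc _ hz.2.2⟩)).differentiableAt (by simp))
      (dT _ (hΩI _ hz.1)).differentiableAt (hk _ (hΩI _ hz.1)) (hBc _ hz.2.2)
  · intro θ hθ Y hY p hp hpd _ hpB
    have hn : θ.n = 1 := hθ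
    rw [isLift_burgersReparam] at hY
    have hYc : ContinuousOn Y θ.dom := by
      rw [continuousOn_pi, Fin.forall_fin_two]
      exact ⟨fun t ht => (hY t ht).1.continuousAt.continuousWithinAt,
        fun t ht => (hY t ht).2.continuousAt.continuousWithinAt⟩
    obtain ⟨J, hJdef⟩ : ∃ J, J = I ∩ (θ.dom ∩ Y ⁻¹' B) := ⟨_, rfl⟩
    have hJo : IsOpen J := by
      rw [hJdef]; exact hI.inter (hYc.isOpen_inter_preimage θ.isOpen_dom hB)
    have hJI : J ⊆ I := by rw [hJdef]; exact Set.inter_subset_left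
    have hJd : J ⊆ θ.dom := by rw [hJdef]; exact fun t ht => ht.2.1
    have hJB : ∀ t ∈ J, Y t ∈ B := by rw [hJdef]; exact fun t ht => ht.2.2
    have hpJ : p.1 ∈ J := by rw [hJdef]; exact ⟨hΩI _ hp, hpd, hpB⟩
    obtain ⟨y₁, hy₁⟩ : ∃ y : ℝ → ℝ, y = fun t => Y t 0 := ⟨_, rfl⟩
    obtain ⟨y₂, hy₂⟩ : ∃ y : ℝ → ℝ, y = fun t => Y t 1 := ⟨_, rfl⟩
    have d₁ : ∀ t ∈ J, HasDerivAt y₁ (θ.h t) t := fun t ht => by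
      rw [hy₁]; exact (hY t (hJd ht)).1
    have d₂ : ∀ t ∈ J, HasDerivAt y₂ (Real.exp (-y₁ t)) t := fun t ht => by
      rw [hy₂, hy₁]; exact (hY t (hJd ht)).2
    -- A lift is only assumed differentiable; its smoothness follows from its differential
    -- equations.
    have s₁ : ContDiffOn ℝ ∞ y₁ J := by
      rw [contDiffOn_infty_iff_deriv_of_isOpen hJo]
      exact ⟨fun t ht => (d₁ t ht).differentiableAt.differentiableWithinAt,
        (θ.smooth_h.mono hJd).congr fun t ht => (d₁ t ht).deriv⟩
    have s₂ : ContDiffOn ℝ ∞ y₂ J := by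
      rw [contDiffOn_infty_iff_deriv_of_isOpen hJo]
      exact ⟨fun t ht => (d₂ t ht).differentiableAt.differentiableWithinAt,
        s₁.neg.exp.congr fun t ht => (d₂ t ht).deriv⟩
    have neX : ∀ t ∈ J, P.c₂ - P.c₁ * y₂ t ≠ 0 := fun t ht => by
      rw [hy₂]; exact hBc _ (hJB t ht)
    have neX' : ∀ t ∈ J, P.X (y₂ t) ≠ 0 := fun t ht => X_ne (neX t ht)
    have neT : ∀ t ∈ J, deriv P.T t ≠ 0 := fun t ht => hT t (hJI ht)
    have sJ := sT.mono hJI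
    have sJ' := sT'.mono hJI
    have sJ'' := sT''.mono hJI
    have sX : ContDiffOn ℝ ∞ (fun t => P.X (y₂ t)) J := contDiffOn_X.comp s₂ neX
    have sW : ContDiffOn ℝ ∞ (fun t => P.W t (y₁ t) (y₂ t)) J :=
      ((sX.pow 2).mul s₁.neg.exp).div sJ' neT
    have dX : ∀ t ∈ J, HasDerivAt (fun t => P.X (y₂ t))
        (P.c₁ * P.X (y₂ t) ^ 2 * Real.exp (-y₁ t)) t := fun t ht =>
      (hasDerivAt_X (neX t ht)).comp t (d₂ t ht)
    have dV : ∀ d e t, t ∈ J → HasDerivAt (fun t => P.X (y₂ t) * (d * y₂ t + e))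
        ((d * P.c₂ + P.c₁ * e) * P.X (y₂ t) ^ 2 * Real.exp (-y₁ t)) t := fun d e t ht =>
      (hasDerivAt_mul_X (neX t ht) d e).comp t (d₂ t ht)
    have dA : ∀ t ∈ J, HasDerivAt (fun t => P.X (y₂ t) / deriv P.T t)
        (P.c₁ * P.W t (y₁ t) (y₂ t) - P.X (y₂ t) / deriv P.T t * (deriv (deriv P.T) t
          / deriv P.T t)) t := fun t ht => by
      have := (dX t ht).div (dT' t (hJI ht)) (neT t ht)
      convert! this using 1
      have := neT t ht
      simp only [W]
      field_simp
    -- `W' = -T' h̃ W`; as `B₁` and `B₀` are constant multiples of `W`, both of their equations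
    -- follow.
    have dW : ∀ t ∈ J, HasDerivAt (fun t => P.W t (y₁ t) (y₂ t))
        (-(deriv P.T t * P.h' t (θ.h t) (y₁ t) (y₂ t) * P.W t (y₁ t) (y₂ t))) t := fun t ht => by
      have := (((dX t ht).pow 2).mul (d₁ t ht).neg.exp).div (dT' t (hJI ht)) (neT t ht)
      convert! this using 1
      have := neT t ht
      simp only [W, h', Pi.mul_apply, Pi.pow_apply, Pi.neg_apply]
      field_simp
      push_cast
      ring
    obtain ⟨I', θ', σ, hI', hpI', hsub, hn', hdom', hval, hadm⟩ := exists_target (R := R)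
      (θ := θ) (T := P.T) (X₁ := fun t => P.X (y₂ t))
      (X₀ := fun t => P.X (y₂ t) * (P.d₁ * y₂ t + P.d₀)) (A := fun t => P.X (y₂ t) / deriv P.T t)
      (B₁ := fun t => P.c₁ * P.W t (y₁ t) (y₂ t)) (B₀ := fun t => P.c₀ * P.W t (y₁ t) (y₂ t))
      (h' := fun t => P.h' t (θ.h t) (y₁ t) (y₂ t))
      (g' := fun t => θ.g t * P.X (y₂ t) ^ 2 / deriv P.T t) (t₀ := p.1) hJo hpJ hJd
      sJ sX (sX.mul ((contDiffOn_const.mul s₂).add contDiffOn_const)) (sX.div sJ' neT)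
      (contDiffOn_const.mul sW) (contDiffOn_const.mul sW)
      ((((θ.smooth_h.mono hJd).sub ((contDiffOn_const.mul sX).mul s₁.neg.exp)).add
        (sJ''.div sJ' neT)).div sJ' neT)
      (((θ.smooth_g.mono hJd).mul (sX.pow 2)).div sJ' neT) neT neX'
      (fun t ht => div_ne_zero (neX' t ht) (neT t ht))
      (fun t ht => by have := neT t ht; field_simp)
      (fun t ht => by
        have := neT t ht
        rw [(dX t ht).deriv]; simp only [W]; field_simp)
      (fun t ht => by
        have := neT t ht
        rw [(dV _ _ t ht).deriv]; simp only [W, c₀]; field_simp)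
      (fun t ht => by
        have := neT t ht
        rw [(dA t ht).deriv]; simp only [W, h']; field_simp; ring)
      (fun t ht => by
        rw [((dW t ht).const_mul P.c₁).deriv]; ring)
      (fun t ht => by
        rw [((dW t ht).const_mul P.c₀).deriv]; ring)
      (fun _ t ht => by have := neT t ht; field_simp)
      (fun h1 => absurd hn h1)
    refine ⟨θ', hn'.trans hn, fun s => ![P.y₁' (σ s) (y₁ (σ s)) (y₂ (σ s)), P.y₂' (y₂ (σ s))], ?_,
      {q | q ∈ Ω ∧ q.1 ∈ I' ∧ q.2.2 ∈ R}, fun q hq => hq.1, ⟨hp, hpI', ‹_›⟩, ?_, ?_⟩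
    · rw [isLift_burgersReparam, hdom']
      rintro _ ⟨t, ht, rfl⟩
      obtain ⟨v1, v2, v3, v4⟩ := hval t ht
      have htJ := hsub ht
      have hTne := neT t htJ
      have hXne := neX' t htJ
      have hkpos := hk t (hJI htJ)
      have hkne : P.k ≠ 0 := fun h => by simp [h] at hkpos
      have hKpos : 0 < P.k / deriv P.T t * P.X (y₂ t) ^ 2 := by positivity
      have hpull : ∀ {f : ℝ → ℝ} {f' : ℝ}, HasDerivAt f f' t →
          HasDerivAt (fun s => f (σ s)) (f' * (deriv P.T t)⁻¹) (P.T t) := fun hf => by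
        rw [← v3] at hf
        exact hf.comp (P.T t) v4
      constructor
      · have e1 : HasDerivAt (fun t => P.y₁' t (y₁ t) (y₂ t))
            (deriv P.T t * P.h' t (θ.h t) (y₁ t) (y₂ t)) t := by
          have := (d₁ t htJ).sub ((((hasDerivAt_const t P.k).div (dT' t (hJI htJ)) hTne).mul
            ((dX t htJ).pow 2)).log (by simpa using hKpos.ne'))
          convert! this using 1
          simp only [h', Pi.mul_apply, Pi.pow_apply, Pi.div_apply]
          field_simp
          push_cast
          ring
        have := hpull e1
        rw [v1]
        convert! this using 1
        field_simp
      · have e2 := hpull (dV P.e₁ P.e₀ t htJ)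
        convert! e2 using 1
        have e3 : Real.exp (-P.y₁' t (y₁ t) (y₂ t)) =
            P.k / deriv P.T t * P.X (y₂ t) ^ 2 * Real.exp (-y₁ t) := by
          rw [y₁', neg_sub, sub_eq_add_neg, Real.exp_add, Real.exp_log hKpos]
        simp only [v3, Matrix.cons_val_zero, e3, k]
        field_simp
    · apply hadm
      · exact hΩ.inter ((hI'.preimage continuous_fst).inter
          (hR.preimage (continuous_snd.comp continuous_snd)))
      · rintro q ⟨hq, hqI, hqR⟩
        refine ⟨hqI, hqR, hU q hq _ (hJB _ (hsub hqI)), ?_⟩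
        rw [hy₁, hy₂]
        rfl
    · rintro q ⟨hq, hqI, hqR⟩
      obtain ⟨v1, v2, v3, -⟩ := hval q.1 hqI
      refine Prod.ext (Prod.ext ?_ (Prod.ext ?_ ?_)) ?_
      · exact hn'.symm
      · rw [hy₁, hy₂] at v1
        exact v1.symm
      · rw [hy₂] at v2
        exact v2.symm
      · change ![P.y₁' q.1 (Y q.1 0) (Y q.1 1), P.y₂' (Y q.1 1)] =
          ![P.y₁' (σ (P.T q.1)) (y₁ (σ (P.T q.1))) (y₂ (σ (P.T q.1))), P.y₂' (y₂ (σ (P.T q.1)))]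
        rw [v3, hy₁, hy₂]

end BurgersParams

/-! ### Generalized extended normalization for `n = 1` -/

/-- The parameters of the inducing transformation are the integration constants of the normal form.
They are read off along the given lifts `Y` and `Y'`, so that the components for the virtual
elements match as well. -/
theorem normalizedGenExt_burgers {R : Set ℝ} (hR : R = Set.Ioi 0 ∨ R = Set.univ) :
    NormalizedGenExt R (fixedClass 1) := by
  have hRo : IsOpen R := by
    rcases hR with rfl | rfl
    · exact isOpen_Ioi
    · exact isOpen_univ
  refine ⟨burgersReparam, fun θ hθ θ' hθ' Y Y' hY hY' φ Ω H p hp => ?_⟩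
  have hn : θ.n = 1 := hθ
  obtain ⟨hn', ε, T, X₁, X₀, A, B₁, B₀, N⟩ :=
    H.normal_form (hR.imp_right fun h => ⟨h, hθ, hθ'⟩) hp
  have hp0 : p.1 ∈ Metric.ball p.1 ε := Metric.mem_ball_self N.pos
  have hTA := N.of_one hn
  set I := Metric.ball p.1 ε with hI
  have hIo : IsOpen I := Metric.isOpen_ball
  have hIc : IsPreconnected I := isPreconnected_ball _ _
  have hIn : I.Nonempty := ⟨_, hp0⟩
  have hx0 : p.2.1 ∈ Metric.ball p.2.1 ε := Metric.mem_ball_self N.pos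
  have hu0 : p.2.2 ∈ Metric.ball p.2.2 ε := Metric.mem_ball_self N.pos
  have hdom : ∀ t ∈ I, t ∈ θ.dom := fun t ht => (H.source _ (N.eq t ht _ hx0 _ hu0).1).1
  have hdom' : ∀ t ∈ I, T t ∈ θ'.dom := fun t ht => by
    have h := N.eq t ht _ hx0 _ hu0
    have := (H.target _ h.1).1
    rwa [h.2] at this
  rw [isLift_burgersReparam] at hY hY'
  have sT' : ContDiffOn ℝ ∞ (deriv T) I := N.smooth_T.deriv_of_isOpen hIo (by norm_cast)
  have hd : ∀ {f : ℝ → ℝ}, ContDiffOn ℝ ∞ f I → ∀ t ∈ I, HasDerivAt f (deriv f t) t :=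
    fun hf t ht => ((hf.contDiffAt (hIo.mem_nhds ht)).differentiableAt (by simp)).hasDerivAt
  obtain ⟨y₁, hy₁⟩ : ∃ y : ℝ → ℝ, y = fun t => Y t 0 := ⟨_, rfl⟩
  obtain ⟨y₂, hy₂⟩ : ∃ y : ℝ → ℝ, y = fun t => Y t 1 := ⟨_, rfl⟩
  obtain ⟨z₁, hz₁⟩ : ∃ y : ℝ → ℝ, y = fun t => Y' (T t) 0 := ⟨_, rfl⟩
  obtain ⟨z₂, hz₂⟩ : ∃ y : ℝ → ℝ, y = fun t => Y' (T t) 1 := ⟨_, rfl⟩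
  have dy₁ : ∀ t ∈ I, HasDerivAt y₁ (θ.h t) t := fun t ht => by
    rw [hy₁]; exact (hY t (hdom t ht)).1
  have dy₂ : ∀ t ∈ I, HasDerivAt y₂ (Real.exp (-y₁ t)) t := fun t ht => by
    rw [hy₂, hy₁]; exact (hY t (hdom t ht)).2
  have dz₁ : ∀ t ∈ I, HasDerivAt z₁ (θ'.h (T t) * deriv T t) t := fun t ht => by
    rw [hz₁]; exact (hY' _ (hdom' t ht)).1.comp t (hd N.smooth_T t ht)
  have dz₂ : ∀ t ∈ I, HasDerivAt z₂ (Real.exp (-z₁ t) * deriv T t) t := fun t ht => by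
    rw [hz₂, hz₁]; exact (hY' _ (hdom' t ht)).2.comp t (hd N.smooth_T t ht)
  -- The functions `W`, `B₁`, `B₀` and `exp(-z₁)` all solve `w' = -T' h̃ w`, and `W` has no zeros.
  -- The ratios to `W` are the constants `c₁`, `c₀`, `k`.
  obtain ⟨W, hW⟩ : ∃ W : ℝ → ℝ, W = fun t => A t * X₁ t * Real.exp (-y₁ t) := ⟨_, rfl⟩
  obtain ⟨r, hr⟩ : ∃ r : ℝ → ℝ, r = fun t => -(deriv T t * θ'.h (T t)) := ⟨_, rfl⟩
  have hW0 : ∀ t ∈ I, W t ≠ 0 := fun t ht => by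
    rw [hW]
    exact mul_ne_zero (mul_ne_zero (N.A_ne t ht) (N.X₁_ne t ht)) (Real.exp_pos _).ne'
  have dW : ∀ t ∈ I, HasDerivAt W (r t * W t) t := fun t ht => by
    have := ((hd N.smooth_A t ht).mul (hd N.smooth_X₁ t ht)).mul (dy₁ t ht).neg.exp
    rw [hW]
    convert! this using 1
    have e1 := N.A_eq t ht
    have e2 := N.X₁_eq t ht
    have e3 := hTA t ht
    simp only [hr, Pi.mul_apply, Pi.neg_apply]
    rw [← e2]
    linear_combination (-X₁ t * Real.exp (-y₁ t)) * e1 - B₁ t * Real.exp (-y₁ t) * e3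
  obtain ⟨c₁, hc₁⟩ := proportional_of_linear_ode hIo hIc hIn (f := B₁) (w := W) (r := r)
    (fun t ht => by
      convert! hd N.smooth_B₁ t ht using 1
      rw [hr]; linear_combination -N.B₁_eq t ht) dW hW0
  obtain ⟨c₀, hc₀⟩ := proportional_of_linear_ode hIo hIc hIn (f := B₀) (w := W) (r := r)
    (fun t ht => by
      convert! hd N.smooth_B₀ t ht using 1
      rw [hr]; linear_combination -N.B₀_eq t ht) dW hW0
  obtain ⟨k, hk⟩ := proportional_of_linear_ode hIo hIc hIn (f := fun t => Real.exp (-z₁ t))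
    (w := W) (r := r)
    (fun t ht => by
      convert! (dz₁ t ht).neg.exp using 1
      simp only [hr, Pi.neg_apply]; ring) dW hW0
  -- Multiplication by `T'` turns these proportionalities into `X₁' = c₁ X₁² y₂'`, `X₀' = c₀ X₁²
  -- y₂'` and `z₂' = k X₁² y₂'`.
  have hTW : ∀ t ∈ I, deriv T t * W t = X₁ t ^ 2 * Real.exp (-y₁ t) := fun t ht => by
    rw [hW]
    linear_combination X₁ t * Real.exp (-y₁ t) * hTA t ht
  have dX₁ : ∀ t ∈ I, HasDerivAt X₁ (c₁ * X₁ t ^ 2 * Real.exp (-y₁ t)) t := fun t ht => by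
    convert! hd N.smooth_X₁ t ht using 1
    rw [← N.X₁_eq t ht, hc₁ t ht]
    linear_combination -c₁ * hTW t ht
  have dX₀ : ∀ t ∈ I, HasDerivAt X₀ (c₀ * X₁ t ^ 2 * Real.exp (-y₁ t)) t := fun t ht => by
    convert! hd N.smooth_X₀ t ht using 1
    rw [← N.X₀_eq t ht, hc₀ t ht]
    linear_combination -c₀ * hTW t ht
  have dz₂' : ∀ t ∈ I, HasDerivAt z₂ (k * X₁ t ^ 2 * Real.exp (-y₁ t)) t := fun t ht => by
    convert! dz₂ t ht using 1
    rw [hk t ht]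
    linear_combination -k * hTW t ht
  obtain ⟨c₂, hc₂⟩ := reciprocal_of_ode hIo hIc hIn N.X₁_ne dy₂ dX₁
  obtain ⟨d₁, d₀, hd₀⟩ := linear_fractional_of_ode hIo hIc hIn N.X₁_ne dy₂ dX₁ dX₀
  obtain ⟨e₁, e₀, he₀⟩ := linear_fractional_of_ode hIo hIc hIn N.X₁_ne dy₂ dX₁ dz₂'
  obtain ⟨P, hP⟩ : ∃ P : BurgersParams, P = ⟨T, c₁, c₂, d₁, d₀, e₁, e₀⟩ := ⟨_, rfl⟩
  have hPX : ∀ t ∈ I, P.X (y₂ t) = X₁ t := fun t ht => by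
    rw [hP, BurgersParams.X, ← hc₂ t ht, inv_inv]
  -- The determinants built into `P` agree with the proportionality constants `c₀` and `k`;
  -- evaluation at `p.1` suffices.
  have hconst : ∀ {c d e v : ℝ}, v = X₁ p.1 * (d * y₂ p.1 + e) → c * X₁ p.1 = d + c₁ * v →
      d * c₂ + c₁ * e = c := fun {c d e v} h1 h2 => by
    have h3 := hc₂ _ hp0
    have h4 := N.X₁_ne _ hp0
    have h5 : c₂ = (X₁ p.1)⁻¹ + c₁ * y₂ p.1 := by linear_combination -h3
    rw [h5]
    rw [h1] at h2
    field_simp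
    linear_combination -h2
  have hPc₀ : P.c₀ = c₀ := by
    rw [hP]; exact hconst (hd₀ _ hp0).1 (hd₀ _ hp0).2
  have hPk : P.k = k := by
    rw [hP]; exact hconst (he₀ _ hp0).1 (he₀ _ hp0).2
  have hPT : P.T = T := by rw [hP]
  have hA : ∀ t ∈ I, A t = X₁ t / deriv T t := fun t ht => by
    rw [eq_div_iff (N.T_ne t ht), ← hTA t ht]; ring
  have hPW : ∀ t ∈ I, P.W t (y₁ t) (y₂ t) = W t := fun t ht => by
    rw [BurgersParams.W, hPX t ht, hPT, div_eq_iff (N.T_ne t ht), ← hTW t ht]; ring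
  have hkK : ∀ t ∈ I, k / deriv T t * X₁ t ^ 2 * Real.exp (-y₁ t) = Real.exp (-z₁ t) := by
    intro t ht
    have := N.T_ne t ht
    rw [hk t ht]
    field_simp
    linear_combination -k * hTW t ht
  have hkpos : ∀ t ∈ I, 0 < P.k / deriv P.T t := fun t ht => by
    have h1 := Real.exp_pos (-z₁ t)
    rw [← hkK t ht, mul_assoc] at h1
    rw [hPk, hPT]
    exact pos_of_mul_pos_left h1 (by positivity)
  have hPne : ∀ t ∈ I, P.c₂ - P.c₁ * y₂ t ≠ 0 := fun t ht => by
    rw [hP]; dsimp only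
    rw [← hc₂ t ht]
    exact inv_ne_zero (N.X₁_ne t ht)
  have hφU : ∀ t ∈ I, ∀ x ∈ Metric.ball p.2.1 ε, ∀ u ∈ Metric.ball p.2.2 ε,
      P.U (t, x, u) (Y t) = (φ (t, x, u)).2.2 := fun t ht x hx u hu => by
    rw [(N.eq t ht x hx u hu).2, hA t ht, hc₁ t ht, hc₀ t ht]
    have e1 := hPX t ht
    have e2 := hPW t ht
    rw [hy₂] at e1
    rw [hy₁, hy₂] at e2
    simp only [BurgersParams.U]
    rw [e1, e2, hPT, hPc₀, hP]
  have hy₂p : Y p.1 1 = y₂ p.1 := by rw [hy₂]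
  have hcU : ContinuousAt (fun w : Pt × (Fin 2 → ℝ) => P.U w.1 w.2) (p, Y p.1) := by
    have hZ : IsOpen {z : Pt × (ℝ × ℝ × ℝ) × (Fin 2 → ℝ) | z.1.1 ∈ I ∧
        P.c₂ - P.c₁ * z.2.2 1 ≠ 0} :=
      (hIo.preimage (by fun_prop)).inter (isOpen_compl_singleton.preimage (by fun_prop))
    have h1 := ((BurgersParams.contDiffOn_equivalence hIo (by rw [hPT]; exact N.smooth_T)
      hkpos).fst.snd.snd.contDiffAt (x := (p, (0, 0, 0), Y p.1))
      (hZ.mem_nhds ⟨hp0, by dsimp only; rw [hy₂p]; exact hPne _ hp0⟩)).continuousAt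
    have h2 : Continuous (fun w : Pt × (Fin 2 → ℝ) =>
        ((w.1, ((0 : ℝ), (0 : ℝ), (0 : ℝ)), w.2) : Pt × (ℝ × ℝ × ℝ) × (Fin 2 → ℝ))) := by fun_prop
    exact ContinuousAt.comp (x := (p, Y p.1)) (f := fun w : Pt × (Fin 2 → ℝ) =>
      (w.1, ((0 : ℝ), (0 : ℝ), (0 : ℝ)), w.2)) h1 h2.continuousAt
  have hUp : P.U p (Y p.1) ∈ R := by
    have h1 := hφU p.1 hp0 p.2.1 hx0 p.2.2 hu0
    have h2 : P.U p (Y p.1) = (φ p).2.2 := h1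
    rw [h2]
    exact (H.target p hp).2
  -- By continuity `U` stays in the open set `R` on a product neighbourhood of `(p, Y p.1)`, for all
  -- values of the virtual elements in `B`.
  obtain ⟨Ω₁, B, hΩ₁, hpΩ₁, hB, hYB, hsub⟩ := mem_nhds_prod_iff'.1 (hcU (hRo.mem_nhds hUp))
  have hΩ'o : IsOpen (Ω₁ ∩ {q : Pt | q.1 ∈ I}) := hΩ₁.inter (hIo.preimage continuous_fst)
  have hB'o : IsOpen (B ∩ {y : Fin 2 → ℝ | P.c₂ - P.c₁ * y 1 ≠ 0}) :=
    hB.inter (isOpen_compl_singleton.preimage (by fun_prop))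
  refine ⟨Ω₁ ∩ {q : Pt | q.1 ∈ I}, B ∩ {y : Fin 2 → ℝ | P.c₂ - P.c₁ * y 1 ≠ 0}, P.equivalence,
    BurgersParams.isEquivalence_equivalence hIo (by rw [hPT]; exact N.smooth_T) hkpos hΩ'o hB'o
      (fun q hq => hq.2) (fun y hy => hy.2) (fun q hq y hy => hsub (show (q, y) ∈ Ω₁ ×ˢ B from ⟨hq.1, hy.1⟩)) hRo,
    ⟨hpΩ₁, hp0⟩, ⟨hYB, ?_⟩, ?_⟩
  · change P.c₂ - P.c₁ * Y p.1 1 ≠ 0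
    rw [hy₂p]; exact hPne _ hp0
  have hbox := box_mem_nhds (t := p.1) (x := p.2.1) (u := p.2.2) hp0 hx0 hu0
  filter_upwards [hbox] with q hq
  obtain ⟨ht, hx, hu⟩ := hq
  have hφ : φ q = _ := (N.eq _ ht _ hx _ hu).2
  have hTne := N.T_ne _ ht
  have hXne := N.X₁_ne _ ht
  have eX := hPX _ ht
  rw [hy₂] at eX
  have eY1 : Y q.1 0 = y₁ q.1 := by rw [hy₁]
  have eY2 : Y q.1 1 = y₂ q.1 := by rw [hy₂]
  have hφ1 : (φ q).1 = T q.1 := by rw [hφ]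
  have hφ2 : (φ q).2.1 = X₁ q.1 * q.2.1 + X₀ q.1 := by rw [hφ]
  refine Prod.ext (Prod.ext ?_ (Prod.ext ?_ ?_)) (Prod.ext (Prod.ext ?_ (Prod.ext ?_ ?_)) ?_)
  · change P.T q.1 = (φ q).1
    rw [hφ1, hPT]
  · change P.X (Y q.1 1) * q.2.1 + P.X (Y q.1 1) * (P.d₁ * Y q.1 1 + P.d₀) = (φ q).2.1
    rw [hφ2, eX, (hd₀ _ ht).1, eY2, hP]
  · exact hφU _ ht _ hx _ hu
  · exact hn'.symm
  · change P.h' q.1 (θ.h q.1) (Y q.1 0) (Y q.1 1) = θ'.h (φ q).1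
    have hPc₁ : P.c₁ = c₁ := by rw [hP]
    have hAd : deriv A q.1 = B₁ q.1 - A q.1 * (deriv (deriv T) q.1 / deriv T q.1) := by
      have h1 : A =ᶠ[𝓝 q.1] fun t => X₁ t / deriv T t := by
        filter_upwards [hIo.mem_nhds ht] with s hs using hA s hs
      have h2 : deriv (fun t => X₁ t / deriv T t) q.1 = _ :=
        ((hd N.smooth_X₁ _ ht).div (hd sT' _ ht) hTne).deriv
      rw [h1.deriv_eq, h2, ← N.X₁_eq _ ht, hA _ ht]
      field_simp
    have hA0 := N.A_ne _ ht
    have h2 := N.A_eq _ ht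
    have h3 : B₁ q.1 = c₁ * (A q.1 * X₁ q.1 * Real.exp (-y₁ q.1)) := by
      rw [hc₁ _ ht, hW]
    rw [hAd, h3] at h2
    rw [BurgersParams.h', eX, eY1, hPT, hPc₁, hφ1, div_eq_iff hTne]
    apply mul_left_cancel₀ hA0
    linear_combination -h2
  · change θ.g q.1 * P.X (Y q.1 1) ^ 2 / deriv P.T q.1 = θ'.g (φ q).1
    rw [eX, hPT, hφ1, div_eq_iff hTne]
    exact N.g_eq _ ht
  · change ![P.y₁' q.1 (Y q.1 0) (Y q.1 1), P.y₂' (Y q.1 1)] = Y' (φ q).1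
    ext i
    fin_cases i
    · change P.y₁' q.1 (Y q.1 0) (Y q.1 1) = Y' (φ q).1 0
      have h1 : Y' (φ q).1 0 = z₁ q.1 := by rw [hφ1, hz₁]
      have h2 := congrArg Real.log (hkK _ ht)
      rw [Real.log_exp, Real.log_mul _ (Real.exp_pos _).ne', Real.log_exp] at h2
      · rw [BurgersParams.y₁', h1, eX, hPk, hPT, eY1]
        linear_combination -h2
      · intro h0
        have h3 := hkK _ ht
        rw [h0, zero_mul] at h3
        exact (Real.exp_pos _).ne h3
    · change P.y₂' (Y q.1 1) = Y' (φ q).1 1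
      have h1 : Y' (φ q).1 1 = z₂ q.1 := by rw [hφ1, hz₂]
      rw [BurgersParams.y₂', h1, eX, (he₀ _ ht).1, eY2, hP]

/-! ### Test equations and the Galilean boost -/

/-- The equation with constant `g` and with `h` affine in `t`, near `t₀`. -/
noncomputable def affineCoeffs {n g : ℝ} (hn : n ≠ 0) (hg : g ≠ 0) (h s t₀ ε : ℝ) : Coeffs where
  n := n
  h := fun t => h + s * (t - t₀)
  g := fun _ => g
  dom := Metric.ball t₀ ε
  isOpen_dom := Metric.isOpen_ball
  n_ne := hn
  smooth_h := by fun_prop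
  smooth_g := contDiffOn_const
  g_ne := fun _ _ => hg

/-- Local existence of values of the virtual arbitrary elements. -/
theorem exists_isLift (A : Reparam) {n g : ℝ} (hn : n ≠ 0) (hg : g ≠ 0) (h t₀ : ℝ)
    (y₀ : Fin A.k → ℝ) : ∃ ε > 0, ∃ Y : ℝ → Fin A.k → ℝ, Y t₀ = y₀ ∧
      A.IsLift (affineCoeffs hn hg h 0 t₀ ε) Y := by
  have hopen : IsOpen {z : ℝ × (ℝ × ℝ × ℝ) × (Fin A.k → ℝ) | z.2.1 ∈ valueSpace} :=
    isOpen_valueSpace.preimage (by fun_prop)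
  -- The time is added as an unknown with derivative `1`, so that the existence theorem for
  -- autonomous equations applies; `hα1` recovers the time.
  have hF : ContDiffAt ℝ 1 (fun z : ℝ × (Fin A.k → ℝ) => ((1 : ℝ), A.F (z.1, (n, h, g), z.2)))
      (t₀, y₀) := by
    refine contDiffAt_const.prodMk ?_
    have h1 : ContDiffAt ℝ 1 A.F (t₀, (n, h, g), y₀) :=
      (A.smooth.contDiffAt (hopen.mem_nhds ⟨hn, hg⟩)).of_le (by norm_cast)
    exact ContDiffAt.comp (t₀, y₀)
      (f := fun z : ℝ × (Fin A.k → ℝ) => (z.1, ((n, h, g) : ℝ × ℝ × ℝ), z.2)) h1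
      (by fun_prop)
  obtain ⟨α, hα, ε, hε, hd⟩ :=
    hF.exists_forall_mem_closedBall_exists_eq_forall_mem_Ioo_hasDerivAt₀ t₀
  rw [← Real.ball_eq_Ioo] at hd
  have hα1 : ∀ t ∈ Metric.ball t₀ ε, (α t).1 = t := by
    intro t ht
    have := eq_of_hasDerivAt_zero Metric.isOpen_ball (isPreconnected_ball t₀ ε)
      (f := fun s => (α s).1 - s) (fun s hs => by
        simpa using! (hasDerivAt_fst_comp (hd s hs)).sub (hasDerivAt_id s)) ht
      (Metric.mem_ball_self hε)
    rw [hα] at this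
    linarith
  refine ⟨ε, hε, fun t => (α t).2, by simp only [hα], fun t ht => ?_⟩
  have h1 := hasDerivAt_snd_comp (hd t ht)
  rw [hα1 t ht] at h1
  convert! h1 using 4
  simp [Coeffs.val, affineCoeffs]

/-- The Galilean boost. -/
def boost (p : Pt) : Pt := (p.1, p.2.1 + p.1, p.2.2 + 1)

theorem isAdmissible_boost {R : Set ℝ} (hR : R = Set.Ioi 0 ∨ R = Set.univ) (ε : ℝ) :
    IsAdmissible R (affineCoeffs one_ne_zero one_ne_zero 0 0 0 ε)
      (affineCoeffs one_ne_zero one_ne_zero 0 0 0 ε) boost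
      {q | q.1 ∈ Metric.ball 0 ε ∧ q.2.2 ∈ R} := by
  have hRo : IsOpen R := by
    rcases hR with rfl | rfl
    · exact isOpen_Ioi
    · exact isOpen_univ
  have hadd : ∀ u ∈ R, u + 1 ∈ R := by
    rcases hR with rfl | rfl
    · intro u (hu : 0 < u)
      exact add_pos hu one_pos
    · exact fun _ _ => trivial
  have hs : ContDiff ℝ ∞ boost := by unfold boost; fun_prop
  refine ⟨(Metric.isOpen_ball.preimage continuous_fst).inter
    (hRo.preimage (continuous_snd.comp continuous_snd)), fun p hp => hp,
    fun p hp => ⟨hp.1, hadd _ hp.2⟩, hs.contDiffOn, fun p hp => ?_, ?_⟩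
  · refine bijective_fderiv_of_affine (T := fun t => t) (X₁ := fun _ => 1) (X₀ := fun t => t)
      (A := fun _ => 1) (B₁ := fun _ => 0) (B₀ := fun _ => 1)
      (hs.differentiable (by simp) p) (Filter.Eventually.of_forall fun q => by simp [boost])
      differentiableAt_id (by simp) one_ne_zero one_ne_zero
  · rintro ⟨t, x, u⟩ hp
    refine mapsEquation_of_affine (T := fun t => t) (X₁ := fun _ => 1) (X₀ := fun t => t)
      (A := fun _ _ => 1) (B := fun _ _ => 1)
      (Filter.Eventually.of_forall fun q => by simp [boost])
      contDiffAt_const contDiffAt_const differentiableAt_id (differentiableAt_const _)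
      differentiableAt_id (by simp [affineCoeffs]) one_ne_zero (by simp) one_ne_zero ?_ ?_
    · simp [affineCoeffs]
    · simp [affineCoeffs]

/-- A transformation with the components of the boost for `t` and `x` is admissible only for
vanishing `h`. -/
theorem IsAdmissible.h_eq_zero {R : Set ℝ} {θ θ' : Coeffs} {φ : Pt → Pt} {Ω : Set Pt} {p : Pt}
    (hR : R = Set.Ioi 0 ∨ (R = Set.univ ∧ θ.n = 1 ∧ θ'.n = 1)) (hn : θ.n = 1)
    (H : IsAdmissible R θ θ' φ Ω) (hp : p ∈ Ω)
    (hφ : ∀ᶠ q in 𝓝 p, (φ q).1 = q.1 ∧ (φ q).2.1 = q.2.1 + q.1) : θ.h p.1 = 0 := by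
  obtain ⟨-, ε, T, X₁, X₀, A, B₁, B₀, N⟩ := H.normal_form hR hp
  have hp0 : p.1 ∈ Metric.ball p.1 ε := Metric.mem_ball_self N.pos
  have hx0 : p.2.1 ∈ Metric.ball p.2.1 ε := Metric.mem_ball_self N.pos
  have hu0 : p.2.2 ∈ Metric.ball p.2.2 ε := Metric.mem_ball_self N.pos
  have h1 := hφ.and (box_mem_nhds (t := p.1) (x := p.2.1) (u := p.2.2) hp0 hx0 hu0)
  have h2 : ∀ᶠ t in 𝓝 p.1, ∀ᶠ x in 𝓝 p.2.1, T t = t ∧ X₁ t * x + X₀ t = x + t := by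
    have h3 : ∀ᶠ w : ℝ × ℝ in 𝓝 (p.1, p.2.1), T w.1 = w.1 ∧
        X₁ w.1 * w.2 + X₀ w.1 = w.2 + w.1 := by
      filter_upwards [(Continuous.tendsto' (f := fun w : ℝ × ℝ => ((w.1, w.2, p.2.2) : Pt))
        (by fun_prop) (p.1, p.2.1) p rfl).eventually h1] with w hw
      have e := (N.eq _ hw.2.1 _ hw.2.2.1 _ hw.2.2.2).2
      have e1 := hw.1
      rw [e] at e1
      exact e1
    -- Currying gives, for each `t` near `p.1`, an identity on a neighbourhood in `x`, to which
    -- `affine_identity` applies.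
    rw [nhds_prod_eq] at h3
    exact h3.curry
  have h4 : ∀ᶠ t in 𝓝 p.1, T t = t ∧ X₁ t = 1 ∧ X₀ t = t := by
    filter_upwards [h2] with t ht
    have h5 := affine_identity (u₀ := p.2.1) (a := X₁ t - 1) (b := X₀ t - t) (by
      filter_upwards [ht] with x hx
      linear_combination hx.2)
    exact ⟨ht.self_of_nhds.1, by linarith [h5.1], by linarith [h5.2]⟩
  have h6 : ∀ᶠ t in 𝓝 p.1, A t = 1 ∧ B₁ t = 0 ∧ B₀ t = 1 ∧ deriv T t = 1 := by
    filter_upwards [h4.eventually_nhds, Metric.isOpen_ball.mem_nhds hp0] with t ht hI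
    have eT : T =ᶠ[𝓝 t] fun t => t := ht.mono fun s hs => hs.1
    have eX₁ : X₁ =ᶠ[𝓝 t] fun _ => 1 := ht.mono fun s hs => hs.2.1
    have eX₀ : X₀ =ᶠ[𝓝 t] fun t => t := ht.mono fun s hs => hs.2.2
    have dT : deriv T t = 1 := by rw [eT.deriv_eq]; simp
    have k1 := N.of_one hn t hI
    have k2 := N.X₁_eq t hI
    have k3 := N.X₀_eq t hI
    rw [dT, one_mul] at k1 k2 k3
    rw [k1, k2, k3, eX₁.deriv_eq, eX₀.deriv_eq]
    refine ⟨eX₁.self_of_nhds, by simp, by simp, dT⟩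
  -- With `A = 1`, `B₁ = 0`, `B₀ = 1` and `T' = 1`, the equation for `A` reads `h̃ = h`, and the one
  -- for `B₀` reads `h̃ = 0`.
  obtain ⟨a1, a2, a3, a4⟩ := h6.self_of_nhds
  have dA : deriv A p.1 = 0 := by
    rw [Filter.EventuallyEq.deriv_eq (f := fun _ => 1) (h6.mono fun s hs => hs.1)]; simp
  have dB₀ : deriv B₀ p.1 = 0 := by
    rw [Filter.EventuallyEq.deriv_eq (f := fun _ => 1) (h6.mono fun s hs => hs.2.2.1)]; simp
  have k1 := N.A_eq _ hp0
  have k2 := N.B₀_eq _ hp0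
  rw [dA, a1, a2] at k1
  rw [dB₀, a3] at k2
  linarith

/-- The relations between the derivatives of first order of an admissible transformation. -/
theorem IsAdmissible.first_order {R : Set ℝ} {θ θ' : Coeffs} {φ : Pt → Pt} {Ω : Set Pt}
    {t x u : ℝ} (hR : R = Set.Ioi 0 ∨ (R = Set.univ ∧ θ.n = 1 ∧ θ'.n = 1))
    (H : IsAdmissible R θ θ' φ Ω) (hp : (t, x, u) ∈ Ω) :
    (θ.n ≠ 1 → (φ (t, x, u)).2.2 = u * (fderiv ℝ φ (t, x, u) (0, 0, 1)).2.2) ∧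
    (θ.n = 1 → (fderiv ℝ φ (t, x, u) (0, 0, 1)).2.2 ≠ 0 ∧
      (fderiv ℝ φ (t, x, u) (0, 0, 1)).2.2 * (fderiv ℝ φ (t, x, u) (1, 0, 0)).1 =
        (fderiv ℝ φ (t, x, u) (0, 1, 0)).2.1 ∧
      ((φ (t, x, u)).2.2 - u * (fderiv ℝ φ (t, x, u) (0, 0, 1)).2.2) *
        (fderiv ℝ φ (t, x, u) (1, 0, 0)).1 = (fderiv ℝ φ (t, x, u) (1, 0, 0)).2.1) := by
  obtain ⟨-, ε, T, X₁, X₀, A, B₁, B₀, N⟩ := H.normal_form hR hp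
  have ht : t ∈ Metric.ball t ε := Metric.mem_ball_self N.pos
  have hx : x ∈ Metric.ball x ε := Metric.mem_ball_self N.pos
  have hu : u ∈ Metric.ball u ε := Metric.mem_ball_self N.pos
  have hd := (H.contDiffAt hp).differentiableAt (by simp)
  have hval := (N.eq t ht x hx u hu).2
  have e1 : (fderiv ℝ φ (t, x, u) (0, 0, 1)).2.2 = A t := by
    have h1 := hasDerivAt_snd_comp (hasDerivAt_snd_comp (hasDerivAt_slice_trd hd))
    have h2 : HasDerivAt (fun s => A t * s + (B₁ t * x + B₀ t)) (A t) u := by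
      simpa using ((hasDerivAt_id u).const_mul (A t)).add_const (B₁ t * x + B₀ t)
    refine h1.unique (h2.congr_of_eventuallyEq ?_)
    filter_upwards [ball_mem_nhds hu] with s hs
    rw [(N.eq t ht x hx s hs).2]
  have e2 : (fderiv ℝ φ (t, x, u) (0, 1, 0)).2.1 = X₁ t := by
    have h1 := hasDerivAt_fst_comp (hasDerivAt_snd_comp (hasDerivAt_slice_snd hd))
    have h2 : HasDerivAt (fun s => X₁ t * s + X₀ t) (X₁ t) x := by
      simpa using ((hasDerivAt_id x).const_mul (X₁ t)).add_const (X₀ t)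
    refine h1.unique (h2.congr_of_eventuallyEq ?_)
    filter_upwards [ball_mem_nhds hx] with s hs
    rw [(N.eq t ht s hs u hu).2]
  have hdd : ∀ {f : ℝ → ℝ}, ContDiffOn ℝ ∞ f (Metric.ball t ε) → HasDerivAt f (deriv f t) t :=
    fun hf => ((hf.contDiffAt (ball_mem_nhds ht)).differentiableAt (by simp)).hasDerivAt
  have e3 : (fderiv ℝ φ (t, x, u) (1, 0, 0)).1 = deriv T t := by
    have h1 := hasDerivAt_fst_comp (hasDerivAt_slice_fst hd)
    refine h1.unique ((hdd N.smooth_T).congr_of_eventuallyEq ?_)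
    filter_upwards [ball_mem_nhds ht] with s hs
    rw [(N.eq s hs x hx u hu).2]
  have e4 : (fderiv ℝ φ (t, x, u) (1, 0, 0)).2.1 = deriv X₁ t * x + deriv X₀ t := by
    have h1 := hasDerivAt_fst_comp (hasDerivAt_snd_comp (hasDerivAt_slice_fst hd))
    have h2 := ((hdd N.smooth_X₁).mul_const x).add (hdd N.smooth_X₀)
    refine h1.unique (h2.congr_of_eventuallyEq ?_)
    filter_upwards [ball_mem_nhds ht] with s hs
    rw [(N.eq s hs x hx u hu).2]
    rfl
  rw [hval, e1, e2, e3, e4]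
  constructor
  · intro hn
    obtain ⟨b1, b0, -⟩ := N.of_ne_one hn t ht
    dsimp only
    rw [b1, b0]; ring
  · intro hn
    refine ⟨N.A_ne t ht, ?_, ?_⟩
    · rw [← N.of_one hn t ht]; ring
    · rw [← N.X₁_eq t ht, ← N.X₀_eq t ht]; ring

/-- The derivatives of a transformation obtained by the substitution of functions of `t`. -/
theorem fderiv_substitution {V : Type*} [NormedAddCommGroup V] [NormedSpace ℝ V]
    {Ψ : Pt × V → Pt × V} {w : ℝ → V} {t x u : ℝ}
    (hΨ : DifferentiableAt ℝ Ψ ((t, x, u), w t))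
    (hφ : DifferentiableAt ℝ (fun q : Pt => (Ψ (q, w q.1)).1) (t, x, u)) :
    fderiv ℝ (fun q : Pt => (Ψ (q, w q.1)).1) (t, x, u) (0, 0, 1) =
      (fderiv ℝ Ψ ((t, x, u), w t) ((0, 0, 1), 0)).1 ∧
    fderiv ℝ (fun q : Pt => (Ψ (q, w q.1)).1) (t, x, u) (0, 1, 0) =
      (fderiv ℝ Ψ ((t, x, u), w t) ((0, 1, 0), 0)).1 ∧
    ∀ w', HasDerivAt w w' t → fderiv ℝ (fun q : Pt => (Ψ (q, w q.1)).1) (t, x, u) (1, 0, 0) =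
      (fderiv ℝ Ψ ((t, x, u), w t) ((1, 0, 0), w')).1 := by
  refine ⟨?_, ?_, fun w' hw => ?_⟩
  · have h1 : HasDerivAt (fun s : ℝ => (((t, x, s), w t) : Pt × V)) ((0, 0, 1), 0) u :=
      ((hasDerivAt_const _ _).prodMk ((hasDerivAt_const _ _).prodMk (hasDerivAt_id _))).prodMk
        (hasDerivAt_const _ _)
    exact (hasDerivAt_slice_trd hφ).unique (hasDerivAt_fst_comp
      (HasFDerivAt.comp_hasDerivAt (l := Ψ) u hΨ.hasFDerivAt h1))
  · have h1 : HasDerivAt (fun s : ℝ => (((t, s, u), w t) : Pt × V)) ((0, 1, 0), 0) x :=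
      ((hasDerivAt_const _ _).prodMk ((hasDerivAt_id _).prodMk (hasDerivAt_const _ _))).prodMk
        (hasDerivAt_const _ _)
    exact (hasDerivAt_slice_snd hφ).unique (hasDerivAt_fst_comp
      (HasFDerivAt.comp_hasDerivAt (l := Ψ) x hΨ.hasFDerivAt h1))
  · have h1 : HasDerivAt (fun s : ℝ => (((s, x, u), w s) : Pt × V)) ((1, 0, 0), w') t :=
      ((hasDerivAt_id _).prodMk (hasDerivAt_const _ _)).prodMk hw
    exact (hasDerivAt_slice_fst hφ).unique (hasDerivAt_fst_comp
      (HasFDerivAt.comp_hasDerivAt (l := Ψ) t hΨ.hasFDerivAt h1))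

/-! ### Obstructions to normalization -/

section Obstructions

variable {R : Set ℝ} {S : Set Coeffs} {A : Reparam} {Ω : Set Pt} {B : Set (Fin A.k → ℝ)}
  {Ψ : A.Space → A.Space}

theorem IsEquivalence.contDiffAt (E : IsEquivalence R S A Ω B Ψ) {z : A.Space}
    (hz : z ∈ Ω ×ˢ valueSpace ×ˢ B) : ContDiffAt ℝ ∞ Ψ z :=
  E.smooth.contDiffAt ((E.isOpen.prod (isOpen_valueSpace.prod E.isOpen_lift)).mem_nhds hz)

theorem mem_valueSpace {n g : ℝ} (hn : n ≠ 0) (hg : g ≠ 0) (h : ℝ) :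
    ((n, h, g) : ℝ × ℝ × ℝ) ∈ valueSpace := ⟨hn, hg⟩

theorem hasDerivAt_val_affineCoeffs {n g : ℝ} (hn : n ≠ 0) (hg : g ≠ 0) (h s t₀ ε : ℝ) :
    HasDerivAt (affineCoeffs hn hg h s t₀ ε).val (0, s, 0) t₀ := by
  refine (hasDerivAt_const _ _).prodMk (HasDerivAt.prodMk ?_ (hasDerivAt_const _ _))
  have k := (((hasDerivAt_id t₀).sub_const t₀).const_mul s).const_add h
  rwa [mul_one] at k

theorem val_affineCoeffs {n g : ℝ} (hn : n ≠ 0) (hg : g ≠ 0) (h s t₀ ε : ℝ) :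
    (affineCoeffs hn hg h s t₀ ε).val t₀ = (n, h, g) := by
  simp [Coeffs.val, affineCoeffs]

/-- The relations between the derivatives of first order of an equivalence transformation. -/
theorem IsEquivalence.first_order (E : IsEquivalence R S A Ω B Ψ) {n g h s t x u ε : ℝ}
    {hn : n ≠ 0} {hg : g ≠ 0} {Y : ℝ → Fin A.k → ℝ} {y' : Fin A.k → ℝ}
    (hR : R = Set.Ioi 0 ∨ (R = Set.univ ∧ S = fixedClass 1)) (hε : 0 < ε)
    (hθ : affineCoeffs hn hg h s t ε ∈ S) (hY : A.IsLift (affineCoeffs hn hg h s t ε) Y)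
    (hy : Y t ∈ B) (hy' : HasDerivAt Y y' t) (hp : (t, x, u) ∈ Ω) (hu : u ∈ R) :
    (n ≠ 1 → (Ψ ((t, x, u), (n, h, g), Y t)).1.2.2 =
        u * (fderiv ℝ Ψ ((t, x, u), (n, h, g), Y t) ((0, 0, 1), 0)).1.2.2) ∧
    (n = 1 → (fderiv ℝ Ψ ((t, x, u), (n, h, g), Y t) ((0, 0, 1), 0)).1.2.2 ≠ 0 ∧
      (fderiv ℝ Ψ ((t, x, u), (n, h, g), Y t) ((0, 0, 1), 0)).1.2.2 *
        (fderiv ℝ Ψ ((t, x, u), (n, h, g), Y t) ((1, 0, 0), (0, s, 0), y')).1.1 =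
        (fderiv ℝ Ψ ((t, x, u), (n, h, g), Y t) ((0, 1, 0), 0)).1.2.1 ∧
      ((Ψ ((t, x, u), (n, h, g), Y t)).1.2.2 -
        u * (fderiv ℝ Ψ ((t, x, u), (n, h, g), Y t) ((0, 0, 1), 0)).1.2.2) *
        (fderiv ℝ Ψ ((t, x, u), (n, h, g), Y t) ((1, 0, 0), (0, s, 0), y')).1.1 =
        (fderiv ℝ Ψ ((t, x, u), (n, h, g), Y t) ((1, 0, 0), (0, s, 0), y')).1.2.1) := by
  set θ := affineCoeffs hn hg h s t ε with hθdef
  obtain ⟨θ', hθ', -, -, Ω', -, hp', H, -⟩ :=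
    E.maps θ hθ Y hY _ hp (Metric.mem_ball_self hε) hu hy
  have hR' : R = Set.Ioi 0 ∨ (R = Set.univ ∧ θ.n = 1 ∧ θ'.n = 1) := by
    rcases hR with h | ⟨h, rfl⟩
    · exact Or.inl h
    · exact Or.inr ⟨h, hθ, hθ'⟩
  have k := H.first_order hR' hp'
  have hval : θ.val t = (n, h, g) := val_affineCoeffs hn hg h s t ε
  have hΨ : DifferentiableAt ℝ Ψ ((t, x, u), θ.val t, Y t) := by
    rw [hval]
    exact (E.contDiffAt ⟨hp, mem_valueSpace hn hg h, hy⟩).differentiableAt (by simp)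
  obtain ⟨d1, d2, d3⟩ := fderiv_substitution (w := fun r => (θ.val r, Y r)) hΨ
    ((H.contDiffAt hp').differentiableAt (by simp))
  have d4 := d3 _ ((hasDerivAt_val_affineCoeffs hn hg h s t ε).prodMk hy')
  rw [d1, d2, d4] at k
  dsimp only at k
  rw [hval] at k
  exact k

/-- The boost is not induced by an equivalence transformation of the class with varying `n`. -/
theorem not_normalizedGenVia_fullClass (A : Reparam) :
    ¬NormalizedGenVia (Set.Ioi 0) fullClass A := by
  intro H
  obtain ⟨ε, hε, Y, -, hY⟩ := exists_isLift A one_ne_zero one_ne_zero 0 0 0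
  obtain ⟨Ω, B, Ψ, E, hp, hB, hI⟩ := H _ trivial _ trivial Y Y hY hY boost _
    (isAdmissible_boost (Or.inl rfl) ε) (0, 0, 1) ⟨Metric.mem_ball_self hε, Set.mem_Ioi.2 one_pos⟩
  have hz : ∀ n : ℝ, n ≠ 0 → (((0, 0, 1), (n, 0, 1), Y 0) : A.Space) ∈ Ω ×ˢ valueSpace ×ˢ B :=
    fun n hn => ⟨hp, mem_valueSpace hn one_ne_zero 0, hB⟩
  have key : ∀ n : ℝ, n ≠ 0 → n ≠ 1 → (Ψ ((0, 0, 1), (n, 0, 1), Y 0)).1.2.2 =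
      (fderiv ℝ Ψ ((0, 0, 1), (n, 0, 1), Y 0) ((0, 0, 1), 0)).1.2.2 := by
    intro n hn hn1
    -- The lift over the equation with exponent `n` starts at the same value `Y 0`, so `Ψ` is
    -- evaluated at points that differ only in `n`.
    obtain ⟨δ, hδ, Z, hZ, hZl⟩ := exists_isLift A hn one_ne_zero 0 0 (Y 0)
    have k := (E.first_order (Or.inl rfl) hδ trivial hZl (hZ ▸ hB)
      (hZl 0 (Metric.mem_ball_self hδ)) hp (Set.mem_Ioi.2 one_pos)).1 hn1
    rw [hZ, one_mul] at k
    exact k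
  have hc : ContinuousAt (fun n : ℝ => (((0, 0, 1), (n, 0, 1), Y 0) : A.Space)) 1 := by
    fun_prop
  have c1 : ContinuousAt (fun n : ℝ => (Ψ ((0, 0, 1), (n, 0, 1), Y 0)).1.2.2) 1 :=
    (ContinuousAt.comp (f := fun n : ℝ => (((0, 0, 1), (n, 0, 1), Y 0) : A.Space))
      (E.contDiffAt (hz 1 one_ne_zero)).continuousAt hc).fst.snd.snd
  have c2 : ContinuousAt (fun n : ℝ =>
      (fderiv ℝ Ψ ((0, 0, 1), (n, 0, 1), Y 0) ((0, 0, 1), 0)).1.2.2) 1 :=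
    ((ContinuousAt.comp (g := fderiv ℝ Ψ)
      (f := fun n : ℝ => (((0, 0, 1), (n, 0, 1), Y 0) : A.Space))
      (((E.contDiffAt (hz 1 one_ne_zero)).fderiv_right (m := 0) (by norm_cast)).continuousAt)
      hc).clm_apply continuousAt_const).fst.snd.snd
  -- `Ψ` is smooth across `n = 1`, so the relation `U = u U_u` at `u = 1` persists there. The boost
  -- has `U = 2` and `U_u = 1` at this point.
  have h1 := tendsto_nhds_unique_of_eventuallyEq (l := 𝓝[≠] 1)
    (c1.mono_left nhdsWithin_le_nhds) (c2.mono_left nhdsWithin_le_nhds) (by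
      filter_upwards [self_mem_nhdsWithin, nhdsWithin_le_nhds (isOpen_ne.mem_nhds one_ne_zero)]
        with n hn1 hn
      exact key n hn hn1)
  set θ := affineCoeffs (n := 1) (g := 1) one_ne_zero one_ne_zero 0 0 0 ε
  have hval : θ.val 0 = (1, 0, 1) := val_affineCoeffs _ _ _ _ _ _
  have hI1 : (fun q : Pt => (Ψ (q, θ.val q.1, Y q.1)).1) =ᶠ[𝓝 (0, 0, 1)] boost :=
    hI.mono fun q hq => congrArg Prod.fst hq
  have hb : DifferentiableAt ℝ boost (0, 0, 1) := by unfold boost; fun_prop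
  have hv := hI1.self_of_nhds
  have hd := (fderiv_substitution (w := fun r => (θ.val r, Y r))
    (by rw [hval]; exact (E.contDiffAt (hz 1 one_ne_zero)).differentiableAt (by simp))
    (hb.congr_of_eventuallyEq hI1)).1
  have hd' := hI1.fderiv_eq (𝕜 := ℝ)
  dsimp only at hd hd' hv
  rw [hd', hval] at hd
  rw [hval] at hv
  have hdu : (fderiv ℝ boost (0, 0, 1) (0, 0, 1)).2.2 = 1 := by
    have k1 := hasDerivAt_snd_comp (hasDerivAt_snd_comp (hasDerivAt_slice_trd hb))
    exact k1.unique ((hasDerivAt_id (1 : ℝ)).add_const 1)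
  dsimp only at h1
  rw [← hd, hv, hdu] at h1
  simp [boost] at h1

/-- An equivalence transformation of the class with `n = 1` which has the components of the boost
for `t` and `x` when an equation with `h = 1` is substituted. -/
theorem IsEquivalence.false_of_boost (E : IsEquivalence R (fixedClass 1) A Ω B Ψ) {ε x u : ℝ}
    {Y : ℝ → Fin A.k → ℝ} (hR : R = Set.Ioi 0 ∨ R = Set.univ) (hε : 0 < ε)
    (hY : A.IsLift (affineCoeffs (n := 1) (g := 1) one_ne_zero one_ne_zero 1 0 0 ε) Y)
    (hy : Y 0 ∈ B) (hp : (0, x, u) ∈ Ω) (hu : u ∈ R)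
    (hφ : ∀ᶠ q in 𝓝 ((0, x, u) : Pt), (Ψ (q, (1, 1, 1), Y q.1)).1.1 = q.1 ∧
      (Ψ (q, (1, 1, 1), Y q.1)).1.2.1 = q.2.1 + q.1) : False := by
  set θ := affineCoeffs (n := 1) (g := 1) one_ne_zero one_ne_zero 1 0 0 ε
  obtain ⟨θ', hθ', -, -, Ω', -, hp', H, -⟩ :=
    E.maps θ rfl Y hY _ hp (Metric.mem_ball_self hε) hu hy
  have hval : ∀ t, θ.val t = (1, 1, 1) := fun t => by simp [θ, Coeffs.val, affineCoeffs]
  have k := H.h_eq_zero (hR.imp id fun h => ⟨h, rfl, hθ'⟩) rfl hp' (by simpa only [hval] using hφ)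
  simp [θ, affineCoeffs] at k

/-- A usual transformation inducing the boost over `h = 0` has the same components for `t, x, u`
over `h = 1`, with a lift started at the same value. There the boost is not admissible, whatever
virtual elements were added. -/
theorem not_normalizedUsualVia_burgers (hR : R = Set.Ioi 0 ∨ R = Set.univ) (A : Reparam) :
    ¬NormalizedUsualVia R (fixedClass 1) A := by
  intro H
  have h1R : (1 : ℝ) ∈ R := by rcases hR with rfl | rfl <;> simp
  obtain ⟨ε, hε, Y, -, hY⟩ := exists_isLift A one_ne_zero one_ne_zero 0 0 0
  have h0 : (0 : ℝ) ∈ Metric.ball 0 ε := Metric.mem_ball_self hε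
  obtain ⟨Ω, B, Ψ, E, hU, hp, hB, hI⟩ := H _ rfl _ rfl Y Y hY hY boost _
    (isAdmissible_boost hR ε) (0, 0, 1) ⟨h0, h1R⟩
  obtain ⟨δ, hδ, Z, hZ, hZl⟩ := exists_isLift A one_ne_zero one_ne_zero 1 0 (Y 0)
  have hZB : Z 0 ∈ B := hZ ▸ hB
  have near : ∀ {W : ℝ → Fin A.k → ℝ}, ContinuousAt W 0 → W 0 ∈ B →
      ∀ᶠ q in 𝓝 ((0, 0, 1) : Pt), W q.1 ∈ B := fun hW hB =>
    (ContinuousAt.comp (f := fun q : Pt => q.1) (x := (0, 0, 1)) hW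
      continuousAt_fst).eventually_mem (E.isOpen_lift.mem_nhds hB)
  refine E.false_of_boost hR hδ hZl hZB hp h1R ?_
  filter_upwards [hI, near (hY 0 h0).continuousAt hB,
    near (hZl 0 (Metric.mem_ball_self hδ)).continuousAt hZB, E.isOpen.mem_nhds hp]
    with q hq hqY hqZ hqΩ
  rw [hU q hqΩ _ (mem_valueSpace one_ne_zero one_ne_zero 1)
    _ (mem_valueSpace one_ne_zero one_ne_zero 0) _ hqZ _ hqY]
  have hq' : (Ψ (q, (1, 0, 1), Y q.1)).1 = boost q := by
    simpa [Coeffs.val, affineCoeffs] using congrArg Prod.fst hq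
  rw [hq']
  exact ⟨rfl, rfl⟩

/-- Without virtual elements, the total derivative in `t` of a component is `∂_t + h_t ∂_h` on the
test equations, and `h_t` is arbitrary at a given point. The first-order relations for `n = 1`
therefore force `T_h = 0` and then `X_h = 0`. So the components of the boost for `t` and `x` carry
over from `h = 0` to `h = 1`. -/
theorem not_normalizedGen_burgers (hR : R = Set.Ioi 0 ∨ R = Set.univ) :
    ¬NormalizedGen R (fixedClass 1) := by
  intro H
  have h1R : (1 : ℝ) ∈ R := by rcases hR with rfl | rfl <;> simp
  have hRo : IsOpen R := by
    rcases hR with rfl | rfl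
    · exact isOpen_Ioi
    · exact isOpen_univ
  have hlift := isLift_trivial
  obtain ⟨Ω, B, Ψ, E, hp, hB, hI⟩ := H _ rfl _ rfl 0 0 (hlift _ _) (hlift _ _) boost _
    (isAdmissible_boost hR 1) (0, 0, 1) ⟨Metric.mem_ball_self one_pos, h1R⟩
  have hder : ∀ t, HasDerivAt (0 : ℝ → Fin Reparam.trivial.k → ℝ) 0 t := fun t =>
    hasDerivAt_const t 0
  have hdiff : ∀ q ∈ Ω, ∀ h : ℝ, DifferentiableAt ℝ Ψ (q, (1, h, 1), 0) := fun q hq h =>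
    (E.contDiffAt ⟨hq, mem_valueSpace one_ne_zero one_ne_zero h, hB⟩).differentiableAt (by simp)
  have key : ∀ q ∈ Ω, q.2.2 ∈ R → ∀ h : ℝ,
      (fderiv ℝ Ψ (q, (1, h, 1), 0) (0, (0, 1, 0), 0)).1.1 = 0 ∧
      (fderiv ℝ Ψ (q, (1, h, 1), 0) (0, (0, 1, 0), 0)).1.2.1 = 0 := by
    rintro ⟨t, x, u⟩ hq hu h
    -- The slope `s` of `h` is the only quantity varied. Subtracting the relations for `s = 0` from
    -- those for `s = 1` isolates the derivative in the direction of `h`.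
    have k : ∀ s, _ := fun s => (E.first_order (n := 1) (g := 1) (h := h) (s := s)
      (hn := one_ne_zero) (hg := one_ne_zero) (hR.imp id fun h => ⟨h, rfl⟩) one_pos rfl
      (hlift _ 0) (show (0 : ℝ → Fin Reparam.trivial.k → ℝ) t ∈ B from hB)
      (hder t) hq hu).2 rfl
    obtain ⟨a0, a1, a2⟩ := k 0
    obtain ⟨-, b1, b2⟩ := k 1
    have hv : (((1, 0, 0), (0, 1, 0), 0) : Reparam.trivial.Space) =
        ((1, 0, 0), (0, 0, 0), 0) + (0, (0, 1, 0), 0) := by simp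
    rw [hv, map_add] at b1 b2
    simp only [Prod.fst_add, Prod.snd_add, Pi.zero_apply] at a0 a1 a2 b1 b2
    have e1 : (fderiv ℝ Ψ ((t, x, u), (1, h, 1), 0) (0, (0, 1, 0), 0)).1.1 = 0 := by
      refine (mul_eq_zero.1 ?_).resolve_left a0
      linear_combination b1 - a1
    rw [e1] at b2
    exact ⟨e1, by linear_combination a2 - b2⟩
  have hconst : ∀ q ∈ Ω, q.2.2 ∈ R →
      (Ψ (q, (1, 1, 1), 0)).1.1 = (Ψ (q, (1, 0, 1), 0)).1.1 ∧
      (Ψ (q, (1, 1, 1), 0)).1.2.1 = (Ψ (q, (1, 0, 1), 0)).1.2.1 := by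
    intro q hq hu
    -- All real values of `h` are admitted, so the values at `h = 0` and `h = 1` are joined by a
    -- line inside the value space.
    have hl : ∀ h : ℝ, HasDerivAt (fun s : ℝ => Ψ (q, (1, s, 1), 0))
        (fderiv ℝ Ψ (q, (1, h, 1), 0) (0, (0, 1, 0), 0)) h := fun h =>
      HasFDerivAt.comp_hasDerivAt (l := Ψ) h (hdiff q hq h).hasFDerivAt
        ((hasDerivAt_const _ _).prodMk (((hasDerivAt_const _ _).prodMk
          ((hasDerivAt_id _).prodMk (hasDerivAt_const _ _))).prodMk (hasDerivAt_const _ _)))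
    constructor
    · refine eq_of_hasDerivAt_zero isOpen_univ isPreconnected_univ
        (f := fun s : ℝ => (Ψ (q, (1, s, 1), 0)).1.1) (fun s _ => ?_) trivial trivial
      rw [← (key q hq hu s).1]
      exact hasDerivAt_fst_comp (hasDerivAt_fst_comp (hl s))
    · refine eq_of_hasDerivAt_zero isOpen_univ isPreconnected_univ
        (f := fun s : ℝ => (Ψ (q, (1, s, 1), 0)).1.2.1) (fun s _ => ?_) trivial trivial
      rw [← (key q hq hu s).2]
      exact hasDerivAt_fst_comp (hasDerivAt_snd_comp (hasDerivAt_fst_comp (hl s)))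
  refine E.false_of_boost hR one_pos (hlift _ 0) hB hp h1R ?_
  filter_upwards [hI, E.isOpen.mem_nhds hp,
    (hRo.preimage (continuous_snd.comp continuous_snd)).mem_nhds
      (show ((0, 0, 1) : Pt) ∈ _ from h1R)] with q hq hqΩ hqR
  obtain ⟨c1, c2⟩ := hconst q hqΩ hqR
  simp only [Pi.zero_apply]
  rw [c1, c2]
  have hq' : (Ψ (q, (1, 0, 1), 0)).1 = boost q := by
    simpa [Coeffs.val, affineCoeffs] using congrArg Prod.fst hq
  rw [hq']
  exact ⟨rfl, rfl⟩

theorem NormalizedUsualVia.normalizedGenVia (H : NormalizedUsualVia R S A) :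
    NormalizedGenVia R S A := by
  intro θ hθ θ' hθ' Y Y' hY hY' φ Ω hφ p hp
  obtain ⟨Ω', B, Ψ, E, -, h⟩ := H θ hθ θ' hθ' Y Y' hY hY' φ Ω hφ p hp
  exact ⟨Ω', B, Ψ, E, h⟩

end Obstructions

end GBE

theorem theorem3 :
    -- the entire class is not normalized, in any of the senses
    (¬ GBE.NormalizedUsual (Set.Ioi 0) GBE.fullClass ∧
      ¬ GBE.NormalizedGen (Set.Ioi 0) GBE.fullClass ∧
      ¬ GBE.NormalizedExt (Set.Ioi 0) GBE.fullClass ∧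
      ¬ GBE.NormalizedGenExt (Set.Ioi 0) GBE.fullClass) ∧
    -- it is partitioned into the subclasses with fixed exponent
    ((⋃ n ∈ {n : ℝ | n ≠ 0}, GBE.fixedClass n) = GBE.fullClass ∧
      (∀ n : ℝ, n ≠ 0 → (GBE.fixedClass n).Nonempty) ∧
      ∀ n m : ℝ, n ≠ m → Disjoint (GBE.fixedClass n) (GBE.fixedClass m)) ∧
    -- which are not connected by point transformations
    (∀ n m : ℝ, n ≠ m →
      ¬ GBE.Connected (Set.Ioi 0) (GBE.fixedClass n) (GBE.fixedClass m)) ∧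
    -- the subclasses with `n ≠ 1`
    (∀ n : ℝ, n ≠ 0 → n ≠ 1 → GBE.NormalizedUsual (Set.Ioi 0) (GBE.fixedClass n)) ∧
    -- the subclass with `n = 1`, for positive `u` and for all real `u`
    (∀ R : Set ℝ, R = Set.Ioi 0 ∨ R = Set.univ →
      GBE.NormalizedGenExt R (GBE.fixedClass 1) ∧
      ¬ GBE.NormalizedUsual R (GBE.fixedClass 1) ∧
      ¬ GBE.NormalizedGen R (GBE.fixedClass 1) ∧
      ¬ GBE.NormalizedExt R (GBE.fixedClass 1)) ∧
    -- unions of subclasses with `n ≠ 1`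
    (∀ N : Set ℝ, 0 ∉ N → 1 ∉ N →
      GBE.NormalizedGen (Set.Ioi 0) (⋃ n ∈ N, GBE.fixedClass n)) := by
  refine ⟨⟨fun H => ?_, fun H => ?_, ?_, ?_⟩, ⟨?_, fun n hn => ?_, fun n m h => ?_⟩,
    fun n m h => GBE.not_connected h, fun n hn hn1 => GBE.normalizedUsual_fixedClass hn hn1,
    fun R hR => ⟨GBE.normalizedGenExt_burgers hR, fun H => ?_, GBE.not_normalizedGen_burgers hR,
      ?_⟩, fun N _ h1 => GBE.normalizedGen_iUnion h1⟩
  · exact GBE.not_normalizedGenVia_fullClass _ H.normalizedGenVia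
  · exact GBE.not_normalizedGenVia_fullClass _ H
  · rintro ⟨A, H⟩
    exact GBE.not_normalizedGenVia_fullClass A H.normalizedGenVia
  · rintro ⟨A, H⟩
    exact GBE.not_normalizedGenVia_fullClass A H
  · refine Set.eq_univ_of_forall fun θ => ?_
    simp only [Set.mem_iUnion]
    exact ⟨θ.n, θ.n_ne, rfl⟩
  · exact ⟨GBE.affineCoeffs hn one_ne_zero 0 0 0 1, rfl⟩
  · exact Set.disjoint_left.2 fun θ hn hm => h (hn.symm.trans hm)
  · exact GBE.not_normalizedUsualVia_burgers hR _ H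
  · rintro ⟨A, H⟩
    exact GBE.not_normalizedUsualVia_burgers hR A H
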